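/- Let $m\ge 1$ and let $P(q_1,\dots,q_m)$ be the $m$-stranded pretzel link, given by its standard diagram with $m$ vertical twist regions having $q_1,\dots,q_m\in\mathbb Z$ half twists, joined cyclically at the top and at the bottom; indices are taken modulo $m$. Assume that it is a knot $K$. A simple coloring of $K$ by permutations is a homomorphism $\varphi:\pi_1(S^3\setminus K)\to S_4$ that sends every meridian to a transposition. It is constant if all strands of the diagram get the same transposition, and it is called a simple $S_4$-coloring if its image is all of $S_4$ (equivalently, if the corresponding simple fourfold branched cover is connected); a simple $S_4$-coloring is never constant. A simple $B_4$-coloring is a homomorphism $\psi:\pi_1(S^3\setminus K)\to B_4$ that sends every meridian to a half twist, i.e. to a conjugate of some $\sigma_i^{\pm1}$. We say that $\varphi$ lifts if $\varphi=\pi\circ\psi$ for some simple $B_4$-coloring $\psi$, where $\pi:B_4\to S_4$ is the canonical epimorphism. 1. Let $m=3$. A simple $S_4$-coloring of $P(q_1,q_2,q_3)$ lifts if and only if some $q_i$ is even and, if this $q_i$ is nonzero, the transpositions of the two strands in the corresponding twist region are disjoint. (The "if" part holds for every simple coloring by permutations.) 2. Let $m$ and all $q_i$ be odd, and suppose that either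 (a) $q_j=\pm q_{j+1}$ for some $j$ with $|q_j|\ge 3$, and $|q_p|>3$ for some $p$; or (b) all $q_j$ have the same sign. Then no simple $S_4$-coloring lifts. More generally, no non-constant simple coloring by permutations lifts, except possibly when its image is not all of $S_4$ and $|q_i|=1$ for all $i$. 3. Let $m$ and $q_1$ be even and let the other $q_j$ be odd. Then every simple $S_4$-coloring lifts. So does every simple coloring by permutations if some $q_i$ is divisible by $3$. 4. Let $q_1$ be even and let $m$ and the other $q_j$ be odd. Then a simple $S_4$-coloring lifts if and only if $q_1=0$, or the transpositions of the two strands in the first twist region are disjoint, or they are identical. (The "if" part holds for every simple coloring by permutations.) -/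

import Mathlib

/-! ### Braid groups, their permutations, half twists -/

/-- The relations of the Artin presentation of the braid group on `n` strands. The generator with
index `i` is the one that exchanges the (zero-based) positions `i` and `i + 1`. -/
inductive BraidRel (n : ℕ) : FreeGroup (Fin (n - 1)) → FreeGroup (Fin (n - 1)) → Prop
  | comm (i j : Fin (n - 1)) (h : i.val + 2 ≤ j.val) :
      BraidRel n (FreeGroup.of i * FreeGroup.of j) (FreeGroup.of j * FreeGroup.of i)
  | braid (i j : Fin (n - 1)) (h : i.val + 1 = j.val) :
      BraidRel n (FreeGroup.of i * FreeGroup.of j * FreeGroup.of i)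
        (FreeGroup.of j * FreeGroup.of i * FreeGroup.of j)

/-- The braid group `B_n` on `n` strands. -/
abbrev BraidGroup (n : ℕ) : Type :=
  PresentedGroup {r : FreeGroup (Fin (n - 1)) | ∃ u v, BraidRel n u v ∧ r = u * v⁻¹}

/-- The standard generators of the braid group. -/
def BraidGroup.sigma {n : ℕ} (i : Fin (n - 1)) : BraidGroup n := PresentedGroup.of i

/-- The transposition of the positions `i` and `i + 1`. -/
def adjSwap (n : ℕ) (i : Fin (n - 1)) : Equiv.Perm (Fin n) :=
  Equiv.swap ⟨i.val, by omega⟩ ⟨i.val + 1, by omega⟩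

theorem adjSwap_rel (n : ℕ) (u v : FreeGroup (Fin (n - 1))) (h : BraidRel n u v) :
    FreeGroup.lift (adjSwap n) u = FreeGroup.lift (adjSwap n) v := by
  cases h with
  | comm i j h =>
    simp only [map_mul, FreeGroup.lift_apply_of]
    apply Equiv.Perm.Disjoint.commute
    intro x
    by_cases hx : x.val = i.val ∨ x.val = i.val + 1
    · right
      apply Equiv.swap_apply_of_ne_of_ne <;> intro hh <;> rw [Fin.ext_iff] at hh <;>
        simp only at hh <;> omega
    · left
      apply Equiv.swap_apply_of_ne_of_ne <;> intro hh <;> rw [Fin.ext_iff] at hh <;>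
        simp only at hh <;> omega
  | braid i j h =>
    simp only [map_mul, FreeGroup.lift_apply_of]
    have hj : adjSwap n j = Equiv.swap (⟨i.val + 1, by omega⟩ : Fin n) ⟨i.val + 2, by omega⟩ := by
      simp only [adjSwap, ← h, add_assoc]
    rw [hj, adjSwap, Equiv.swap_mul_swap_mul_swap, Equiv.swap_comm (⟨i.val, _⟩ : Fin n),
      Equiv.swap_comm (⟨i.val + 1, _⟩ : Fin n) ⟨i.val + 2, _⟩, Equiv.swap_mul_swap_mul_swap,
      Equiv.swap_comm]
    all_goals simp [Fin.ext_iff]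

/-- The canonical epimorphism `B_n → S_n`. -/
def BraidGroup.toPerm (n : ℕ) : BraidGroup n →* Equiv.Perm (Fin n) :=
  PresentedGroup.toGroup (f := adjSwap n) (by
    rintro r ⟨u, v, h, rfl⟩
    rw [map_mul, map_inv, adjSwap_rel n u v h, mul_inv_cancel])

/-- A half twist (of either handedness): a conjugate of a standard generator or of the inverse of
a standard generator. -/
def BraidGroup.IsHalfTwist {n : ℕ} (b : BraidGroup n) : Prop :=
  ∃ i : Fin (n - 1), IsConj (BraidGroup.sigma i) b ∨ IsConj (BraidGroup.sigma i)⁻¹ b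

/-! ### Pretzel links

The standard diagram of `P(q_1, …, q_m)`, with `m ≥ 1`, consists of `m` vertical twist regions
placed side by side and indexed by `Fin m`; the region `i` contains `|q i|` crossings on top of
each other, whose handedness is the sign of `q i`. The crossings cut the two strands of the
region into `|q i| + 1` pairs of pieces (left, right), at the levels `0` (bottom), …, `|q i|`
(top). At the top and at the bottom the right strand of each region is joined by an arc to the
left strand of the next region, cyclically. -/

/-- A piece of strand in the standard diagram of the pretzel link: a twist region, a level in that
region, and a side (`false` is left, `true` is right). -/
structure PretzelStrand {m : ℕ} (q : Fin m → ℤ) where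
  region : Fin m
  level : Fin ((q region).natAbs + 1)
  side : Bool

/-- The left piece at the given level of a region. -/
abbrev PretzelStrand.left {m : ℕ} (q : Fin m → ℤ) (i : Fin m) (l : Fin ((q i).natAbs + 1)) :
    PretzelStrand q := ⟨i, l, false⟩

/-- The right piece at the given level of a region. -/
abbrev PretzelStrand.right {m : ℕ} (q : Fin m → ℤ) (i : Fin m) (l : Fin ((q i).natAbs + 1)) :
    PretzelStrand q := ⟨i, l, true⟩

section

open PretzelStrand

/-- Two pieces of strand that follow each other along the link. -/
inductive PretzelStrand.Joined {m : ℕ} [NeZero m] (q : Fin m → ℤ) :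
    PretzelStrand q → PretzelStrand q → Prop
  | crossing_left (i : Fin m) (l : Fin (q i).natAbs) :
      Joined q (left q i l.castSucc) (right q i l.succ)
  | crossing_right (i : Fin m) (l : Fin (q i).natAbs) :
      Joined q (right q i l.castSucc) (left q i l.succ)
  | bottom (i : Fin m) : Joined q (right q i 0) (left q (i + 1) 0)
  | top (i : Fin m) : Joined q (right q i (Fin.last _)) (left q (i + 1) (Fin.last _))

/-- The pretzel link is a knot: it has only one component. -/
def IsPretzelKnot {m : ℕ} [NeZero m] (q : Fin m → ℤ) : Prop :=
  ∀ s t : PretzelStrand q, Relation.EqvGen (PretzelStrand.Joined q) s t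

/-- The Wirtinger relations of the standard diagram. The generator of a piece is its meridian,
where every piece is oriented upwards in its twist region; the arcs at the bottom and at the top
reverse this orientation, so there the meridian is inverted. At a crossing of a region with `q i`
positive the strand from the lower left passes over, at one with `q i` negative the strand from
the lower right does. -/
inductive WirtingerRel {m : ℕ} [NeZero m] (q : Fin m → ℤ) :
    FreeGroup (PretzelStrand q) → FreeGroup (PretzelStrand q) → Prop
  | pos_over (i : Fin m) (l : Fin (q i).natAbs) (h : 0 < q i) :
      WirtingerRel q (.of (right q i l.succ)) (.of (left q i l.castSucc))
  | pos_under (i : Fin m) (l : Fin (q i).natAbs) (h : 0 < q i) :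
      WirtingerRel q (.of (left q i l.succ))
        ((.of (left q i l.castSucc))⁻¹ * .of (right q i l.castSucc) * .of (left q i l.castSucc))
  | neg_over (i : Fin m) (l : Fin (q i).natAbs) (h : q i < 0) :
      WirtingerRel q (.of (left q i l.succ)) (.of (right q i l.castSucc))
  | neg_under (i : Fin m) (l : Fin (q i).natAbs) (h : q i < 0) :
      WirtingerRel q (.of (right q i l.succ))
        (.of (right q i l.castSucc) * .of (left q i l.castSucc) * (.of (right q i l.castSucc))⁻¹)
  | bottom (i : Fin m) :
      WirtingerRel q (.of (right q i 0)) (.of (left q (i + 1) 0))⁻¹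
  | top (i : Fin m) :
      WirtingerRel q (.of (right q i (Fin.last _))) (.of (left q (i + 1) (Fin.last _)))⁻¹

end

/-- The link group of the pretzel link (the fundamental group of its complement), by the Wirtinger
presentation of the standard diagram. -/
abbrev PretzelGroup {m : ℕ} [NeZero m] (q : Fin m → ℤ) : Type :=
  PresentedGroup {r : FreeGroup (PretzelStrand q) | ∃ u v, WirtingerRel q u v ∧ r = u * v⁻¹}

/-- The meridian of a piece of strand, oriented upwards in its twist region. -/
def PretzelGroup.meridian {m : ℕ} [NeZero m] {q : Fin m → ℤ} (s : PretzelStrand q) :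
    PretzelGroup q := PresentedGroup.of s

section

open PretzelGroup

/-! ### Colorings -/

variable {m : ℕ} [NeZero m] {q : Fin m → ℤ}

/-- A `G`-coloring is a homomorphism from the link group to `G`. An `S_4`-coloring by
transpositions is constant if all pieces of strand have the same color (the orientations of the
pieces do not matter, as transpositions are involutions). -/
def IsConstantColoring (φ : PretzelGroup q →* Equiv.Perm (Fin 4)) : Prop :=
  ∀ s t : PretzelStrand q, φ (meridian s) = φ (meridian t)

/-- Every meridian goes to a transposition. -/
def IsSimplePermColoring (φ : PretzelGroup q →* Equiv.Perm (Fin 4)) : Prop :=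
  ∀ s : PretzelStrand q, (φ (meridian s)).IsSwap

/-- Every meridian goes to a half twist. -/
def IsSimpleBraidColoring (ψ : PretzelGroup q →* BraidGroup 4) : Prop :=
  ∀ s : PretzelStrand q, BraidGroup.IsHalfTwist (ψ (meridian s))

/-- The `S_4`-coloring lifts to a simple `B_4`-coloring. -/
def LiftsToSimpleBraidColoring (φ : PretzelGroup q →* Equiv.Perm (Fin 4)) : Prop :=
  ∃ ψ : PretzelGroup q →* BraidGroup 4,
    IsSimpleBraidColoring ψ ∧ (BraidGroup.toPerm 4).comp ψ = φ

/-- At every level of the twist region `i` the colors of the two strands are disjoint. -/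
def DisjointInRegion (φ : PretzelGroup q →* Equiv.Perm (Fin 4)) (i : Fin m) : Prop :=
  ∀ l, (φ (meridian (.left q i l))).Disjoint (φ (meridian (.right q i l)))

/-- At every level of the twist region `i` the colors of the two strands are identical. -/
def IdenticalInRegion (φ : PretzelGroup q →* Equiv.Perm (Fin 4)) (i : Fin m) : Prop :=
  ∀ l, φ (meridian (.left q i l)) = φ (meridian (.right q i l))

end

/-! A coloring is determined by the colors xᵢ of the lower left strands. Region i applies a power of
`crossing` to (xᵢ, xᵢ₊₁⁻¹), and the result must have the form (yᵢ, yᵢ₊₁⁻¹). Twisting preserves the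
product of the two colors of a region, so C = yᵢ xᵢ⁻¹ does not depend on i (`topColor_mul_inv`).

Lifting. In S₄ every xᵢ conjugates C to its inverse, so C = 1 for a surjective coloring; C = 1 also
follows from suitable divisibility or commutation in the regions. If C = 1, each region fixes its
pair of transpositions. Replace a transposition by the half twist along the corresponding edge of a
complete graph drawn in the plane: half twists of disjoint edges commute and those of adjacent edges
are braided, so the same powers of `crossing` fix them, provided that both strands of a region get
the same exponent ±1. This means that the exponents of the bottom colors alternate around the
diagram, which is possible for even m. For odd m one region must break the alternation; this is
harmless if it has no crossings, or an even number and commuting colors (`lifts_of_topColor_eq`).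

Obstruction for surjective colorings. Let ψ be a lift and map B₄ to SL₂(ℤ), half twists going to
transvections with primitive vectors uᵢ (bottom) and vᵢ (top). The trace of C shows that the square
of the area of (uᵢ, vᵢ) is independent of i. If the area is nonzero, the reduced Burau
representation over ℤ[T;T⁻¹] confines the vectors of all bottom colors to one plane: the covector
vanishing on the bottom and top vectors of one region is fixed by C, and comparing its images in any
other region shows that it vanishes on that bottom vector too. At t = 1 these vectors become roots
of S₄, and roots in a plane do not generate S₄. So the area is zero
(`areaForm_eq_zero_of_surjective`). Inside a region with equal exponents e the vectors are
combinations of uᵢ and uᵢ₊₁ with Fibonacci polynomials as coefficients. These do not vanish, so uᵢ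
and uᵢ₊₁ are parallel, and reduction modulo 2 makes the transpositions commute
(`commute_of_areaForm_eq_zero`).

Obstruction with m and all qᵢ odd. A non-constant lifted coloring has nonzero area ±N in every
region. The pairs pᵢ = (uᵢ, ±vᵢ) are then nodes of a closed walk in a lattice with an automorphism J
satisfying J² = N J - 1: region i is a step F p' = ±(J + f) p, or the same with p and p' exchanged,
according to the sign of qᵢ. Steps in one direction never return, as positivity of coefficients
shows (`not_closed_zero_of_fwd_eq`). For N ≥ 3 a closed walk has even length (`even_length_add`):
unit steps are absorbed by powers of J, backtracking steps cancel, and divisibility excludes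
everything else. This contradicts m odd. -/

/-! ### Crossings acting on pairs of group elements -/

/-- The effect of a positive crossing on the pair of colors (left, right) of its strands. -/
def crossing (G : Type*) [Group G] : Equiv.Perm (G × G) where
  toFun p := (p.1⁻¹ * p.2 * p.1, p.1)
  invFun p := (p.2, p.2 * p.1 * p.2⁻¹)
  left_inv p := by ext <;> simp [mul_assoc]
  right_inv p := by ext <;> simp [mul_assoc]

section

variable {G H : Type*} [Group G] [Group H]

theorem crossing_apply (a b : G) : crossing G (a, b) = (a⁻¹ * b * a, a) := rfl

theorem crossing_inv_apply (a b : G) : (crossing G)⁻¹ (a, b) = (b, b * a * b⁻¹) := rfl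

theorem crossing_zpow_succ (k : ℤ) (p : G × G) :
    (crossing G ^ (k + 1)) p = crossing G ((crossing G ^ k) p) := by
  rw [add_comm, zpow_add, zpow_one]; rfl

theorem crossing_zpow_pred (k : ℤ) (p : G × G) :
    (crossing G ^ (k - 1)) p = (crossing G)⁻¹ ((crossing G ^ k) p) := by
  rw [sub_eq_add_neg, add_comm, zpow_add, zpow_neg_one]; rfl

theorem crossing_zpow_invariant {α : Sort*} (f : G × G → α) (h : ∀ p, f (crossing G p) = f p)
    (k : ℤ) (p : G × G) : f ((crossing G ^ k) p) = f p := by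
  induction k using Int.induction_on with
  | zero => rfl
  | succ k ih => rw [crossing_zpow_succ, h, ih]
  | pred k ih => rw [crossing_zpow_pred, ← ih, ← h ((crossing G)⁻¹ _), ← Equiv.Perm.mul_apply,
      mul_inv_cancel, Equiv.Perm.one_apply]

/-- The product is the color of a loop around both strands of the region, which no crossing changes.
-/
theorem crossing_zpow_mul (k : ℤ) (p : G × G) :
    ((crossing G ^ k) p).2 * ((crossing G ^ k) p).1 = p.2 * p.1 :=
  crossing_zpow_invariant (fun p : G × G => p.2 * p.1)
    (fun p => by simp [crossing, mul_assoc]) k p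

theorem crossing_zpow_map (f : G →* H) (k : ℤ) (p : G × G) :
    Prod.map f f ((crossing G ^ k) p) = (crossing H ^ k) (Prod.map f f p) := by
  induction k using Int.induction_on with
  | zero => rfl
  | succ k ih => rw [crossing_zpow_succ, crossing_zpow_succ, ← ih]; ext <;> simp [crossing]
  | pred k ih => rw [crossing_zpow_pred, crossing_zpow_pred, ← ih]; ext <;> simp [crossing]

theorem crossing_zpow_conj_closed (S : G → Prop) (hS : ∀ a b, S a → S (b * a * b⁻¹)) (k : ℤ)
    (p : G × G) (h1 : S p.1) (h2 : S p.2) :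
    S ((crossing G ^ k) p).1 ∧ S ((crossing G ^ k) p).2 := by
  rw [crossing_zpow_invariant (fun p : G × G => S p.1 ∧ S p.2) _ k p]
  · exact ⟨h1, h2⟩
  · rintro ⟨a, b⟩
    simp only [crossing_apply, eq_iff_iff]
    constructor
    · rintro ⟨h, h'⟩
      refine ⟨h', ?_⟩
      simpa [mul_assoc] using hS _ a h
    · rintro ⟨h, h'⟩
      refine ⟨?_, h⟩
      simpa [mul_assoc] using hS _ a⁻¹ h'

theorem crossing_zpow_mem (K : Subgroup G) (k : ℤ)
    (p : G × G) (h1 : p.1 ∈ K) (h2 : p.2 ∈ K) :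
    ((crossing G ^ k) p).1 ∈ K ∧ ((crossing G ^ k) p).2 ∈ K := by
  rw [crossing_zpow_invariant (fun p : G × G => p.1 ∈ K ∧ p.2 ∈ K) _ k p]
  · exact ⟨h1, h2⟩
  · rintro ⟨a, b⟩
    simp only [crossing_apply, eq_iff_iff]
    constructor
    · rintro ⟨h, h'⟩
      refine ⟨h', ?_⟩
      simpa [mul_assoc] using K.mul_mem (K.mul_mem h' h) (K.inv_mem h')
    · rintro ⟨h, h'⟩
      exact ⟨K.mul_mem (K.mul_mem (K.inv_mem h) h') h, h⟩

theorem crossing_zpow_of_commute_even {a b : G} (h : a * b = b * a) {k : ℤ} (hk : Even k) :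
    (crossing G ^ k) (a, b) = (a, b) := by
  obtain ⟨j, rfl⟩ := hk
  have : (crossing G * crossing G) (a, b) = (a, b) := by
    have h1 : a⁻¹ * b * a = b := by rw [mul_assoc, ← h]; simp
    have h2 : b⁻¹ * a * b = a := by rw [mul_assoc, h]; simp
    simp [crossing_apply, h1, h2]
  rw [← two_mul, zpow_mul, zpow_two]
  exact Function.IsFixedPt.perm_zpow this j

theorem crossing_zpow_of_commute_odd {a b : G} (h : a * b = b * a) {k : ℤ} (hk : Odd k) :
    (crossing G ^ k) (a, b) = (b, a) := by
  obtain ⟨j, rfl⟩ := hk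
  rw [crossing_zpow_succ, crossing_zpow_of_commute_even h (even_two_mul j), crossing_apply]
  rw [mul_assoc, ← h]; simp

theorem crossing_zpow_self (a : G) (k : ℤ) : (crossing G ^ k) (a, a) = (a, a) := by
  rcases Int.even_or_odd k with h | h
  · exact crossing_zpow_of_commute_even rfl h
  · exact crossing_zpow_of_commute_odd rfl h

/-- Three crossings lead through (b a b⁻¹, a) and (b, b a b⁻¹) back to (a, b). -/
theorem crossing_zpow_of_braid {a b : G} (h : a * b * a = b * a * b) {k : ℤ} (hk : 3 ∣ k) :
    (crossing G ^ k) (a, b) = (a, b) := by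
  obtain ⟨j, rfl⟩ := hk
  have : (crossing G ^ (3 : ℕ)) (a, b) = (a, b) := by
    have h1 : a⁻¹ * b * a = b * a * b⁻¹ := by
      rw [eq_mul_inv_iff_mul_eq, mul_assoc, mul_assoc, ← mul_assoc b, ← h]; simp [mul_assoc]
    have h2 : (b * a * b⁻¹)⁻¹ * a * (b * a * b⁻¹) = b := by
      have : b⁻¹ * (a * b * a) * b⁻¹ = a := by rw [h]; simp [mul_assoc]
      calc (b * a * b⁻¹)⁻¹ * a * (b * a * b⁻¹) = b * a⁻¹ * (b⁻¹ * (a * b * a) * b⁻¹) := by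
            simp [mul_assoc]
        _ = b := by rw [this]; simp
    simp only [pow_succ, pow_zero, one_mul, Equiv.Perm.mul_apply, crossing_apply, h1, h2]
    simp [mul_assoc]
  rw [zpow_mul]
  exact Function.IsFixedPt.perm_zpow this j

theorem crossing_zpow_fst_mul_fst_inv (k : ℤ) (a b : G) :
    ((crossing G ^ k) (a, b⁻¹)).1 * a⁻¹ = ((crossing G ^ k) (a, b⁻¹)).2⁻¹ * b⁻¹ := by
  have := crossing_zpow_mul k (a, b⁻¹)
  rw [mul_inv_eq_iff_eq_mul, mul_assoc, ← this]; simp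

end

/-! ### Colorings of pretzel links -/

section

open PretzelStrand PretzelGroup

variable {m : ℕ} [NeZero m] {q : Fin m → ℤ} {G : Type*} [Group G]

/-- The color of the lower left piece of strand of a twist region. -/
def bottomColor (φ : PretzelGroup q →* G) (i : Fin m) : G := φ (meridian (left q i 0))

/-- The color of the upper left piece of strand of a twist region. -/
def topColor (φ : PretzelGroup q →* G) (i : Fin m) : G := φ (meridian (left q i (Fin.last _)))

theorem map_wirtingerRel (φ : PretzelGroup q →* G) {u v : FreeGroup (PretzelStrand q)}
    (h : WirtingerRel q u v) :
    FreeGroup.lift (fun s => φ (meridian s)) u = FreeGroup.lift (fun s => φ (meridian s)) v := by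
  have e : ∀ w : FreeGroup (PretzelStrand q),
      FreeGroup.lift (fun s => φ (meridian s)) w = φ (PresentedGroup.mk _ w) := by
    intro w
    have : FreeGroup.lift (fun s => φ (meridian s)) = φ.comp (PresentedGroup.mk _) := by
      ext s; simp [meridian, PresentedGroup.of]
    rw [this]; rfl
  rw [e, e]
  congr 1
  have := PresentedGroup.one_of_mem (rels := {r | ∃ u v, WirtingerRel q u v ∧ r = u * v⁻¹})
    (x := u * v⁻¹) ⟨u, v, h, rfl⟩
  rwa [map_mul, map_inv, mul_inv_eq_one] at this

theorem map_right_zero (φ : PretzelGroup q →* G) (i : Fin m) :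
    φ (meridian (right q i 0)) = (bottomColor φ (i + 1))⁻¹ := by
  simpa [bottomColor] using map_wirtingerRel φ (.bottom i)

theorem map_right_last (φ : PretzelGroup q →* G) (i : Fin m) :
    φ (meridian (right q i (Fin.last _))) = (topColor φ (i + 1))⁻¹ := by
  simpa [topColor] using map_wirtingerRel φ (.top i)

theorem map_level_succ (φ : PretzelGroup q →* G) (i : Fin m) (l : Fin (q i).natAbs) :
    (φ (meridian (left q i l.succ)), φ (meridian (right q i l.succ))) =
      (crossing G ^ (q i).sign)
        (φ (meridian (left q i l.castSucc)), φ (meridian (right q i l.castSucc))) := by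
  rcases lt_trichotomy (q i) 0 with h | h | h
  · rw [Int.sign_eq_neg_one_of_neg h, zpow_neg_one, crossing_inv_apply]
    have h1 := map_wirtingerRel φ (.neg_over i l h)
    have h2 := map_wirtingerRel φ (.neg_under i l h)
    simp only [map_mul, map_inv, FreeGroup.lift_apply_of] at h1 h2
    rw [h1, h2]
  · exact absurd l.pos (by simp [h])
  · rw [Int.sign_eq_one_of_pos h, zpow_one, crossing_apply]
    have h1 := map_wirtingerRel φ (.pos_over i l h)
    have h2 := map_wirtingerRel φ (.pos_under i l h)
    simp only [map_mul, map_inv, FreeGroup.lift_apply_of] at h1 h2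
    rw [h1, h2]

theorem map_level (φ : PretzelGroup q →* G) (i : Fin m) (l : Fin ((q i).natAbs + 1)) :
    (φ (meridian (left q i l)), φ (meridian (right q i l))) =
      (crossing G ^ ((q i).sign * (l.val : ℤ))) (bottomColor φ i, (bottomColor φ (i + 1))⁻¹) := by
  induction l using Fin.induction with
  | zero => simp [map_right_zero, bottomColor]
  | succ l ih =>
    rw [map_level_succ, ih, ← Equiv.Perm.mul_apply, ← zpow_add]
    congr 2
    simp only [Fin.val_castSucc, Fin.val_succ]; push_cast; ring

/-- With `exists_hom_of_bottomColor` as converse, this reduces the Wirtinger presentation to one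
equation for each region. -/
theorem crossing_zpow_bottomColor (φ : PretzelGroup q →* G) (i : Fin m) :
    (crossing G ^ q i) (bottomColor φ i, (bottomColor φ (i + 1))⁻¹) =
      (topColor φ i, (topColor φ (i + 1))⁻¹) := by
  have := map_level φ i (Fin.last _)
  rw [map_right_last] at this
  rw [Fin.val_last, Int.sign_mul_natAbs] at this
  exact this.symm

theorem Fin.eq_of_forall_add_one {α : Type*} (f : Fin m → α) (h : ∀ i, f (i + 1) = f i)
    (i j : Fin m) : f i = f j := by
  have key : ∀ n : ℕ, f (Fin.ofNat m n) = f 0 := by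
    intro n
    induction n with
    | zero => rfl
    | succ n ih =>
      rw [← ih, ← h (Fin.ofNat m n)]
      congr 1
      ext; simp [Fin.val_add]
  have := key i.val
  have h2 := key j.val
  simp only [Fin.ofNat_val_eq_self] at this h2
  rw [this, h2]

/-- Invariance of the product in region i equates the quotients of its left strand and of the left
strand of region i + 1; then go around the cycle. -/
theorem topColor_mul_inv (φ : PretzelGroup q →* G) (i j : Fin m) :
    topColor φ i * (bottomColor φ i)⁻¹ = topColor φ j * (bottomColor φ j)⁻¹ := by
  refine Fin.eq_of_forall_add_one (fun i => topColor φ i * (bottomColor φ i)⁻¹) (fun i => ?_) i j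
  have := crossing_zpow_fst_mul_fst_inv (q i) (bottomColor φ i) (bottomColor φ (i + 1))
  rw [crossing_zpow_bottomColor] at this
  simp only at this ⊢
  rw [this, inv_inv]

theorem map_mem_of_bottomColor_mem (φ : PretzelGroup q →* G) (K : Subgroup G)
    (h : ∀ i, bottomColor φ i ∈ K) (g : PretzelGroup q) : φ g ∈ K := by
  have hg : g ∈ Subgroup.closure (Set.range
      (PresentedGroup.of (rels := {r | ∃ u v, WirtingerRel q u v ∧ r = u * v⁻¹}))) := by
    rw [PresentedGroup.closure_range_of]; trivial
  have : Subgroup.closure (Set.range (PresentedGroup.of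
      (rels := {r | ∃ u v, WirtingerRel q u v ∧ r = u * v⁻¹}))) ≤ K.comap φ := by
    rw [Subgroup.closure_le]
    rintro _ ⟨⟨i, l, s⟩, rfl⟩
    have h1 := crossing_zpow_mem K ((q i).sign * (l.val : ℤ))
      (bottomColor φ i, (bottomColor φ (i + 1))⁻¹) (h i) (K.inv_mem (h (i + 1)))
    rw [← map_level] at h1
    cases s
    · exact h1.1
    · exact h1.2
  exact this hg

theorem pretzelGroup_hom_ext {φ ψ : PretzelGroup q →* G}
    (h : ∀ i, bottomColor φ i = bottomColor ψ i) : φ = ψ := by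
  refine PresentedGroup.ext fun ⟨i, l, s⟩ => ?_
  have h1 := map_level φ i l
  rw [h, h, ← map_level ψ i l, Prod.mk.injEq] at h1
  cases s
  · exact h1.1
  · exact h1.2

theorem exists_hom_of_bottomColor (x y : Fin m → G)
    (h : ∀ i, (crossing G ^ q i) (x i, (x (i + 1))⁻¹) = (y i, (y (i + 1))⁻¹)) :
    ∃ φ : PretzelGroup q →* G, ∀ i, bottomColor φ i = x i := by
  set f : PretzelStrand q → G := fun s => bif s.side then
    ((crossing G ^ ((q s.region).sign * (s.level.val : ℤ)))
      (x s.region, (x (s.region + 1))⁻¹)).2 else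
    ((crossing G ^ ((q s.region).sign * (s.level.val : ℤ)))
      (x s.region, (x (s.region + 1))⁻¹)).1 with hf
  have hpair : ∀ i l, (f (left q i l), f (right q i l)) =
      (crossing G ^ ((q i).sign * (l.val : ℤ))) (x i, (x (i + 1))⁻¹) := fun i l => rfl
  have hsucc : ∀ i (l : Fin (q i).natAbs), (f (left q i l.succ), f (right q i l.succ)) =
      (crossing G ^ (q i).sign) (f (left q i l.castSucc), f (right q i l.castSucc)) := by
    intro i l
    rw [hpair, hpair, ← Equiv.Perm.mul_apply, ← zpow_add]
    congr 2
    simp only [Fin.val_castSucc, Fin.val_succ]; push_cast; ring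
  have hzero : ∀ i, (f (left q i 0), f (right q i 0)) = (x i, (x (i + 1))⁻¹) := by
    intro i; rw [hpair]; simp
  have hlast : ∀ i, (f (left q i (Fin.last _)), f (right q i (Fin.last _))) =
      (y i, (y (i + 1))⁻¹) := by
    intro i; rw [hpair, Fin.val_last, Int.sign_mul_natAbs, h]
  have hrel : ∀ r ∈ {r : FreeGroup (PretzelStrand q) | ∃ u v, WirtingerRel q u v ∧ r = u * v⁻¹},
      FreeGroup.lift f r = 1 := by
    rintro r ⟨u, v, huv, rfl⟩
    rw [map_mul, map_inv, mul_inv_eq_one]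
    cases huv with
    | pos_over i l hq =>
      have := hsucc i l
      rw [Int.sign_eq_one_of_pos hq, zpow_one, crossing_apply, Prod.mk.injEq] at this
      simp [this.2]
    | pos_under i l hq =>
      have := hsucc i l
      rw [Int.sign_eq_one_of_pos hq, zpow_one, crossing_apply, Prod.mk.injEq] at this
      simp [this.1]
    | neg_over i l hq =>
      have := hsucc i l
      rw [Int.sign_eq_neg_one_of_neg hq, zpow_neg_one, crossing_inv_apply, Prod.mk.injEq] at this
      simp [this.1]
    | neg_under i l hq =>
      have := hsucc i l
      rw [Int.sign_eq_neg_one_of_neg hq, zpow_neg_one, crossing_inv_apply, Prod.mk.injEq] at this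
      simp [this.2]
    | bottom i =>
      have h1 := hzero i
      have h2 := hzero (i + 1)
      rw [Prod.mk.injEq] at h1 h2
      simp [h1.2, h2.1]
    | top i =>
      have h1 := hlast i
      have h2 := hlast (i + 1)
      rw [Prod.mk.injEq] at h1 h2
      simp [h1.2, h2.1]
  refine ⟨PresentedGroup.toGroup hrel, fun i => ?_⟩
  have h1 := hzero i
  rw [Prod.mk.injEq] at h1
  rw [← h1.1]
  exact PresentedGroup.toGroup.of hrel

end

/-! ### Half twists along the edges of a planar complete graph -/

namespace BraidGroup

theorem sigma_comm {n : ℕ} (i j : Fin (n - 1)) (h : i.val + 2 ≤ j.val) :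
    sigma i * sigma j = (sigma j * sigma i : BraidGroup n) := by
  have := PresentedGroup.one_of_mem (rels := {r | ∃ u v, BraidRel n u v ∧ r = u * v⁻¹})
    ⟨_, _, .comm i j h, rfl⟩
  rwa [map_mul, map_inv, mul_inv_eq_one, map_mul, map_mul] at this

theorem sigma_braid {n : ℕ} (i j : Fin (n - 1)) (h : i.val + 1 = j.val) :
    sigma i * sigma j * sigma i = (sigma j * sigma i * sigma j : BraidGroup n) := by
  have := PresentedGroup.one_of_mem (rels := {r | ∃ u v, BraidRel n u v ∧ r = u * v⁻¹})
    ⟨_, _, .braid i j h, rfl⟩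
  rwa [map_mul, map_inv, mul_inv_eq_one, map_mul, map_mul, map_mul, map_mul] at this

theorem toPerm_sigma {n : ℕ} (i : Fin (n - 1)) : toPerm n (sigma i) = adjSwap n i :=
  PresentedGroup.toGroup.of _

theorem IsHalfTwist.conj {n : ℕ} {b : BraidGroup n} (hb : IsHalfTwist b) (g : BraidGroup n) :
    IsHalfTwist (g * b * g⁻¹) := by
  obtain ⟨i, h⟩ := hb
  have : IsConj b (g * b * g⁻¹) := isConj_iff.2 ⟨g, rfl⟩
  exact ⟨i, h.imp (·.trans this) (·.trans this)⟩

theorem IsHalfTwist.inv {n : ℕ} {b : BraidGroup n} (hb : IsHalfTwist b) : IsHalfTwist b⁻¹ := by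
  obtain ⟨i, h⟩ := hb
  refine ⟨i, h.symm.imp (fun h => ?_) (fun h => ?_)⟩ <;>
  · obtain ⟨g, hg⟩ := isConj_iff.1 h
    exact isConj_iff.2 ⟨g, by rw [← hg]; simp [mul_assoc]⟩

theorem isHalfTwist_sigma {n : ℕ} (i : Fin (n - 1)) : IsHalfTwist (sigma i : BraidGroup n) :=
  ⟨i, .inl (IsConj.refl _)⟩

end BraidGroup

/-- The braid relation. -/
def Braided {G : Type*} [Mul G] (a b : G) : Prop := a * b * a = b * a * b

section

variable {G : Type*} [Group G] {a b : G}

theorem Braided.symm (h : Braided a b) : Braided b a := Eq.symm h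

theorem Braided.conj_eq (h : Braided a b) : b⁻¹ * a * b = a * b * a⁻¹ := by
  unfold Braided at h
  rw [eq_mul_inv_iff_mul_eq, mul_assoc, mul_assoc, ← mul_assoc a, h]; simp [mul_assoc]

theorem braided_conj_iff (g : G) : Braided (g * a * g⁻¹) (g * b * g⁻¹) ↔ Braided a b := by
  unfold Braided
  constructor
  · intro h
    have := congrArg (fun x => g⁻¹ * x * g) h
    simpa [mul_assoc] using this
  · intro h
    have := congrArg (fun x => g * x * g⁻¹) h
    simpa [mul_assoc] using this

theorem braided_conj_iff' (g : G) : Braided (g⁻¹ * a * g) (g⁻¹ * b * g) ↔ Braided a b := by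
  simpa using braided_conj_iff (a := a) (b := b) g⁻¹

theorem Braided.inv (h : Braided a b) : Braided a⁻¹ b⁻¹ := by
  have := congrArg (·⁻¹) h
  simpa [Braided, mul_assoc] using this

theorem Braided.zpow (h : Braided a b) {e : ℤ} (he : e = 1 ∨ e = -1) :
    Braided (a ^ e) (b ^ e) := by
  rcases he with rfl | rfl
  · simpa using h
  · simpa using h.inv

theorem Commute.conj_iff' (g : G) : Commute (g⁻¹ * a * g) (g⁻¹ * b * g) ↔ Commute a b := by
  have := Commute.conj_iff (a := a) (b := b) g⁻¹
  simpa using this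

variable {c : G}

theorem Braided.conj_mid (hab : Braided a b) : Braided (b⁻¹ * a * b) b := by
  have := (braided_conj_iff' (a := a) (b := b) b).2 hab
  simpa using this

theorem Braided.conj_left (hab : Braided a b) : Braided (b⁻¹ * a * b) a := by
  rw [hab.conj_eq]
  have := (braided_conj_iff (a := b) (b := a) a).2 hab.symm
  simpa using this

theorem Braided.conj_right (hab : Braided a b) (hbc : Braided b c) (hac : Commute a c) :
    Braided (b⁻¹ * a * b) c := by
  rw [← braided_conj_iff b, show b * (b⁻¹ * a * b) * b⁻¹ = a by simp [mul_assoc],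
    ← hbc.conj_eq, ← braided_conj_iff c, show c * a * c⁻¹ = a by rw [← hac.eq]; simp,
    show c * (c⁻¹ * b * c) * c⁻¹ = b by simp [mul_assoc]]
  exact hab

/-- The relations between the half twists along the edges `13`, `24`, `14` and the standard
generators `12`, `23`, `34`. -/
theorem braided_edges (hab : Braided a b) (hbc : Braided b c) (hac : Commute a c) :
    Commute (b⁻¹ * a * b) (b⁻¹ * c * b) ∧ Commute (c⁻¹ * (b⁻¹ * a * b) * c) b ∧
    Braided (c⁻¹ * (b⁻¹ * a * b) * c) a ∧ Braided (c⁻¹ * (b⁻¹ * a * b) * c) c ∧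
    Braided (c⁻¹ * (b⁻¹ * a * b) * c) (b⁻¹ * a * b) ∧
    Braided (c⁻¹ * (b⁻¹ * a * b) * c) (b⁻¹ * c * b) := by
  have h13c := hab.conj_right hbc hac
  have hcom : Commute (b⁻¹ * a * b) (b⁻¹ * c * b) := (Commute.conj_iff' b).2 hac
  refine ⟨hcom, ?_, ?_, h13c.conj_mid, h13c.conj_left, ?_⟩
  · have h : b * c * b * c⁻¹ * b⁻¹ = c := by
      have : b * c * b = c * b * c := hbc
      rw [this]; simp
    rw [← Commute.conj_iff (b * c)]
    have e1 : b * c * (c⁻¹ * (b⁻¹ * a * b) * c) * (b * c)⁻¹ = a := by simp [mul_assoc]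
    have e2 : b * c * b * (b * c)⁻¹ = c := by rw [mul_inv_rev, ← mul_assoc, h]
    rw [e1, e2]; exact hac
  · have e : c⁻¹ * (b⁻¹ * a * b) * c = a * (b * c * b⁻¹) * a⁻¹ := by
      rw [hab.conj_eq, ← hbc.conj_eq]
      have h1 : c⁻¹ * a = a * c⁻¹ := (hac.symm.inv_left).eq
      have h2 : a⁻¹ * c = c * a⁻¹ := (hac.inv_left).eq
      calc c⁻¹ * (a * b * a⁻¹) * c = c⁻¹ * a * b * (a⁻¹ * c) := by simp [mul_assoc]
        _ = _ := by rw [h1, h2]; simp [mul_assoc]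
    rw [e]
    have h : Braided (b * c * b⁻¹) a := by
      rw [← braided_conj_iff' b]
      rw [show b⁻¹ * (b * c * b⁻¹) * b = c by simp [mul_assoc]]
      exact h13c.symm
    have := (braided_conj_iff a).2 h
    simpa using this
  · rw [h13c.conj_eq, ← braided_conj_iff' (b⁻¹ * a * b)]
    have e1 : (b⁻¹ * a * b)⁻¹ * ((b⁻¹ * a * b) * c * (b⁻¹ * a * b)⁻¹) * (b⁻¹ * a * b) = c := by
      simp [mul_assoc]
    have e2 : (b⁻¹ * a * b)⁻¹ * (b⁻¹ * c * b) * (b⁻¹ * a * b) = b⁻¹ * c * b := by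
      rw [mul_assoc, ← hcom.eq]; simp [mul_assoc]
    rw [e1, e2]
    exact hbc.symm.conj_left.symm

end

/-! ### Half twists that imitate transpositions -/

section

open BraidGroup Equiv

/-- Half twists along the edges of a complete graph that is embedded in the plane, one for each
transposition. -/
noncomputable def edgeTwist (π : Perm (Fin 4)) : BraidGroup 4 :=
  let a : BraidGroup 4 := sigma (n := 4) 0
  let b : BraidGroup 4 := sigma (n := 4) 1
  let c : BraidGroup 4 := sigma (n := 4) 2
  if π = swap 0 1 then a else if π = swap 1 2 then b else if π = swap 2 3 then c else
  if π = swap 0 2 then b⁻¹ * a * b else if π = swap 1 3 then b⁻¹ * c * b else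
  c⁻¹ * (b⁻¹ * a * b) * c

theorem isSwap_four {π : Perm (Fin 4)} (h : π.IsSwap) :
    π = swap 0 1 ∨ π = swap 1 2 ∨ π = swap 2 3 ∨ π = swap 0 2 ∨ π = swap 1 3 ∨ π = swap 0 3 := by
  obtain ⟨x, y, hxy, rfl⟩ := h
  revert x y; decide

theorem edgeTwist_cases {π : Perm (Fin 4)} (h : π.IsSwap) {a b c : BraidGroup 4}
    (ha : a = sigma (n := 4) 0) (hb : b = sigma (n := 4) 1) (hc : c = sigma (n := 4) 2) :
    (π = swap 0 1 ∧ edgeTwist π = a) ∨ (π = swap 1 2 ∧ edgeTwist π = b) ∨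
    (π = swap 2 3 ∧ edgeTwist π = c) ∨ (π = swap 0 2 ∧ edgeTwist π = b⁻¹ * a * b) ∨
    (π = swap 1 3 ∧ edgeTwist π = b⁻¹ * c * b) ∨
    (π = swap 0 3 ∧ edgeTwist π = c⁻¹ * (b⁻¹ * a * b) * c) := by
  subst ha hb hc
  have h1 : (swap 1 2 : Perm (Fin 4)) ≠ swap 0 1 := by decide
  have h2 : (swap 2 3 : Perm (Fin 4)) ≠ swap 0 1 := by decide
  have h3 : (swap 2 3 : Perm (Fin 4)) ≠ swap 1 2 := by decide
  have h4 : (swap 0 2 : Perm (Fin 4)) ≠ swap 0 1 := by decide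
  have h5 : (swap 0 2 : Perm (Fin 4)) ≠ swap 1 2 := by decide
  have h6 : (swap 0 2 : Perm (Fin 4)) ≠ swap 2 3 := by decide
  have h7 : (swap 1 3 : Perm (Fin 4)) ≠ swap 0 1 := by decide
  have h8 : (swap 1 3 : Perm (Fin 4)) ≠ swap 1 2 := by decide
  have h9 : (swap 1 3 : Perm (Fin 4)) ≠ swap 2 3 := by decide
  have h10 : (swap 1 3 : Perm (Fin 4)) ≠ swap 0 2 := by decide
  have h11 : (swap 0 3 : Perm (Fin 4)) ≠ swap 0 1 := by decide
  have h12 : (swap 0 3 : Perm (Fin 4)) ≠ swap 1 2 := by decide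
  have h13 : (swap 0 3 : Perm (Fin 4)) ≠ swap 2 3 := by decide
  have h14 : (swap 0 3 : Perm (Fin 4)) ≠ swap 0 2 := by decide
  have h15 : (swap 0 3 : Perm (Fin 4)) ≠ swap 1 3 := by decide
  rcases isSwap_four h with rfl | rfl | rfl | rfl | rfl | rfl
  · exact .inl ⟨rfl, by simp only [edgeTwist, if_true]⟩
  · exact .inr (.inl ⟨rfl, by simp only [edgeTwist, h1, if_false, if_true]⟩)
  · exact .inr (.inr (.inl ⟨rfl, by simp only [edgeTwist, h2, h3, if_false, if_true]⟩))
  · exact .inr (.inr (.inr (.inl ⟨rfl, by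
      simp only [edgeTwist, h4, h5, h6, if_false, if_true]⟩)))
  · exact .inr (.inr (.inr (.inr (.inl ⟨rfl, by
      simp only [edgeTwist, h7, h8, h9, h10, if_false, if_true]⟩))))
  · exact .inr (.inr (.inr (.inr (.inr ⟨rfl, by
      simp only [edgeTwist, h11, h12, h13, h14, h15, if_false]⟩))))

theorem isHalfTwist_edgeTwist {π : Perm (Fin 4)} (h : π.IsSwap) : IsHalfTwist (edgeTwist π) := by
  have key : ∀ x y : BraidGroup 4, IsHalfTwist x → IsHalfTwist (y⁻¹ * x * y) := by
    intro x y hx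
    simpa using hx.conj y⁻¹
  rcases edgeTwist_cases h rfl rfl rfl with ⟨-, e⟩ | ⟨-, e⟩ | ⟨-, e⟩ | ⟨-, e⟩ | ⟨-, e⟩ | ⟨-, e⟩ <;>
    rw [e]
  · exact isHalfTwist_sigma _
  · exact isHalfTwist_sigma _
  · exact isHalfTwist_sigma _
  · exact key _ _ (isHalfTwist_sigma _)
  · exact key _ _ (isHalfTwist_sigma _)
  · exact key _ _ (key _ _ (isHalfTwist_sigma _))

theorem toPerm_edgeTwist {π : Perm (Fin 4)} (h : π.IsSwap) : toPerm 4 (edgeTwist π) = π := by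
  rcases edgeTwist_cases h rfl rfl rfl with
    ⟨r, e⟩ | ⟨r, e⟩ | ⟨r, e⟩ | ⟨r, e⟩ | ⟨r, e⟩ | ⟨r, e⟩ <;>
    rw [e, r] <;> simp only [map_mul, map_inv, toPerm_sigma] <;> decide

/-- The edges of the drawing do not cross, so two of them coincide, are disjoint, or share exactly
one endpoint; their half twists are then equal, commuting, or braided. -/
theorem edgeTwist_trichotomy {π ρ : Perm (Fin 4)} (hπ : π.IsSwap) (hρ : ρ.IsSwap) :
    π = ρ ∨ (π.Disjoint ρ ∧ Commute (edgeTwist π) (edgeTwist ρ)) ∨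
      (π * ρ ≠ ρ * π ∧ Braided π ρ ∧ Braided (edgeTwist π) (edgeTwist ρ)) := by
  obtain ⟨a, ha⟩ : ∃ a : BraidGroup 4, a = sigma (n := 4) 0 := ⟨_, rfl⟩
  obtain ⟨b, hb⟩ : ∃ b : BraidGroup 4, b = sigma (n := 4) 1 := ⟨_, rfl⟩
  obtain ⟨c, hc⟩ : ∃ c : BraidGroup 4, c = sigma (n := 4) 2 := ⟨_, rfl⟩
  have hab : Braided a b := by rw [ha, hb]; exact sigma_braid (n := 4) 0 1 rfl
  have hbc : Braided b c := by rw [hb, hc]; exact sigma_braid (n := 4) 1 2 rfl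
  have hac : Commute a c := by rw [ha, hc]; exact sigma_comm (n := 4) 0 2 (by decide)
  obtain ⟨k1, k2, k3, k4, k5, k6⟩ := braided_edges hab hbc hac
  have j1 := hab.conj_mid
  have j2 := hab.conj_left
  have j3 := hab.conj_right hbc hac
  have j4 := hbc.symm.conj_mid
  have j5 := hbc.symm.conj_left
  have j6 := hbc.symm.conj_right hab.symm hac.symm
  have main : ∀ (x y : Fin 4) (z w : Fin 4) (u v : BraidGroup 4), π = swap x y → ρ = swap z w →
      edgeTwist π = u → edgeTwist ρ = v →
      (swap x y = swap z w ∨ ((∀ i, swap x y i = i ∨ swap z w i = i) ∧ Commute u v) ∨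
      (swap x y * swap z w ≠ swap z w * swap x y ∧
        swap x y * swap z w * swap x y = swap z w * swap x y * swap z w ∧ Braided u v)) →
      π = ρ ∨ (π.Disjoint ρ ∧ Commute (edgeTwist π) (edgeTwist ρ)) ∨
      (π * ρ ≠ ρ * π ∧ Braided π ρ ∧ Braided (edgeTwist π) (edgeTwist ρ)) := by
    rintro x y z w u v rfl rfl rfl rfl h
    exact h
  rcases edgeTwist_cases hπ ha hb hc with
    ⟨r, e⟩ | ⟨r, e⟩ | ⟨r, e⟩ | ⟨r, e⟩ | ⟨r, e⟩ | ⟨r, e⟩ <;>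
  rcases edgeTwist_cases hρ ha hb hc with
    ⟨r', e'⟩ | ⟨r', e'⟩ | ⟨r', e'⟩ | ⟨r', e'⟩ | ⟨r', e'⟩ | ⟨r', e'⟩ <;>
  refine main _ _ _ _ _ _ r r' e e' ?_ <;>
  first
  | exact .inl rfl
  | exact .inr (.inl ⟨by decide, by first | assumption | (apply Commute.symm; assumption)⟩)
  | exact .inr (.inr ⟨by decide, by decide, by
      first | assumption | (apply Braided.symm; assumption)⟩)

/-- Which powers of `crossing` fix a pair of transpositions depends only on the position of the two
edges: all powers for equal edges, even powers for disjoint ones, multiples of three for adjacent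
ones. Half twists with a common exponent are fixed by those powers as well. -/
theorem edgeTwist_fixed {π ρ : Perm (Fin 4)} (hπ : π.IsSwap) (hρ : ρ.IsSwap) {k e : ℤ}
    (he : e = 1 ∨ e = -1) (h : (crossing _ ^ k) (π, ρ) = (π, ρ)) :
    (crossing _ ^ k) (edgeTwist π ^ e, edgeTwist ρ ^ e) = (edgeTwist π ^ e, edgeTwist ρ ^ e) := by
  rcases edgeTwist_trichotomy hπ hρ with rfl | ⟨hd, hc⟩ | ⟨hne, hb, hb'⟩
  · exact crossing_zpow_self _ _
  · rcases Int.even_or_odd k with hk | hk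
    · exact crossing_zpow_of_commute_even (hc.zpow_zpow e e).eq hk
    · rw [crossing_zpow_of_commute_odd hd.commute.eq hk, Prod.mk.injEq] at h
      rw [h.2]
      exact crossing_zpow_self _ _
  · have h3 : 3 ∣ k := by
      obtain ⟨j, hj⟩ : ∃ j, k = 3 * j ∨ k = 3 * j + 1 ∨ k = 3 * j - 1 :=
        ⟨(k + 1) / 3, by omega⟩
      rcases hj with hj | hj | hj
      · exact ⟨j, hj⟩
      · exfalso
        rw [hj, crossing_zpow_succ, crossing_zpow_of_braid hb ⟨j, rfl⟩, crossing_apply,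
          Prod.mk.injEq] at h
        exact hne (by rw [h.2])
      · exfalso
        rw [hj, crossing_zpow_pred, crossing_zpow_of_braid hb ⟨j, rfl⟩, crossing_inv_apply,
          Prod.mk.injEq] at h
        exact hne (by rw [h.1])
    exact crossing_zpow_of_braid (hb'.zpow he) h3

end

/-! ### Colorings that lift -/

section

open BraidGroup Equiv PretzelStrand PretzelGroup

variable {m : ℕ} [NeZero m] {q : Fin m → ℤ}

theorem Equiv.Perm.IsSwap.mul_self {π : Perm (Fin 4)} (h : π.IsSwap) : π * π = 1 := by
  obtain ⟨x, y, -, rfl⟩ := h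
  exact swap_mul_self x y

theorem Equiv.Perm.IsSwap.inv_eq {π : Perm (Fin 4)} (h : π.IsSwap) : π⁻¹ = π :=
  inv_eq_of_mul_eq_one_left h.mul_self

theorem isSimpleBraidColoring_of_bottomColor {ψ : PretzelGroup q →* BraidGroup 4}
    (h : ∀ i, IsHalfTwist (bottomColor ψ i)) : IsSimpleBraidColoring ψ := by
  rintro ⟨i, l, s⟩
  have h1 := crossing_zpow_conj_closed IsHalfTwist (fun a b ha => ha.conj b)
    ((q i).sign * (l.val : ℤ)) (bottomColor ψ i, (bottomColor ψ (i + 1))⁻¹) (h i) (h (i + 1)).inv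
  rw [← map_level] at h1
  cases s
  · exact h1.1
  · exact h1.2

theorem IsSimplePermColoring.bottomColor {φ : PretzelGroup q →* Perm (Fin 4)}
    (hφ : IsSimplePermColoring φ) (i : Fin m) : (bottomColor φ i).IsSwap := hφ _

theorem IsSimplePermColoring.topColor {φ : PretzelGroup q →* Perm (Fin 4)}
    (hφ : IsSimplePermColoring φ) (i : Fin m) : (topColor φ i).IsSwap := hφ _

theorem IsSimplePermColoring.crossing_zpow {φ : PretzelGroup q →* Perm (Fin 4)}
    (hφ : IsSimplePermColoring φ) (i : Fin m) :
    (crossing _ ^ q i) (_root_.bottomColor φ i, _root_.bottomColor φ (i + 1)) =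
      (_root_.topColor φ i, _root_.topColor φ (i + 1)) := by
  have := crossing_zpow_bottomColor φ i
  rwa [(hφ.bottomColor (i + 1)).inv_eq, (hφ.topColor (i + 1)).inv_eq] at this

/-- A sign on each twist region that changes from each region to the next one, with the possible
exception of `i₀`. -/
def alternatingSign (i₀ : Fin m) (i : Fin m) : ℤ := (-1) ^ (i - (i₀ + 1)).val

theorem alternatingSign_eq (i₀ i : Fin m) :
    alternatingSign i₀ i = 1 ∨ alternatingSign i₀ i = -1 := neg_one_pow_eq_or ℤ _

theorem alternatingSign_add_one {i₀ i : Fin m} (h : i ≠ i₀) :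
    alternatingSign i₀ (i + 1) = -alternatingSign i₀ i := by
  obtain ⟨n, rfl⟩ : ∃ n, m = n + 1 := ⟨m - 1, by have := NeZero.pos m; omega⟩
  have h1 : i - (i₀ + 1) ≠ Fin.last n := by
    intro e
    apply h
    have : i = Fin.last n + 1 + i₀ := by rw [← e]; abel
    simpa using this
  have h2 : (i + 1 - (i₀ + 1)).val = (i - (i₀ + 1)).val + 1 := by
    rw [show i + 1 - (i₀ + 1) = (i - (i₀ + 1)) + 1 by abel]
    exact Fin.val_add_one_of_lt (Fin.lt_last_iff_ne_last.2 h1)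
  rw [alternatingSign, alternatingSign, h2, pow_succ]; ring

theorem alternatingSign_succ_self (i₀ : Fin m) : alternatingSign i₀ (i₀ + 1) = 1 := by
  simp [alternatingSign]

theorem alternatingSign_self (i₀ : Fin m) : alternatingSign i₀ i₀ = (-1) ^ (m - 1) := by
  obtain ⟨n, rfl⟩ : ∃ n, m = n + 1 := ⟨m - 1, by have := NeZero.pos m; omega⟩
  have h1 : i₀ - (i₀ + 1) = Fin.last n := by
    have : Fin.last n + 1 = 0 := by simp
    rw [sub_eq_iff_eq_add, add_comm i₀, ← add_assoc, this, zero_add]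
  simp [alternatingSign, h1]

/-- The right strand of region i carries the inverse of `X (i + 1)`, so alternating signs give both
strands the same exponent and `edgeTwist_fixed` applies. Only at `i₀` can the alternation fail, and
there `h₀` takes over. -/
theorem lifts_of_topColor_eq {φ : PretzelGroup q →* Perm (Fin 4)} (hφ : IsSimplePermColoring φ)
    (hfix : ∀ i, topColor φ i = bottomColor φ i) (i₀ : Fin m)
    (h₀ : Even m ∨ q i₀ = 0 ∨ Even (q i₀) ∧ Commute (bottomColor φ i₀) (bottomColor φ (i₀ + 1))) :
    LiftsToSimpleBraidColoring φ := by
  set e := alternatingSign i₀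
  set X : Fin m → BraidGroup 4 := fun i => edgeTwist (bottomColor φ i) ^ e i with hX
  have hfix' : ∀ i, (crossing _ ^ q i) (bottomColor φ i, bottomColor φ (i + 1)) =
      (bottomColor φ i, bottomColor φ (i + 1)) := by
    intro i; rw [hφ.crossing_zpow, hfix, hfix]
  have hneg : ∀ i, e (i + 1) = -e i →
      (crossing _ ^ q i) (X i, (X (i + 1))⁻¹) = (X i, (X (i + 1))⁻¹) := by
    intro i hi
    simp only [hX, hi, zpow_neg, inv_inv]
    exact edgeTwist_fixed (hφ.bottomColor i) (hφ.bottomColor (i + 1))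
      (alternatingSign_eq i₀ i) (hfix' i)
  have hall : ∀ i, (crossing _ ^ q i) (X i, (X (i + 1))⁻¹) = (X i, (X (i + 1))⁻¹) := by
    intro i
    by_cases hi : i = i₀
    · subst hi
      rcases h₀ with hm | h | ⟨h, hc⟩
      -- For even m the alternation also holds across `i₀`.
      · refine hneg i ?_
        simp only [e]
        rw [alternatingSign_succ_self, alternatingSign_self, Odd.neg_one_pow, neg_neg]
        exact Nat.Even.sub_odd NeZero.one_le hm odd_one
      · rw [h]; rfl
      · refine crossing_zpow_of_commute_even ?_ h
        have : Commute (edgeTwist (bottomColor φ i)) (edgeTwist (bottomColor φ (i + 1))) := by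
          rcases edgeTwist_trichotomy (hφ.bottomColor i) (hφ.bottomColor (i + 1)) with
            h | ⟨-, h⟩ | ⟨h, -⟩
          · rw [h]
          · exact h
          · exact absurd hc.eq h
        exact ((this.zpow_zpow _ _).inv_right).eq
    · exact hneg i (alternatingSign_add_one hi)
  obtain ⟨ψ, hψ⟩ := exists_hom_of_bottomColor X X hall
  have htw : ∀ i, e i = 1 ∨ e i = -1 := alternatingSign_eq i₀
  refine ⟨ψ, isSimpleBraidColoring_of_bottomColor fun i => ?_, pretzelGroup_hom_ext fun i => ?_⟩
  · rw [hψ]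
    have := isHalfTwist_edgeTwist (hφ.bottomColor i)
    rcases htw i with h | h
    · simpa [hX, h] using this
    · simpa [hX, h] using this.inv
  · have : bottomColor ((toPerm 4).comp ψ) i = toPerm 4 (bottomColor ψ i) := rfl
    rw [this, hψ]
    simp only [hX, map_zpow, toPerm_edgeTwist (hφ.bottomColor i)]
    rcases htw i with h | h
    · simp [h]
    · rw [h, zpow_neg_one, (hφ.bottomColor i).inv_eq]

theorem eq_one_of_conj_eq_or_inv (C : Perm (Fin 4))
    (h : ∀ g, g * C * g⁻¹ = C ∨ g * C * g⁻¹ = C⁻¹) : C = 1 := by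
  revert C; decide

/-- The elements that conjugate `C` to itself or to its inverse. -/
def conjUpToInv {G : Type*} [Group G] (C : G) : Subgroup G where
  carrier := {g | g * C * g⁻¹ = C ∨ g * C * g⁻¹ = C⁻¹}
  one_mem' := by simp
  mul_mem' := by
    have key : ∀ a b : G, a * b * C * (a * b)⁻¹ = a * (b * C * b⁻¹) * a⁻¹ := by
      intro a b; simp [mul_assoc]
    have key2 : ∀ a : G, a * C⁻¹ * a⁻¹ = (a * C * a⁻¹)⁻¹ := by
      intro a; simp [mul_assoc]
    rintro a b ha (hb | hb)
    · simpa only [Set.mem_ofPred_eq, key, hb] using ha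
    · rcases ha with ha | ha
      · right; rw [key, hb, key2, ha]
      · left; rw [key, hb, key2, ha, inv_inv]
  inv_mem' := by
    rintro a (ha | ha)
    · left; nth_rewrite 1 [← ha]; simp [mul_assoc]
    · right
      have : C = (a * C * a⁻¹)⁻¹ := by rw [ha, inv_inv]
      nth_rewrite 1 [this]; simp [mul_assoc]

theorem topColor_eq_of_eq {φ : PretzelGroup q →* Perm (Fin 4)} {i₀ : Fin m}
    (h : topColor φ i₀ = bottomColor φ i₀) (i : Fin m) : topColor φ i = bottomColor φ i := by
  have := topColor_mul_inv φ i i₀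
  rwa [h, mul_inv_cancel, mul_inv_eq_one] at this

/-- As C = yⱼ xⱼ is a product of two involutions, xⱼ conjugates C to its inverse. Hence all of S₄
conjugates C to C or C⁻¹, which leaves only C = 1. -/
theorem topColor_eq_of_surjective {φ : PretzelGroup q →* Perm (Fin 4)}
    (hφ : IsSimplePermColoring φ) (hs : Function.Surjective φ) (i : Fin m) :
    topColor φ i = bottomColor φ i := by
  set C := topColor φ i * bottomColor φ i with hC
  have hCj : ∀ j, topColor φ j * bottomColor φ j = C := by
    intro j
    have := topColor_mul_inv φ j i
    rwa [(hφ.bottomColor j).inv_eq, (hφ.bottomColor i).inv_eq] at this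
  have hmem : ∀ j, bottomColor φ j ∈ conjUpToInv C := by
    intro j
    right
    rw [← hCj j, mul_inv_rev, (hφ.bottomColor j).inv_eq, (hφ.topColor j).inv_eq, mul_assoc,
      mul_assoc, (hφ.bottomColor j).mul_self, mul_one]
  have : C = 1 := by
    refine eq_one_of_conj_eq_or_inv C fun g => ?_
    obtain ⟨x, rfl⟩ := hs g
    exact map_mem_of_bottomColor_mem φ (conjUpToInv C) hmem x
  rw [hC] at this
  rw [eq_inv_of_mul_eq_one_left this, (hφ.bottomColor i).inv_eq]

theorem topColor_eq_of_commute {φ : PretzelGroup q →* Perm (Fin 4)}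
    (hφ : IsSimplePermColoring φ) {i : Fin m} (hi : Even (q i))
    (hc : Commute (bottomColor φ i) (bottomColor φ (i + 1))) :
    topColor φ i = bottomColor φ i := by
  have := hφ.crossing_zpow i
  rw [crossing_zpow_of_commute_even hc.eq hi, Prod.mk.injEq] at this
  exact this.1.symm

/-- The common element C = y x satisfies C² = 1 by region j and C³ = 1 by region i: a multiple of
three crossings undoes the braided case in j, and an even number the commuting case in i. -/
theorem topColor_eq_of_even_of_three_dvd {φ : PretzelGroup q →* Perm (Fin 4)}
    (hφ : IsSimplePermColoring φ) {i j : Fin m} (hi : Even (q i)) (hj : 3 ∣ q j) (k : Fin m) :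
    topColor φ k = bottomColor φ k := by
  have hC := topColor_mul_inv φ i j
  rw [(hφ.bottomColor j).inv_eq, (hφ.bottomColor i).inv_eq] at hC
  refine topColor_eq_of_eq (i₀ := i) ?_ k
  have hi' := hφ.crossing_zpow i
  have hj' := hφ.crossing_zpow j
  have h2 : (topColor φ j * bottomColor φ j) ^ 2 = 1 := by
    rcases edgeTwist_trichotomy (hφ.bottomColor j) (hφ.bottomColor (j + 1)) with
      h | ⟨h, -⟩ | ⟨-, h, -⟩
    · rw [← h, crossing_zpow_self, Prod.mk.injEq] at hj'
      rw [← hj'.1, (hφ.bottomColor j).mul_self, one_pow]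
    · rcases Int.even_or_odd (q j) with hq | hq
      · rw [topColor_eq_of_commute hφ hq h.commute, (hφ.bottomColor j).mul_self, one_pow]
      · rw [crossing_zpow_of_commute_odd h.commute.eq hq, Prod.mk.injEq] at hj'
        rw [← hj'.1, (h.commute.symm).mul_pow, pow_two, pow_two, (hφ.bottomColor j).mul_self,
          (hφ.bottomColor (j + 1)).mul_self, one_mul]
    · rw [crossing_zpow_of_braid h hj, Prod.mk.injEq] at hj'
      rw [← hj'.1, (hφ.bottomColor j).mul_self, one_pow]
  have h3 : (topColor φ i * bottomColor φ i) ^ 3 = 1 := by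
    rcases edgeTwist_trichotomy (hφ.bottomColor i) (hφ.bottomColor (i + 1)) with
      h | ⟨h, -⟩ | ⟨-, h, -⟩
    · rw [topColor_eq_of_commute hφ hi (by rw [h]), (hφ.bottomColor i).mul_self, one_pow]
    · rw [topColor_eq_of_commute hφ hi h.commute, (hφ.bottomColor i).mul_self, one_pow]
    · generalize topColor φ i = y at *
      generalize topColor φ (i + 1) = y' at *
      obtain ⟨k, hk⟩ : ∃ k, q i = 3 * k ∨ q i = 3 * k + 1 ∨ q i = 3 * k - 1 :=
        ⟨(q i + 1) / 3, by omega⟩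
      have hx := (hφ.bottomColor i).mul_self
      have hx' := (hφ.bottomColor (i + 1)).mul_self
      have hxi := (hφ.bottomColor i).inv_eq
      generalize bottomColor φ i = x at *
      generalize bottomColor φ (i + 1) = x' at *
      have h3' : (x * x') ^ 3 = 1 := by
        have e : x * x' * x = x' * x * x' := h
        calc (x * x') ^ 3 = (x * x' * x) * (x' * x * x') := by simp [pow_succ, mul_assoc]
          _ = (x * x' * x) * (x * x' * x) := by rw [e]
          _ = x * x' * (x * x) * x' * x := by simp only [mul_assoc]
          _ = 1 := by rw [hx, mul_one, mul_assoc x, hx', mul_one, hx]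
      rcases hk with hk | hk | hk
      · rw [hk, crossing_zpow_of_braid h ⟨k, rfl⟩, Prod.mk.injEq] at hi'
        rw [← hi'.1, hx, one_pow]
      · rw [hk, crossing_zpow_succ, crossing_zpow_of_braid h ⟨k, rfl⟩, crossing_apply,
          Prod.mk.injEq] at hi'
        rw [← hi'.1, hxi, mul_assoc, hx, mul_one, h3']
      · rw [hk, crossing_zpow_pred, crossing_zpow_of_braid h ⟨k, rfl⟩, crossing_inv_apply,
          Prod.mk.injEq] at hi'
        rw [← hi'.1]
        have : x' * x = (x * x')⁻¹ := by
          rw [mul_inv_rev, hxi, inv_eq_of_mul_eq_one_left hx']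
        rw [this, inv_pow, h3', inv_one]
  rw [← hC] at h2
  rw [pow_succ, h2, one_mul] at h3
  rw [eq_inv_of_mul_eq_one_left h3, (hφ.bottomColor i).inv_eq]

theorem commute_of_disjointInRegion {φ : PretzelGroup q →* Perm (Fin 4)} {i : Fin m}
    (h : DisjointInRegion φ i) : Commute (bottomColor φ i) (bottomColor φ (i + 1)) := by
  have := (h 0).commute
  rw [map_right_zero, Commute.inv_right_iff] at this
  exact this

theorem bottomColor_eq_of_identicalInRegion {φ : PretzelGroup q →* Perm (Fin 4)}
    (hφ : IsSimplePermColoring φ) {i : Fin m} (h : IdenticalInRegion φ i) :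
    bottomColor φ i = bottomColor φ (i + 1) := by
  have := h 0
  rwa [map_right_zero, (hφ.bottomColor (i + 1)).inv_eq] at this

theorem disjoint_or_identical_of_commute {φ : PretzelGroup q →* Perm (Fin 4)}
    (hφ : IsSimplePermColoring φ) {i : Fin m}
    (h : Commute (bottomColor φ i) (bottomColor φ (i + 1))) :
    DisjointInRegion φ i ∨ IdenticalInRegion φ i := by
  have hlev := fun l => map_level φ i l
  rw [(hφ.bottomColor (i + 1)).inv_eq] at hlev
  rcases edgeTwist_trichotomy (hφ.bottomColor i) (hφ.bottomColor (i + 1)) with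
    e | ⟨hd, -⟩ | ⟨hne, -⟩
  · right
    intro l
    have := hlev l
    rw [← e, crossing_zpow_self, Prod.mk.injEq] at this
    rw [this.1, this.2]
  · left
    intro l
    have := hlev l
    rcases Int.even_or_odd ((q i).sign * (l.val : ℤ)) with hk | hk
    · rw [crossing_zpow_of_commute_even h.eq hk, Prod.mk.injEq] at this
      rw [this.1, this.2]; exact hd
    · rw [crossing_zpow_of_commute_odd h.eq hk, Prod.mk.injEq] at this
      rw [this.1, this.2]; exact hd.symm
  · exact absurd h.eq hne

theorem lifts_of_even_length (hm : Even m) {i₀ : Fin m} (h₀ : Even (q i₀))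
    {φ : PretzelGroup q →* Perm (Fin 4)} (hφ : IsSimplePermColoring φ)
    (h : Function.Surjective φ ∨ ∃ i, 3 ∣ q i) : LiftsToSimpleBraidColoring φ := by
  refine lifts_of_topColor_eq hφ (fun i => ?_) i₀ (.inl hm)
  rcases h with h | ⟨j, hj⟩
  · exact topColor_eq_of_surjective hφ h i
  · exact topColor_eq_of_even_of_three_dvd hφ h₀ hj i

theorem lifts_of_commute {i₀ : Fin m} (h₀ : Even (q i₀))
    {φ : PretzelGroup q →* Perm (Fin 4)} (hφ : IsSimplePermColoring φ)
    (h : q i₀ = 0 ∨ Commute (bottomColor φ i₀) (bottomColor φ (i₀ + 1))) :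
    LiftsToSimpleBraidColoring φ := by
  refine lifts_of_topColor_eq hφ (topColor_eq_of_eq (i₀ := i₀) ?_) i₀
    (.inr (h.imp id fun h => ⟨h₀, h⟩))
  rcases h with h | h
  · have := hφ.crossing_zpow i₀
    rw [h] at this
    exact (congrArg Prod.fst this).symm
  · exact topColor_eq_of_commute hφ h₀ h

end

/-! ### Fibonacci polynomials -/

/-- The values at `n` of the Fibonacci polynomials. -/
def fibPoly (n : ℤ) : ℕ → ℤ
  | 0 => 0
  | 1 => 1
  | k + 2 => n * fibPoly n (k + 1) + fibPoly n k

/-- The values at `n` of the Fibonacci polynomials, with all integers as indices. -/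
def fibPolyZ (n : ℤ) : ℤ → ℤ
  | .ofNat k => fibPoly n k
  | .negSucc k => (-1) ^ k * fibPoly n (k + 1)

theorem fibPolyZ_natCast (n : ℤ) (k : ℕ) : fibPolyZ n (k : ℤ) = fibPoly n k := rfl

theorem fibPolyZ_neg_natCast (n : ℤ) (k : ℕ) :
    fibPolyZ n (-(k : ℤ)) = (-1) ^ (k + 1) * fibPoly n k := by
  cases k with
  | zero => simp [fibPolyZ, fibPoly]
  | succ k =>
    rw [show (-((k + 1 : ℕ) : ℤ)) = Int.negSucc k from rfl, fibPolyZ]; ring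

theorem fibPolyZ_add_two (n k : ℤ) :
    fibPolyZ n (k + 2) = n * fibPolyZ n (k + 1) + fibPolyZ n k := by
  obtain ⟨j, rfl | rfl⟩ := k.eq_nat_or_neg
  · have h1 : (j : ℤ) + 2 = ((j + 2 : ℕ) : ℤ) := by push_cast; ring
    have h2 : (j : ℤ) + 1 = ((j + 1 : ℕ) : ℤ) := by push_cast; ring
    rw [h1, h2, fibPolyZ_natCast, fibPolyZ_natCast, fibPolyZ_natCast, fibPoly]
  · match j with
    | 0 =>
      have h1 : -((0 : ℕ) : ℤ) + 2 = ((2 : ℕ) : ℤ) := by norm_num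
      have h2 : -((0 : ℕ) : ℤ) + 1 = ((1 : ℕ) : ℤ) := by norm_num
      rw [h1, h2, fibPolyZ_natCast, fibPolyZ_natCast, fibPolyZ_neg_natCast]
      simp [fibPoly]
    | 1 =>
      have h1 : -((1 : ℕ) : ℤ) + 2 = ((1 : ℕ) : ℤ) := by norm_num
      have h2 : -((1 : ℕ) : ℤ) + 1 = ((0 : ℕ) : ℤ) := by norm_num
      rw [h1, h2, fibPolyZ_natCast, fibPolyZ_natCast, fibPolyZ_neg_natCast]
      simp [fibPoly]
    | j + 2 =>
      have h1 : -((j + 2 : ℕ) : ℤ) + 2 = -(j : ℤ) := by push_cast; ring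
      have h2 : -((j + 2 : ℕ) : ℤ) + 1 = -((j + 1 : ℕ) : ℤ) := by push_cast; ring
      rw [h1, h2, fibPolyZ_neg_natCast, fibPolyZ_neg_natCast, fibPolyZ_neg_natCast, fibPoly]
      ring

/-! ### Transvections of the plane -/

section

open Matrix MatrixGroups

/-- The area form on the plane. -/
def areaForm (v w : Fin 2 → ℤ) : ℤ := v 0 * w 1 - v 1 * w 0

/-- The transvection `w ↦ w - e * areaForm v w • v`. -/
def transvec (v : Fin 2 → ℤ) (e : ℤ) : SL(2, ℤ) :=
  ⟨!![1 + e * v 0 * v 1, -e * v 0 ^ 2; e * v 1 ^ 2, 1 - e * v 0 * v 1], by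
    rw [det_fin_two_of]; ring⟩

theorem coe_transvec (v : Fin 2 → ℤ) (e : ℤ) : (transvec v e : Matrix (Fin 2) (Fin 2) ℤ) =
    !![1 + e * v 0 * v 1, -e * v 0 ^ 2; e * v 1 ^ 2, 1 - e * v 0 * v 1] := rfl

theorem transvec_mulVec (v w : Fin 2 → ℤ) (e : ℤ) :
    (transvec v e : Matrix (Fin 2) (Fin 2) ℤ) *ᵥ w = w - (e * areaForm v w) • v := by
  ext i
  fin_cases i <;> simp [coe_transvec, areaForm, Matrix.mulVec, dotProduct, Fin.sum_univ_two] <;>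
    ring

theorem transvec_mul_neg (v : Fin 2 → ℤ) (e : ℤ) : transvec v e * transvec v (-e) = 1 := by
  ext i j
  fin_cases i <;> fin_cases j <;>
    simp [coe_transvec, Matrix.mul_apply, Fin.sum_univ_two] <;> ring

theorem transvec_inv (v : Fin 2 → ℤ) (e : ℤ) : (transvec v e)⁻¹ = transvec v (-e) :=
  inv_eq_of_mul_eq_one_right (transvec_mul_neg v e)

theorem conj_transvec (g : SL(2, ℤ)) (v : Fin 2 → ℤ) (e : ℤ) :
    g * transvec v e * g⁻¹ = transvec ((g : Matrix (Fin 2) (Fin 2) ℤ) *ᵥ v) e := by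
  rw [mul_inv_eq_iff_eq_mul]
  have hdet := g.det_coe
  rw [det_fin_two] at hdet
  ext i j
  fin_cases i <;> fin_cases j <;>
    simp [coe_transvec, Matrix.mul_apply, Fin.sum_univ_two]
  · linear_combination (-e * v 1 * (g.1 0 0 * v 0 + g.1 0 1 * v 1)) * hdet
  · linear_combination (e * v 0 * (g.1 0 0 * v 0 + g.1 0 1 * v 1)) * hdet
  · linear_combination (-e * v 1 * (g.1 1 0 * v 0 + g.1 1 1 * v 1)) * hdet
  · linear_combination (e * v 0 * (g.1 1 0 * v 0 + g.1 1 1 * v 1)) * hdet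

theorem areaForm_mulVec (g : SL(2, ℤ)) (v w : Fin 2 → ℤ) :
    areaForm ((g : Matrix (Fin 2) (Fin 2) ℤ) *ᵥ v) ((g : Matrix (Fin 2) (Fin 2) ℤ) *ᵥ w) =
      areaForm v w := by
  have hdet := g.det_coe
  rw [det_fin_two] at hdet
  simp only [areaForm, Matrix.mulVec, dotProduct, Fin.sum_univ_two]
  linear_combination (v 0 * w 1 - v 1 * w 0) * hdet

theorem trace_transvec_mul (v w : Fin 2 → ℤ) (d e : ℤ) :
    ((transvec v d * transvec w e : SL(2, ℤ)) : Matrix (Fin 2) (Fin 2) ℤ).trace =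
      2 - d * e * areaForm v w ^ 2 := by
  simp only [Matrix.SpecialLinearGroup.coe_mul, coe_transvec, trace_fin_two, Matrix.mul_apply,
    Fin.sum_univ_two, areaForm]
  simp
  ring

theorem crossing_transvec (u w : Fin 2 → ℤ) (e : ℤ) :
    crossing _ (transvec u e, transvec w (-e)) =
      (transvec (w + (e * areaForm u w) • u) (-e), transvec u e) := by
  rw [crossing_apply]
  congr 1
  have := conj_transvec (transvec u e)⁻¹ w (-e)
  rw [inv_inv] at this
  rw [this, transvec_inv, transvec_mulVec]
  congr 1
  module

/-- The vectors of the strands of a twist region. -/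
def regionVec (n : ℤ) (u w : Fin 2 → ℤ) (k : ℤ) : Fin 2 → ℤ :=
  fibPolyZ n k • w + fibPolyZ n (k + 1) • u

theorem regionVec_zero (n : ℤ) (u w : Fin 2 → ℤ) : regionVec n u w 0 = u := by
  simp [regionVec, show fibPolyZ n 0 = 0 from rfl, show fibPolyZ n 1 = 1 from rfl]

theorem regionVec_neg_one (n : ℤ) (u w : Fin 2 → ℤ) : regionVec n u w (-1) = w := by
  simp [regionVec, show fibPolyZ n 0 = 0 from rfl, show fibPolyZ n (-1) = 1 by
    simpa [fibPoly] using fibPolyZ_neg_natCast n 1]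

theorem regionVec_add_two (n : ℤ) (u w : Fin 2 → ℤ) (k : ℤ) :
    regionVec n u w (k + 2) = regionVec n u w k + n • regionVec n u w (k + 1) := by
  simp only [regionVec, fibPolyZ_add_two, show k + 2 + 1 = k + 1 + 2 by ring,
    show k + 1 + 1 = k + 2 by ring]
  module

/-- A crossing moves the left vector to the right, puts (previous right) + n · (left) on the left,
and flips the exponent. Area times exponent stays equal to n, whence the Fibonacci recursion with
constant parameter. -/
theorem crossing_zpow_transvec (u w : Fin 2 → ℤ) (e : ℤ) (k : ℤ) :
    (crossing _ ^ k) (transvec u e, transvec w (-e)) =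
      (transvec (regionVec (e * areaForm u w) u w k) (k.negOnePow * e),
        transvec (regionVec (e * areaForm u w) u w (k - 1)) (-(k.negOnePow * e))) := by
  set n := e * areaForm u w with hn
  have area : ∀ k : ℤ, k.negOnePow * e * areaForm (regionVec n u w k) (regionVec n u w (k - 1)) =
      n := by
    have step : ∀ k : ℤ, k.negOnePow * e * areaForm (regionVec n u w k) (regionVec n u w (k - 1)) =
        (k + 1).negOnePow * e *
          areaForm (regionVec n u w (k + 1)) (regionVec n u w (k + 1 - 1)) := by
      intro k
      have := regionVec_add_two n u w (k - 1)
      rw [show k - 1 + 2 = k + 1 by ring, show k - 1 + 1 = k by ring] at this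
      rw [this, Int.negOnePow_succ, show k + 1 - 1 = k by ring]
      simp only [areaForm, Pi.add_apply, Pi.smul_apply, smul_eq_mul, Units.val_neg]
      ring
    intro k
    induction k using Int.induction_on with
    | zero =>
      rw [regionVec_zero, show (0 : ℤ) - 1 = -1 by ring, regionVec_neg_one]; simp [hn]
    | succ k ih => rw [← step, ih]
    | pred k ih =>
      rw [step (-(k : ℤ) - 1), sub_add_cancel, ih]
  have step : ∀ k : ℤ, crossing _ (transvec (regionVec n u w k) (k.negOnePow * e),
        transvec (regionVec n u w (k - 1)) (-(k.negOnePow * e))) =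
      (transvec (regionVec n u w (k + 1)) ((k + 1).negOnePow * e),
        transvec (regionVec n u w (k + 1 - 1)) (-((k + 1).negOnePow * e))) := by
    intro k
    rw [crossing_transvec, area]
    have := regionVec_add_two n u w (k - 1)
    rw [show k - 1 + 2 = k + 1 by ring, show k - 1 + 1 = k by ring] at this
    rw [this, Int.negOnePow_succ, show k + 1 - 1 = k by ring]
    simp
  induction k using Int.induction_on with
  | zero => rw [regionVec_zero, show (0 : ℤ) - 1 = -1 by ring, regionVec_neg_one]; simp
  | succ k ih => rw [crossing_zpow_succ, ih, step]
  | pred k ih =>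
    rw [crossing_zpow_pred, ih, Equiv.Perm.inv_eq_iff_eq, step (-(k : ℤ) - 1)]
    simp

theorem areaForm_regionVec (n : ℤ) (u w : Fin 2 → ℤ) (k : ℤ) :
    areaForm (regionVec n u w k) u = fibPolyZ n k * areaForm w u := by
  simp only [areaForm, regionVec, Pi.add_apply, Pi.smul_apply, smul_eq_mul]; ring

end

/-! ### Homomorphisms from the braid group on four strands -/

namespace BraidGroup

section

open Matrix MatrixGroups

/-- A homomorphism from the braid group on four strands. -/
theorem exists_hom_four {G : Type*} [Group G] (a b c : G) (hab : Braided a b) (hbc : Braided b c)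
    (hac : Commute a c) : ∃ f : BraidGroup 4 →* G,
      f (sigma (n := 4) 0) = a ∧ f (sigma (n := 4) 1) = b ∧ f (sigma (n := 4) 2) = c := by
  have h : ∀ r ∈ {r : FreeGroup (Fin (4 - 1)) | ∃ u v, BraidRel 4 u v ∧ r = u * v⁻¹},
      FreeGroup.lift (![a, b, c] : Fin 3 → G) r = 1 := by
    rintro r ⟨u, v, huv, rfl⟩
    rw [map_mul, map_inv, mul_inv_eq_one]
    cases huv with
    | comm i j h =>
      simp only [map_mul, FreeGroup.lift_apply_of]
      have h1 : i.val = 0 := by have := j.isLt; omega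
      have h2 : j.val = 2 := by have := j.isLt; omega
      rw [show i = (0 : Fin 3) from Fin.ext h1, show j = (2 : Fin 3) from Fin.ext h2]
      exact hac.eq
    | braid i j h =>
      simp only [map_mul, FreeGroup.lift_apply_of]
      have h0 : i.val = 0 ∨ i.val = 1 := by have := j.isLt; omega
      rcases h0 with h0 | h0
      · rw [show i = (0 : Fin 3) from Fin.ext h0, show j = (1 : Fin 3) from Fin.ext (by
          rw [← h, h0]; rfl)]
        exact hab
      · rw [show i = (1 : Fin 3) from Fin.ext h0, show j = (2 : Fin 3) from Fin.ext (by
          rw [← h, h0]; rfl)]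
        exact hbc
  exact ⟨PresentedGroup.toGroup h, PresentedGroup.toGroup.of h, PresentedGroup.toGroup.of h,
    PresentedGroup.toGroup.of h⟩

theorem induction_sigma {n : ℕ} {p : BraidGroup n → Prop} (one : p 1)
    (mul : ∀ a b, p a → p b → p (a * b)) (inv : ∀ a, p a → p a⁻¹) (gen : ∀ i, p (sigma i))
    (g : BraidGroup n) : p g := by
  have hg : g ∈ Subgroup.closure (Set.range
      (PresentedGroup.of (rels := {r | ∃ u v, BraidRel n u v ∧ r = u * v⁻¹}))) := by
    rw [PresentedGroup.closure_range_of]; trivial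
  induction hg using Subgroup.closure_induction with
  | mem x hx => obtain ⟨i, rfl⟩ := hx; exact gen i
  | one => exact one
  | mul a b _ _ ha hb => exact mul a b ha hb
  | inv a _ ha => exact inv a ha

/-- A map that commutes with the generators commutes with all braids. -/
theorem equivariant_of_sigma {n : ℕ} {X Y : Type*} (A : BraidGroup n → X → X)
    (B : BraidGroup n → Y → Y) (hA1 : ∀ x, A 1 x = x) (hA : ∀ g h x, A (g * h) x = A g (A h x))
    (hB1 : ∀ x, B 1 x = x) (hB : ∀ g h x, B (g * h) x = B g (B h x)) (f : X → Y)
    (hf : ∀ i x, f (A (sigma i) x) = B (sigma i) (f x)) (g : BraidGroup n) (x : X) :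
    f (A g x) = B g (f x) := by
  induction g using induction_sigma generalizing x with
  | one => rw [hA1, hB1]
  | mul a b ha hb => rw [hA, hB, ha, hb]
  | inv a ha =>
    have h1 : x = A a (A a⁻¹ x) := by rw [← hA, mul_inv_cancel, hA1]
    nth_rewrite 2 [h1]
    rw [ha, ← hB, inv_mul_cancel, hB1]
  | gen i => exact hf i x

/-- The exponent sum. -/
noncomputable def exponent : BraidGroup 4 →* Multiplicative ℤ :=
  (exists_hom_four (Multiplicative.ofAdd 1) (Multiplicative.ofAdd 1) (Multiplicative.ofAdd 1)
    rfl rfl rfl).choose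

theorem exponent_sigma_zero : exponent (sigma (n := 4) 0) = Multiplicative.ofAdd 1 :=
  (exists_hom_four (Multiplicative.ofAdd (1 : ℤ)) (Multiplicative.ofAdd 1) (Multiplicative.ofAdd 1)
    rfl rfl rfl).choose_spec.1

/-- This is the map B₄ → B₃ that identifies the outer generators, followed by the classical B₃ →
SL₂(ℤ). -/
theorem exists_planeRep : ∃ f : BraidGroup 4 →* SL(2, ℤ),
    f (sigma (n := 4) 0) = transvec ![1, 0] 1 ∧ f (sigma (n := 4) 1) = transvec ![0, 1] 1 ∧
      f (sigma (n := 4) 2) = transvec ![1, 0] 1 := by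
  have h : Braided (transvec ![1, 0] 1) (transvec ![0, 1] 1) := by
    unfold Braided
    ext i j
    fin_cases i <;> fin_cases j <;>
      simp [coe_transvec, Matrix.mul_apply, Fin.sum_univ_two]
  exact exists_hom_four _ _ _ h h.symm (Commute.refl _)

/-- The action on the plane. -/
noncomputable def planeRep : BraidGroup 4 →* SL(2, ℤ) := exists_planeRep.choose

theorem planeRep_sigma :
    planeRep (sigma (n := 4) 0) = transvec ![1, 0] 1 ∧
      planeRep (sigma (n := 4) 1) = transvec ![0, 1] 1 ∧
      planeRep (sigma (n := 4) 2) = transvec ![1, 0] 1 := exists_planeRep.choose_spec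

/-- The vector in the plane of the half twists `g * sigma 0 ^ e * g⁻¹`. -/
noncomputable def planeVec (g : BraidGroup 4) : Fin 2 → ℤ :=
  (planeRep g : Matrix (Fin 2) (Fin 2) ℤ) *ᵥ ![1, 0]

theorem planeRep_halfTwist (g : BraidGroup 4) {e : ℤ} (he : e = 1 ∨ e = -1) :
    planeRep (g * sigma (n := 4) 0 ^ e * g⁻¹) = transvec (planeVec g) e := by
  rw [map_mul, map_mul, map_inv, map_zpow, planeRep_sigma.1, planeVec, ← conj_transvec]
  rcases he with rfl | rfl
  · rw [zpow_one]
  · rw [_root_.zpow_neg_one, transvec_inv]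

theorem exponent_halfTwist (g : BraidGroup 4) (e : ℤ) :
    exponent (g * sigma (n := 4) 0 ^ e * g⁻¹) = Multiplicative.ofAdd e := by
  rw [map_mul, map_mul, map_inv, map_zpow, exponent_sigma_zero, mul_inv_cancel_comm,
    ← ofAdd_zsmul]
  simp

theorem IsHalfTwist.exists_conj {b : BraidGroup 4} (hb : IsHalfTwist b) :
    ∃ (g : BraidGroup 4) (e : ℤ), (e = 1 ∨ e = -1) ∧ b = g * sigma (n := 4) 0 ^ e * g⁻¹ := by
  have key : ∀ i : Fin (4 - 1), ∃ h : BraidGroup 4, sigma i = h * sigma (n := 4) 0 * h⁻¹ := by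
    -- Adjacent generators are conjugate by the braid relation, so the conjugates of the first
    -- generator and its inverse exhaust the half twists.
    have aux : ∀ i j : Fin (4 - 1), i.val + 1 = j.val →
        (sigma j : BraidGroup 4) = (sigma i * sigma j) * sigma i * (sigma i * sigma j)⁻¹ := by
      intro i j h
      have := sigma_braid (n := 4) i j h
      rw [this]; simp
    obtain ⟨u, hu⟩ : ∃ u : BraidGroup 4, sigma (n := 4) 1 = u * sigma (n := 4) 0 * u⁻¹ :=
      ⟨_, aux 0 1 rfl⟩
    obtain ⟨v, hv⟩ : ∃ v : BraidGroup 4, sigma (n := 4) 2 = v * sigma (n := 4) 1 * v⁻¹ :=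
      ⟨_, aux 1 2 rfl⟩
    intro i
    match i with
    | 0 => exact ⟨1, by simp⟩
    | 1 => exact ⟨u, hu⟩
    | 2 => exact ⟨v * u, hv.trans (by rw [hu]; simp [mul_assoc])⟩
  obtain ⟨i, h⟩ := hb
  obtain ⟨h', hi⟩ := key i
  rcases h with h | h <;> obtain ⟨g, rfl⟩ := isConj_iff.1 h
  · exact ⟨g * h', 1, .inl rfl, by rw [hi]; simp [mul_assoc]⟩
  · exact ⟨g * h', -1, .inr rfl, by rw [hi]; simp [mul_assoc]⟩

/-- The reduction modulo 2 of the vectors of the half twists. -/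
def modTwoVec : Fin 4 → Fin 4 → Fin 2 → ZMod 2 :=
  ![![![0, 0], ![1, 0], ![1, 1], ![0, 1]], ![![1, 0], ![0, 0], ![0, 1], ![1, 1]],
    ![![1, 1], ![0, 1], ![0, 0], ![1, 0]], ![![0, 1], ![1, 1], ![1, 0], ![0, 0]]]

/-- Modulo 2 the plane representation factors through S₄ → S₃ ≅ SL₂(𝔽₂). Complementary pairs of
points have the same vector. -/
theorem planeRep_modTwoVec (g : BraidGroup 4) (x : Fin 4 × Fin 4) :
    modTwoVec (toPerm 4 g x.1) (toPerm 4 g x.2) =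
      (planeRep g : Matrix (Fin 2) (Fin 2) ℤ).map (Int.castRingHom (ZMod 2)) *ᵥ
        modTwoVec x.1 x.2 := by
  refine equivariant_of_sigma (fun g x => (toPerm 4 g x.1, toPerm 4 g x.2))
    (fun g v => (planeRep g : Matrix (Fin 2) (Fin 2) ℤ).map (Int.castRingHom (ZMod 2)) *ᵥ v)
    (by simp) (by simp) (by simp) ?_ (fun x => modTwoVec x.1 x.2) ?_ g x
  · intro g h v
    simp only [map_mul, Matrix.SpecialLinearGroup.coe_mul, Matrix.map_mul, Matrix.mulVec_mulVec]
  · intro i x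
    have h0 : ∀ x y : Fin 4, modTwoVec (adjSwap 4 0 x) (adjSwap 4 0 y) =
      !![1, 1; 0, 1] *ᵥ modTwoVec x y := by decide
    have h1 : ∀ x y : Fin 4, modTwoVec (adjSwap 4 1 x) (adjSwap 4 1 y) =
      !![1, 0; 1, 1] *ᵥ modTwoVec x y := by decide
    have h2 : ∀ x y : Fin 4, modTwoVec (adjSwap 4 2 x) (adjSwap 4 2 y) =
      !![1, 1; 0, 1] *ᵥ modTwoVec x y := by decide
    have e0 : (transvec ![1, 0] 1 : Matrix (Fin 2) (Fin 2) ℤ).map (Int.castRingHom (ZMod 2)) =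
      !![1, 1; 0, 1] := by
      ext i j; fin_cases i <;> fin_cases j <;> simp [coe_transvec]
    have e1 : (transvec ![0, 1] 1 : Matrix (Fin 2) (Fin 2) ℤ).map (Int.castRingHom (ZMod 2)) =
      !![1, 0; 1, 1] := by
      ext i j; fin_cases i <;> fin_cases j <;> simp [coe_transvec]
    obtain ⟨p0, p1, p2⟩ := planeRep_sigma
    rw [toPerm_sigma]
    match i with
    | 0 => exact (h0 _ _).trans (by rw [← e0, ← p0])
    | 1 => exact (h1 _ _).trans (by rw [← e1, ← p1])
    | 2 => exact (h2 _ _).trans (by rw [← e0, ← p2])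

theorem planeVec_mod_two (g : BraidGroup 4) (i : Fin 2) :
    ((planeVec g i : ℤ) : ZMod 2) = modTwoVec (toPerm 4 g 0) (toPerm 4 g 1) i := by
  rw [planeRep_modTwoVec g (0, 1)]
  have : modTwoVec 0 1 = Int.castRingHom (ZMod 2) ∘ ![1, 0] := by decide
  simp only [this, ← RingHom.map_mulVec]
  rfl

theorem toPerm_halfTwist (g : BraidGroup 4) {e : ℤ} (he : e = 1 ∨ e = -1) :
    toPerm 4 (g * sigma (n := 4) 0 ^ e * g⁻¹) = Equiv.swap (toPerm 4 g 0) (toPerm 4 g 1) := by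
  rw [map_mul, map_mul, map_inv, map_zpow, toPerm_sigma]
  have h1 : adjSwap 4 (0 : Fin 3) ^ e = Equiv.swap 0 1 := by
    rcases he with rfl | rfl
    · rw [zpow_one]; rfl
    · rw [_root_.zpow_neg_one]; rfl
  have := Equiv.swap_apply_apply (toPerm 4 g) 0 1
  rw [this]
  exact congrArg (fun x => toPerm 4 g * x * (toPerm 4 g)⁻¹) h1

theorem isCoprime_planeVec (g : BraidGroup 4) : IsCoprime (planeVec g 0) (planeVec g 1) := by
  have hdet := (planeRep g).det_coe
  rw [det_fin_two] at hdet
  refine ⟨(planeRep g).1 1 1, -(planeRep g).1 0 1, ?_⟩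
  simp [planeVec, Matrix.mulVec, dotProduct, Fin.sum_univ_two]
  linear_combination hdet

/-- Half twists whose vectors are parallel have commuting permutations. -/
theorem commute_toPerm_of_areaForm_eq_zero {g h : BraidGroup 4}
    (hgh : areaForm (planeVec g) (planeVec h) = 0) {d e : ℤ} (hd : d = 1 ∨ d = -1)
    (he : e = 1 ∨ e = -1) :
    Commute (toPerm 4 (g * sigma (n := 4) 0 ^ d * g⁻¹))
      (toPerm 4 (h * sigma (n := 4) 0 ^ e * h⁻¹)) := by
  rw [toPerm_halfTwist g hd, toPerm_halfTwist h he]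
  have h2 : modTwoVec (toPerm 4 g 0) (toPerm 4 g 1) 0 * modTwoVec (toPerm 4 h 0) (toPerm 4 h 1) 1 -
      modTwoVec (toPerm 4 g 0) (toPerm 4 g 1) 1 * modTwoVec (toPerm 4 h 0) (toPerm 4 h 1) 0 = 0 := by
    rw [← planeVec_mod_two, ← planeVec_mod_two, ← planeVec_mod_two, ← planeVec_mod_two]
    have := congrArg (Int.cast : ℤ → ZMod 2) hgh
    simpa [areaForm] using this
  -- Nonzero vectors over 𝔽₂ are parallel only if equal, that is, if the two pairs of points agree
  -- or are complementary.
  have key : ∀ x y z w : Fin 4, x ≠ y → z ≠ w →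
      modTwoVec x y 0 * modTwoVec z w 1 - modTwoVec x y 1 * modTwoVec z w 0 = 0 →
      Equiv.swap x y * Equiv.swap z w = Equiv.swap z w * Equiv.swap x y := by decide
  refine key _ _ _ _ ?_ ?_ h2
  · exact fun h => absurd ((toPerm 4 g).injective h) (by decide)
  · exact fun h' => absurd ((toPerm 4 h).injective h') (by decide)

end

end BraidGroup

/-! ### The Burau representation -/

section

open Matrix LaurentPolynomial

variable {R S : Type*} [CommRing R] [CommRing S]

/-- The reduced Burau matrices of the standard generators. -/
def burauSigma (t : Rˣ) : Fin 3 → (Matrix (Fin 3) (Fin 3) R)ˣ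
  | 0 => ⟨!![-t, t, 0; 0, 1, 0; 0, 0, 1], !![-↑t⁻¹, 1, 0; 0, 1, 0; 0, 0, 1],
      by ext i j; fin_cases i <;> fin_cases j <;> simp [Matrix.mul_apply, Fin.sum_univ_three],
      by ext i j; fin_cases i <;> fin_cases j <;> simp [Matrix.mul_apply, Fin.sum_univ_three]⟩
  | 1 => ⟨!![1, 0, 0; 1, -t, t; 0, 0, 1], !![1, 0, 0; ↑t⁻¹, -↑t⁻¹, 1; 0, 0, 1],
      by ext i j; fin_cases i <;> fin_cases j <;> simp [Matrix.mul_apply, Fin.sum_univ_three],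
      by ext i j; fin_cases i <;> fin_cases j <;> simp [Matrix.mul_apply, Fin.sum_univ_three]⟩
  | 2 => ⟨!![1, 0, 0; 0, 1, 0; 0, 1, -t], !![1, 0, 0; 0, 1, 0; 0, ↑t⁻¹, -↑t⁻¹],
      by ext i j; fin_cases i <;> fin_cases j <;> simp [Matrix.mul_apply, Fin.sum_univ_three],
      by ext i j; fin_cases i <;> fin_cases j <;> simp [Matrix.mul_apply, Fin.sum_univ_three]⟩

namespace BraidGroup

theorem exists_burau (t : Rˣ) : ∃ f : BraidGroup 4 →* (Matrix (Fin 3) (Fin 3) R)ˣ,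
    f (sigma (n := 4) 0) = burauSigma t 0 ∧ f (sigma (n := 4) 1) = burauSigma t 1 ∧
      f (sigma (n := 4) 2) = burauSigma t 2 := by
  refine exists_hom_four _ _ _ ?_ ?_ ?_
  · ext i j
    fin_cases i <;> fin_cases j <;>
      simp [burauSigma, Matrix.mul_apply, Fin.sum_univ_three]
  · ext i j
    fin_cases i <;> fin_cases j <;>
      simp [burauSigma, Matrix.mul_apply, Fin.sum_univ_three]
  · ext i j
    fin_cases i <;> fin_cases j <;>
      simp [burauSigma, Matrix.mul_apply, Fin.sum_univ_three]

/-- The reduced Burau representation at the unit `t`. -/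
noncomputable def burau (t : Rˣ) : BraidGroup 4 →* (Matrix (Fin 3) (Fin 3) R)ˣ :=
  (exists_burau t).choose

theorem burau_sigma (t : Rˣ) (i : Fin 3) : burau t (sigma (n := 4) i) = burauSigma t i := by
  obtain ⟨h0, h1, h2⟩ := (exists_burau t).choose_spec
  match i with
  | 0 => exact h0
  | 1 => exact h1
  | 2 => exact h2

theorem burau_sigma_val (t : Rˣ) :
    (burau t (sigma (n := 4) 0)).1 = !![-(t : R), t, 0; 0, 1, 0; 0, 0, 1] ∧
    (burau t (sigma (n := 4) 1)).1 = !![1, 0, 0; 1, -(t : R), t; 0, 0, 1] ∧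
    (burau t (sigma (n := 4) 2)).1 = !![1, 0, 0; 0, 1, 0; 0, 1, -(t : R)] := by
  refine ⟨?_, ?_, ?_⟩ <;> exact congrArg Units.val (burau_sigma t _)

theorem map_burau (f : R →+* S) (t : Rˣ) (g : BraidGroup 4) :
    ((burau t g : (Matrix (Fin 3) (Fin 3) R)ˣ) : Matrix (Fin 3) (Fin 3) R).map f =
      (burau (Units.map f t) g : (Matrix (Fin 3) (Fin 3) S)ˣ) := by
  have : (Units.map (f.mapMatrix (m := Fin 3)).toMonoidHom).comp (burau t) =
      burau (Units.map (f : R →* S) t) := by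
    refine PresentedGroup.ext fun i => ?_
    change Units.map _ (burau t (sigma (n := 4) i)) = burau _ (sigma (n := 4) i)
    obtain ⟨a0, a1, a2⟩ := burau_sigma_val t
    obtain ⟨b0, b1, b2⟩ := burau_sigma_val (Units.map (f : R →* S) t)
    apply Units.ext
    change ((burau t (sigma (n := 4) i)).1).map f = (burau _ (sigma (n := 4) i)).1
    match i with
    | 0 => refine (congrArg (Matrix.map · f) a0).trans (Eq.trans ?_ b0.symm)
           ext k l; fin_cases k <;> fin_cases l <;> simp
    | 1 => refine (congrArg (Matrix.map · f) a1).trans (Eq.trans ?_ b1.symm)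
           ext k l; fin_cases k <;> fin_cases l <;> simp
    | 2 => refine (congrArg (Matrix.map · f) a2).trans (Eq.trans ?_ b2.symm)
           ext k l; fin_cases k <;> fin_cases l <;> simp
  rw [← this]; rfl

/-- The vector of the half twists `g * sigma 0 ^ e * g⁻¹`. -/
noncomputable def burauVec (t : Rˣ) (g : BraidGroup 4) : Fin 3 → R :=
  (burau t g).1 *ᵥ ![1, 0, 0]

/-- The covector of the half twists `g * sigma 0 ^ e * g⁻¹`. -/
noncomputable def burauCovec (t : Rˣ) (g : BraidGroup 4) : Fin 3 → R :=
  ![1 + t, -t, 0] ᵥ* (burau t g⁻¹).1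

/-- The generator is a pseudoreflection, and so is its inverse, with the same vector and covector;
only the scalar changes, from 1 to t⁻¹. -/
theorem burau_halfTwist (t : Rˣ) (g : BraidGroup 4) {e : ℤ} (he : e = 1 ∨ e = -1) :
    ∃ κ : Rˣ, (burau t (g * sigma (n := 4) 0 ^ e * g⁻¹)).1 =
      1 - (κ : R) • vecMulVec (burauVec t g) (burauCovec t g) := by
  have key : ∀ κ : Rˣ, (burau t (sigma (n := 4) 0 ^ e)).1 =
      1 - (κ : R) • vecMulVec ![1, 0, 0] ![1 + (t : R), -t, 0] →
      (burau t (g * sigma (n := 4) 0 ^ e * g⁻¹)).1 =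
      1 - (κ : R) • vecMulVec (burauVec t g) (burauCovec t g) := by
    intro κ h
    rw [map_mul, map_mul, Units.val_mul, Units.val_mul, h, mul_sub, sub_mul, mul_one,
      ← Units.val_mul, ← map_mul, mul_inv_cancel, map_one, Units.val_one, mul_smul_comm,
      smul_mul_assoc, mul_vecMulVec, vecMulVec_mul]
    rfl
  rcases he with rfl | rfl
  · refine ⟨1, key 1 ?_⟩
    rw [zpow_one, (burau_sigma_val t).1]
    ext i j; fin_cases i <;> fin_cases j <;> simp
  · refine ⟨t⁻¹, key t⁻¹ ?_⟩
    have h : (burau t (sigma (n := 4) 0))⁻¹.1 = !![-↑t⁻¹, 1, 0; 0, 1, 0; 0, 0, 1] :=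
      congrArg (fun z => z⁻¹.1) (burau_sigma t 0)
    rw [_root_.zpow_neg_one, map_inv, h]
    ext i j; fin_cases i <;> fin_cases j <;> simp [mul_add]

theorem map_burauVec (f : R →+* S) (t : Rˣ) (g : BraidGroup 4) :
    f ∘ burauVec t g = burauVec (Units.map f t) g := by
  rw [burauVec, burauVec, ← map_burau]
  funext i
  simp [RingHom.map_mulVec, Function.comp_def]
  congr 1
  funext j; fin_cases j <;> simp

theorem map_burauCovec (f : R →+* S) (t : Rˣ) (g : BraidGroup 4) :
    f ∘ burauCovec t g = burauCovec (Units.map f t) g := by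
  rw [burauCovec, burauCovec, ← map_burau]
  funext i
  simp [RingHom.map_vecMul, Function.comp_def]
  congr 1
  funext j; fin_cases j <;> simp

/-- At `t = -1` the pairing of covectors and vectors is the area form. -/
theorem burauCovec_dotProduct_neg_one (g h : BraidGroup 4) :
    burauCovec (-1 : ℤˣ) g ⬝ᵥ burauVec (-1 : ℤˣ) h = areaForm (planeVec g) (planeVec h) := by
  -- At t = -1 the map x ↦ (x₀ - x₂, x₁) intertwines the Burau action with the action on the plane.
  have eqv : ∀ (k : BraidGroup 4) (x : Fin 3 → ℤ),
      (fun x : Fin 3 → ℤ => (![x 0 - x 2, x 1] : Fin 2 → ℤ)) ((burau (-1 : ℤˣ) k).1 *ᵥ x) =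
        (planeRep k : Matrix (Fin 2) (Fin 2) ℤ) *ᵥ ![x 0 - x 2, x 1] := by
    refine fun k x => equivariant_of_sigma (fun k x => (burau (-1 : ℤˣ) k).1 *ᵥ x)
      (fun k y => (planeRep k : Matrix (Fin 2) (Fin 2) ℤ) *ᵥ y) (by simp) (by simp) (by simp)
      (fun g h x => by rw [map_mul, mulVec_mulVec]; rfl)
      (fun x : Fin 3 → ℤ => (![x 0 - x 2, x 1] : Fin 2 → ℤ)) ?_ k x
    intro i x
    obtain ⟨p0, p1, p2⟩ := planeRep_sigma
    obtain ⟨a0, a1, a2⟩ := burau_sigma_val (-1 : ℤˣ)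
    match i with
    | 0 =>
      refine Eq.trans (congrArg (fun z : Matrix (Fin 3) (Fin 3) ℤ => (![(z *ᵥ x) 0 - (z *ᵥ x) 2, (z *ᵥ x) 1] : Fin 2 → ℤ)) a0)
        (Eq.trans ?_ (congrArg (fun z : SpecialLinearGroup (Fin 2) ℤ =>
          (z : Matrix (Fin 2) (Fin 2) ℤ) *ᵥ ![x 0 - x 2, x 1]) p0.symm))
      rw [transvec_mulVec]
      ext j; fin_cases j <;>
        simp [areaForm, Matrix.mulVec, dotProduct, Fin.sum_univ_three]; ring
    | 1 =>
      refine Eq.trans (congrArg (fun z : Matrix (Fin 3) (Fin 3) ℤ => (![(z *ᵥ x) 0 - (z *ᵥ x) 2, (z *ᵥ x) 1] : Fin 2 → ℤ)) a1)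
        (Eq.trans ?_ (congrArg (fun z : SpecialLinearGroup (Fin 2) ℤ =>
          (z : Matrix (Fin 2) (Fin 2) ℤ) *ᵥ ![x 0 - x 2, x 1]) p1.symm))
      rw [transvec_mulVec]
      ext j; fin_cases j <;>
        simp [areaForm, Matrix.mulVec, dotProduct, Fin.sum_univ_three]; ring
    | 2 =>
      refine Eq.trans (congrArg (fun z : Matrix (Fin 3) (Fin 3) ℤ => (![(z *ᵥ x) 0 - (z *ᵥ x) 2, (z *ᵥ x) 1] : Fin 2 → ℤ)) a2)
        (Eq.trans ?_ (congrArg (fun z : SpecialLinearGroup (Fin 2) ℤ =>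
          (z : Matrix (Fin 2) (Fin 2) ℤ) *ᵥ ![x 0 - x 2, x 1]) p2.symm))
      rw [transvec_mulVec]
      ext j; fin_cases j <;>
        simp [areaForm, Matrix.mulVec, dotProduct, Fin.sum_univ_three]; ring
  have h1 := eqv (g⁻¹ * h) ![1, 0, 0]
  rw [burauCovec, burauVec, ← dotProduct_mulVec, mulVec_mulVec, ← Units.val_mul, ← map_mul]
  have h2 : areaForm (planeVec g) (planeVec h) =
      areaForm ![1, 0] ((planeRep (g⁻¹ * h) : Matrix (Fin 2) (Fin 2) ℤ) *ᵥ ![1, 0]) := by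
    rw [planeVec, planeVec, ← areaForm_mulVec (planeRep g) ![1, 0], mulVec_mulVec]
    have : planeRep h = planeRep g * planeRep (g⁻¹ * h) := by
      rw [← map_mul, mul_inv_cancel_left]
    rw [this]
    rfl
  have h3 : (![1, 0] : Fin 2 → ℤ) = ![(![1, 0, 0] : Fin 3 → ℤ) 0 - (![1, 0, 0] : Fin 3 → ℤ) 2,
    (![1, 0, 0] : Fin 3 → ℤ) 1] := by simp
  rw [h2]
  nth_rewrite 2 [h3]
  rw [← h1]
  simp [areaForm]
  rfl

/-- At `t = 1` the vectors are the roots of the transpositions. -/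
theorem burauVec_one (g : BraidGroup 4) (f : Fin 3 → ℤ) :
    f ⬝ᵥ burauVec (1 : ℤˣ) g =
      (![0, -f 0, -f 0 - f 1, -f 0 - f 1 - f 2] : Fin 4 → ℤ) (toPerm 4 g 0) -
        (![0, -f 0, -f 0 - f 1, -f 0 - f 1 - f 2] : Fin 4 → ℤ) (toPerm 4 g 1) := by
  -- This identifies ℤ³ with the vectors of sum zero in ℤ⁴. At t = 1 braids permute the coordinates,
  -- and the vector (1, 0, 0) becomes the root e₀ - e₁.
  set ι : (Fin 3 → ℤ) → Fin 4 → ℤ := fun x => ![x 0, x 1 - x 0, x 2 - x 1, - x 2] with hι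
  have eqv : ∀ (k : BraidGroup 4) (x : Fin 3 → ℤ),
      ι ((burau (1 : ℤˣ) k).1 *ᵥ x) = fun i => ι x ((toPerm 4 k)⁻¹ i) := by
    refine fun k x => equivariant_of_sigma (fun k x => (burau (1 : ℤˣ) k).1 *ᵥ x)
      (fun k y i => y ((toPerm 4 k)⁻¹ i)) (by simp) (by simp) (by simp)
      (by simp) ι ?_ k x
    intro i x
    have hp : ∀ j, (toPerm 4 (sigma i))⁻¹ j = adjSwap 4 i j := by
      intro j
      rw [toPerm_sigma]
      simp [adjSwap]
    obtain ⟨a0, a1, a2⟩ := burau_sigma_val (1 : ℤˣ)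
    funext j
    rw [hp]
    match i with
    | 0 =>
      refine (congrArg (fun z : Matrix (Fin 3) (Fin 3) ℤ => ι (z *ᵥ x) j) a0).trans ?_
      fin_cases j <;> simp [ι, dotProduct, Fin.sum_univ_three, adjSwap, Equiv.swap_apply_def]; ring
    | 1 =>
      refine (congrArg (fun z : Matrix (Fin 3) (Fin 3) ℤ => ι (z *ᵥ x) j) a1).trans ?_
      fin_cases j <;> simp [ι, dotProduct, Fin.sum_univ_three, adjSwap, Equiv.swap_apply_def] <;> ring
    | 2 =>
      refine (congrArg (fun z : Matrix (Fin 3) (Fin 3) ℤ => ι (z *ᵥ x) j) a2).trans ?_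
      fin_cases j <;> simp [ι, dotProduct, Fin.sum_univ_three, adjSwap, Equiv.swap_apply_def]; ring
  have h1 := eqv g ![1, 0, 0]
  set H : Fin 4 → ℤ := ![0, -f 0, -f 0 - f 1, -f 0 - f 1 - f 2] with hH
  -- Summation by parts: `H` has the entries of -f as successive differences.
  have h2 : f ⬝ᵥ burauVec (1 : ℤˣ) g = ∑ i, H i * ι (burauVec 1 g) i := by
    simp [H, ι, vec3_dotProduct, Fin.sum_univ_four]; ring
  rw [h2, burauVec, h1, ← Equiv.sum_comp (toPerm 4 g)]
  simp [Fin.sum_univ_four, ι]; ring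

end BraidGroup

end

/-! ### Liftings of surjective colorings -/

section

open Matrix

/-- Vectors in space all of whose triple products vanish lie in a plane. -/
theorem exists_dotProduct_eq_zero {ι : Type*} (W : ι → Fin 3 → ℤ)
    (h : ∀ i j k, det (of ![W i, W j, W k]) = 0) : ∃ f : Fin 3 → ℤ, f ≠ 0 ∧ ∀ i, f ⬝ᵥ W i = 0 := by
  by_cases h1 : ∃ j k, W j ⨯₃ W k ≠ 0
  · obtain ⟨j, k, hjk⟩ := h1
    exact ⟨_, hjk, fun i => by rw [dotProduct_comm, triple_product_eq_det]; exact h _ _ _⟩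
  push Not at h1
  by_cases h2 : ∃ j, W j ≠ 0
  · obtain ⟨j, hj⟩ := h2
    have h3 : ∃ e : Fin 3 → ℤ, W j ⨯₃ e ≠ 0 := by
      by_contra! h3
      apply hj
      have a := h3 ![1, 0, 0]
      have b := h3 ![0, 1, 0]
      simp [cross_apply] at a b
      ext i; fin_cases i
      · exact b.2
      · exact a.2
      · exact a.1
    obtain ⟨e, he⟩ := h3
    refine ⟨_, he, fun i => ?_⟩
    rw [dotProduct_comm, triple_product_permutation, triple_product_permutation, h1 i j,
      dotProduct_zero]
  · push Not at h2
    exact ⟨![1, 0, 0], by simp, fun i => by rw [h2, dotProduct_zero]⟩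

/-- A function that is unchanged by all permutations in the image of `φ`. -/
theorem map_invariant_of_bottomColor {m : ℕ} [NeZero m] {q : Fin m → ℤ}
    (φ : PretzelGroup q →* Equiv.Perm (Fin 4)) (H : Fin 4 → ℤ)
    (h : ∀ i x, H (bottomColor φ i x) = H x) (g : PretzelGroup q) (x : Fin 4) :
    H (φ g x) = H x := by
  let K : Subgroup (Equiv.Perm (Fin 4)) :=
    { carrier := {σ | ∀ x, H (σ x) = H x}
      mul_mem' := fun {a b} ha hb x => by rw [Equiv.Perm.mul_apply, ha, hb]
      one_mem' := fun x => rfl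
      inv_mem' := fun {a} ha x => by rw [← ha (a⁻¹ x), ← Equiv.Perm.mul_apply, mul_inv_cancel, Equiv.Perm.one_apply] }
  exact map_mem_of_bottomColor_mem φ K h g x

variable {R : Type*} [CommRing R] [IsDomain R]

/-- The vectors of half twists whose product with the inverses of the half twists `1 - V'Φ'` is
constant lie in a plane. -/
theorem exists_dotProduct_eq_zero_of_mul_eq {ι : Type*} (i₀ : ι) (C : (Matrix (Fin 3) (Fin 3) R)ˣ)
    (X Y : ι → (Matrix (Fin 3) (Fin 3) R)ˣ) (hXY : ∀ i, Y i = C * X i)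
    (V P V' P' : ι → Fin 3 → R) (κ κ' : ι → Rˣ)
    (hX : ∀ i, (X i).1 = 1 - (κ i : R) • vecMulVec (V i) (P i))
    (hY : ∀ i, (Y i).1 = 1 - (κ' i : R) • vecMulVec (V' i) (P' i))
    (hG : ∀ i, P i ⬝ᵥ V i * P' i ⬝ᵥ V' i - P i ⬝ᵥ V' i * P' i ⬝ᵥ V i ≠ 0) :
    ∃ v : Fin 3 → R, v ≠ 0 ∧ ∀ i, v ⬝ᵥ V i = 0 := by
  have mulX : ∀ i v, v ᵥ* (X i).1 = v - ((κ i : R) * v ⬝ᵥ V i) • P i := by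
    intro i v
    rw [hX, vecMul_sub, vecMul_one, vecMul_smul, vecMul_vecMulVec, smul_smul]
  have mulY : ∀ i v, v ᵥ* (Y i).1 = v - ((κ' i : R) * v ⬝ᵥ V' i) • P' i := by
    intro i v
    rw [hY, vecMul_sub, vecMul_one, vecMul_smul, vecMul_vecMulVec, smul_smul]
  set v := V i₀ ⨯₃ V' i₀ with hv
  refine ⟨v, ?_, fun j => ?_⟩
  · intro h0
    apply hG i₀
    rw [← cross_dot_cross, ← hv, h0, dotProduct_zero]
  -- Since v is orthogonal to both vectors of region i₀, it is fixed by X i₀ and Y i₀, hence by C.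
  have e1 : v ᵥ* (X i₀).1 = v := by
    rw [mulX, hv, dotProduct_comm, dot_self_cross, mul_zero, zero_smul, sub_zero]
  have e2 : v ᵥ* (Y i₀).1 = v := by
    rw [mulY, hv, dotProduct_comm, dot_cross_self, mul_zero, zero_smul, sub_zero]
  have e3 : v ᵥ* C.1 = v := by
    have h1 : C = Y i₀ * (X i₀)⁻¹ := by rw [hXY, mul_inv_cancel_right]
    have h2 : v ᵥ* (X i₀)⁻¹.1 = v := by
      nth_rewrite 1 [← e1]
      rw [vecMul_vecMul, Units.mul_inv, vecMul_one]
    rw [h1, Units.val_mul, ← vecMul_vecMul, e2, h2]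
  -- The two sides differ from v by multiples of `P' j` and `P j`. The Gram determinant in `hG`
  -- makes these covectors independent, so both multiples are zero.
  have e4 : v ᵥ* (Y j).1 = v ᵥ* (X j).1 := by
    rw [hXY, Units.val_mul, ← vecMul_vecMul, e3]
  rw [mulX, mulY, sub_right_inj] at e4
  have f1 := congrArg (· ⬝ᵥ V j) e4
  have f2 := congrArg (· ⬝ᵥ V' j) e4
  simp only [smul_dotProduct, smul_eq_mul] at f1 f2
  have : ((κ j : R) * v ⬝ᵥ V j) *
      (P j ⬝ᵥ V j * P' j ⬝ᵥ V' j - P j ⬝ᵥ V' j * P' j ⬝ᵥ V j) = 0 := by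
    linear_combination (P' j ⬝ᵥ V j) * f2 - (P' j ⬝ᵥ V' j) * f1
  rcases mul_eq_zero.1 this with h | h
  · rwa [Units.mul_right_eq_zero] at h
  · exact absurd h (hG j)

end

/-! ### The area of a lifted coloring -/

section

open Matrix LaurentPolynomial BraidGroup

variable {m : ℕ} [NeZero m] {q : Fin m → ℤ}

theorem IsSimpleBraidColoring.exists_conj {ψ : PretzelGroup q →* BraidGroup 4}
    (hψ : IsSimpleBraidColoring ψ) : ∃ (g h : Fin m → BraidGroup 4) (e d : Fin m → ℤ),
      (∀ i, e i = 1 ∨ e i = -1) ∧ (∀ i, d i = 1 ∨ d i = -1) ∧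
      (∀ i, bottomColor ψ i = g i * sigma (n := 4) 0 ^ e i * (g i)⁻¹) ∧
      ∀ i, topColor ψ i = h i * sigma (n := 4) 0 ^ d i * (h i)⁻¹ := by
  have h1 : ∀ i, ∃ (g : BraidGroup 4) (e : ℤ), (e = 1 ∨ e = -1) ∧
      bottomColor ψ i = g * sigma (n := 4) 0 ^ e * g⁻¹ := fun i => (hψ _).exists_conj
  have h2 : ∀ i, ∃ (g : BraidGroup 4) (e : ℤ), (e = 1 ∨ e = -1) ∧
      topColor ψ i = g * sigma (n := 4) 0 ^ e * g⁻¹ := fun i => (hψ _).exists_conj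
  choose g e he hg using h1
  choose h d hd hh using h2
  exact ⟨g, h, e, d, he, hd, hg, hh⟩

variable {ψ : PretzelGroup q →* BraidGroup 4} {g h : Fin m → BraidGroup 4} {e d : Fin m → ℤ}

theorem exponent_sub_eq (hb : ∀ i, bottomColor ψ i = g i * sigma (n := 4) 0 ^ e i * (g i)⁻¹)
    (ht : ∀ i, topColor ψ i = h i * sigma (n := 4) 0 ^ d i * (h i)⁻¹) (i j : Fin m) :
    d i - e i = d j - e j := by
  have := congrArg exponent (topColor_mul_inv ψ i j)
  simp only [hb, ht, map_mul exponent (_ * _ * _) (_)⁻¹, map_inv exponent (_ * _),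
    exponent_halfTwist] at this
  exact Multiplicative.ofAdd.injective this

/-- The plane image of C has trace 2 + dᵢ eᵢ · area². The sign dᵢ eᵢ is determined by dᵢ - eᵢ, which
is the exponent sum of C and so independent of i. -/
theorem areaForm_sq_eq (he : ∀ i, e i = 1 ∨ e i = -1) (hd : ∀ i, d i = 1 ∨ d i = -1)
    (hb : ∀ i, bottomColor ψ i = g i * sigma (n := 4) 0 ^ e i * (g i)⁻¹)
    (ht : ∀ i, topColor ψ i = h i * sigma (n := 4) 0 ^ d i * (h i)⁻¹) (i j : Fin m) :
    areaForm (planeVec (g i)) (planeVec (h i)) ^ 2 =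
      areaForm (planeVec (g j)) (planeVec (h j)) ^ 2 := by
  have h0 := topColor_mul_inv ψ i j
  have h1 := congrArg (fun z => ((planeRep z : Matrix (Fin 2) (Fin 2) ℤ)).trace) h0
  simp only [hb, ht, map_mul planeRep (_ * _ * _) (_)⁻¹, map_inv planeRep (_ * _),
    planeRep_halfTwist _ (he _), planeRep_halfTwist _ (hd _), transvec_inv,
    trace_transvec_mul] at h1
  have h2 := exponent_sub_eq hb ht i j
  have h3 : ∀ v w : Fin 2 → ℤ, areaForm v w ^ 2 = areaForm w v ^ 2 := by
    intro v w; simp only [areaForm]; ring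
  rw [h3, h3 (planeVec (g j))]
  rcases he i with a | a <;> rcases hd i with b | b <;> rcases he j with c | c <;>
    rcases hd j with f | f <;> rw [a, b, c, f] at h1 h2 <;> linarith

/-- Burau at three values of t: the generic one puts the vectors in a plane, t = -1 shows that the
required Gram determinant is nonzero, and t = 1 carries the conclusion to S₄. -/
theorem areaForm_eq_zero_of_surjective
    (he : ∀ i, e i = 1 ∨ e i = -1) (hd : ∀ i, d i = 1 ∨ d i = -1)
    (hb : ∀ i, bottomColor ψ i = g i * sigma (n := 4) 0 ^ e i * (g i)⁻¹)
    (ht : ∀ i, topColor ψ i = h i * sigma (n := 4) 0 ^ d i * (h i)⁻¹)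
    (hs : Function.Surjective ((toPerm 4).comp ψ)) (i : Fin m) :
    areaForm (planeVec (g i)) (planeVec (h i)) = 0 := by
  by_contra hne
  have hne : ∀ j, areaForm (planeVec (g j)) (planeVec (h j)) ≠ 0 := by
    intro j hj
    have := areaForm_sq_eq he hd hb ht i j
    rw [hj] at this
    exact hne (pow_eq_zero_iff two_ne_zero |>.1 (this.trans (by norm_num)))
  set t : ℤ[T;T⁻¹]ˣ := ⟨T 1, T (-1), by rw [← T_add]; simp, by rw [← T_add]; simp⟩ with ht'
  have hev : ∀ u : ℤˣ, ∃ f : ℤ[T;T⁻¹] →+* ℤ, Units.map (f : ℤ[T;T⁻¹] →* ℤ) t = u := by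
    intro u
    refine ⟨eval₂ (RingHom.id ℤ) u, ?_⟩
    ext
    simp [t]
  choose κ hκ using fun i => burau_halfTwist t (g i) (he i)
  choose κ' hκ' using fun i => burau_halfTwist t (h i) (hd i)
  obtain ⟨v, hv, hv0⟩ := exists_dotProduct_eq_zero_of_mul_eq i
    (burau t (topColor ψ i * (bottomColor ψ i)⁻¹)) (fun j => burau t (bottomColor ψ j))
    (fun j => burau t (topColor ψ j))
    (fun j => by rw [topColor_mul_inv ψ i j, ← map_mul, inv_mul_cancel_right])
    (fun j => burauVec t (g j)) (fun j => burauCovec t (g j))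
    (fun j => burauVec t (h j)) (fun j => burauCovec t (h j)) κ κ'
    (fun j => by simp only [hb, hκ]) (fun j => by simp only [ht, hκ']) (fun j h0 => by
      obtain ⟨f, hf⟩ := hev (-1)
      have := congrArg f h0
      simp only [map_sub, map_mul, RingHom.map_dotProduct, map_burauVec, map_burauCovec, hf,
        burauCovec_dotProduct_neg_one, map_zero] at this
      -- At t = -1 the Gram determinant is the square of the area.
      have h1 : ∀ v : Fin 2 → ℤ, areaForm v v = 0 := fun v => by simp only [areaForm]; ring
      have h2 : areaForm (planeVec (h j)) (planeVec (g j)) =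
        - areaForm (planeVec (g j)) (planeVec (h j)) := by simp only [areaForm]; ring
      rw [h1, h1, h2] at this
      have h3 : areaForm (planeVec (g j)) (planeVec (h j)) ^ 2 = 0 := by linarith
      exact hne j (pow_eq_zero_iff two_ne_zero |>.1 h3))
  -- The covector v might specialize to zero at t = 1. Vanishing determinants survive specialization
  -- and provide a new covector there.
  have hdet : ∀ i j k, det (of ![burauVec t (g i), burauVec t (g j), burauVec t (g k)]) = 0 := by
    intro i j k
    refine exists_mulVec_eq_zero_iff.1 ⟨v, hv, ?_⟩
    funext l
    have := fun j => hv0 j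
    simp only [dotProduct_comm v] at this
    fin_cases l
    · exact this i
    · exact this j
    · exact this k
  obtain ⟨f, hf0, hf⟩ := exists_dotProduct_eq_zero
    (fun j => burauVec (1 : ℤˣ) (g j)) (fun i j k => by
      obtain ⟨f, hf⟩ := hev 1
      have := congrArg f (hdet i j k)
      rw [RingHom.map_det, map_zero] at this
      rw [← this, ← hf, ← map_burauVec, ← map_burauVec, ← map_burauVec]
      congr 1
      ext a b; fin_cases a <;> rfl)
  apply hf0
  set H : Fin 4 → ℤ := ![0, -f 0, -f 0 - f 1, -f 0 - f 1 - f 2] with hH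
  -- A covector that kills the roots of the bottom colors is a function on four points that is
  -- invariant under the image, hence constant if the image is S₄.
  have hinv := map_invariant_of_bottomColor ((toPerm 4).comp ψ) H (fun j x => by
    have h1 : bottomColor ((toPerm 4).comp ψ) j =
        Equiv.swap (toPerm 4 (g j) 0) (toPerm 4 (g j) 1) := by
      rw [← toPerm_halfTwist (g j) (he j), ← hb]; rfl
    have h2 : H (toPerm 4 (g j) 0) = H (toPerm 4 (g j) 1) := by
      have := hf j
      rw [burauVec_one] at this
      exact sub_eq_zero.1 this
    rw [h1, Equiv.swap_apply_def]
    split_ifs with a b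
    · rw [a, h2]
    · rw [b, h2]
    · rfl)
  have hconst : ∀ x, H x = H 0 := by
    intro x
    obtain ⟨y, hy⟩ := hs (Equiv.swap 0 x)
    have := hinv y 0
    rwa [hy, Equiv.swap_apply_left] at this
  have h1 := hconst 1
  have h2 := hconst 2
  have h3 := hconst 3
  simp [H] at h1 h2 h3
  ext j
  fin_cases j <;> simp <;> omega

end

/-! ### Closed walks in a lattice with an automorphism of trace `N` and determinant one -/

/-- The data of a step from `p` to `p'`: either `F p' = (J + f) p`, or `F p = (J + f) p'`. -/
structure LatticeStep where
  fwd : Bool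
  n : ℤ
  F : ℤ
  f : ℤ

/-- The numerical conditions on a step: `F` and `f` behave like values at `n` of Fibonacci
polynomials with consecutive indices, the first of which is odd. -/
structure LatticeStep.Valid (N : ℤ) (a : LatticeStep) : Prop where
  pos : 0 < a.n
  nonneg : 0 ≤ a.f
  mul_eq : a.n * a.F = N
  sq_eq : a.F ^ 2 = a.f ^ 2 + N * a.f + 1
  le : a.n * a.f ≤ a.F
  shape : (a.F = 1 ∧ a.f = 0) ∨ (a.F = a.n ^ 2 + 1 ∧ a.f = a.n) ∨ a.n ^ 4 + 3 * a.n ^ 2 + 1 ≤ a.F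

namespace LatticeStep

variable {N : ℤ} {a b : LatticeStep}

/-- The sign of a step. -/
def sign (a : LatticeStep) : ℤ := if a.fwd then 1 else -1

theorem Valid.F_pos (ha : a.Valid N) : 0 < a.F := by
  rcases ha.shape with h | h | h <;> nlinarith [sq_nonneg a.n, sq_nonneg (a.n ^ 2)]

theorem Valid.sq_add_one_le (ha : a.Valid N) (h1 : a.F ≠ 1) : a.n ^ 2 + 1 ≤ a.F := by
  rcases ha.shape with h | h | h
  · exact absurd h.1 h1
  · exact h.1.ge
  · nlinarith [sq_nonneg a.n, sq_nonneg (a.n ^ 2)]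

theorem Valid.f_eq_zero (ha : a.Valid N) (h1 : a.F = 1) : a.f = 0 := by
  have := ha.le
  have := ha.nonneg
  have h2 := ha.mul_eq
  have h3 := ha.sq_eq
  have := ha.pos
  rw [h1] at h2 h3
  nlinarith

theorem Valid.F_eq (ha : a.Valid N) (hb : b.Valid N) (h : a.n = b.n) : a.F = b.F := by
  have h1 := ha.mul_eq
  rw [← hb.mul_eq, h] at h1
  exact mul_left_cancel₀ hb.pos.ne' h1

theorem Valid.f_lt (ha : a.Valid N) (hb : b.Valid N) (h : b.n < a.n) : a.f < b.f := by
  by_contra! hc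
  have h1 : a.F < b.F := by
    by_contra! h2
    have := ha.mul_eq
    have := hb.mul_eq
    have := hb.F_pos
    nlinarith [ha.F_pos, hb.pos]
  have := ha.sq_eq
  have := hb.sq_eq
  have := hb.nonneg
  have : 0 < N := by rw [← ha.mul_eq]; exact mul_pos ha.pos ha.F_pos
  nlinarith [ha.F_pos, hb.F_pos]

theorem Valid.f_eq (ha : a.Valid N) (hb : b.Valid N) (h : a.n = b.n) : a.f = b.f := by
  have h1 := ha.F_eq hb h
  have h2 := ha.sq_eq
  have h3 := hb.sq_eq
  have : 0 < N := by rw [← ha.mul_eq]; exact mul_pos ha.pos ha.F_pos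
  have := ha.nonneg
  have := hb.nonneg
  rw [h1] at h2
  have h4 : (a.f - b.f) * (a.f + b.f + N) = 0 := by linear_combination h3 - h2
  rcases mul_eq_zero.1 h4 with h | h
  · linarith
  · linarith

theorem Valid.F_dvd_mul_gcd (ha : a.Valid N) (hb : b.Valid N) : a.F ∣ b.n * (Int.gcd a.F b.F) := by
  have h1 : a.F ∣ b.n * b.F := by rw [hb.mul_eq, ← ha.mul_eq]; exact dvd_mul_left _ _
  rw [Int.gcd_eq_gcd_ab, mul_add, ← mul_assoc, ← mul_assoc]
  exact dvd_add (dvd_mul_of_dvd_left (dvd_mul_left _ _) _) (dvd_mul_of_dvd_left h1 _)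

/-- A common divisor of `F` and `F'` that divides `f - s f'` divides it twice, up to a factor
two. -/
theorem Valid.sq_dvd_of_dvd_sub (ha : a.Valid N) (hb : b.Valid N) {G : ℤ} (h1 : G ∣ a.F)
    (h2 : G ∣ b.F) (h : G ∣ a.f - b.f) : G ^ 2 ∣ 2 * (a.f - b.f) := by
  obtain ⟨x, hx⟩ := h1
  obtain ⟨y, hy⟩ := h2
  obtain ⟨z, hz⟩ := h
  have hN := ha.mul_eq
  have e1 := ha.sq_eq
  have e2 := hb.sq_eq
  have e3 : (a.f - b.f) * (a.f + b.f + N) = a.F ^ 2 - b.F ^ 2 := by linear_combination e2 - e1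
  -- Modulo G² one has f (f + N) = F² - 1 ≡ -1, so f + N is a unit. Multiplying `e3` by it and using
  -- that G divides N and the difference of the f's leaves twice this difference.
  have key : 2 * (a.f - b.f) = - (a.F ^ 2 - b.F ^ 2) * (a.f + N) + 2 * a.F ^ 2 * (a.f - b.f) +
      (a.f - b.f) * (N - (a.f - b.f)) * (a.f + N) := by
    rw [← e3]; linear_combination (-2 * (a.f - b.f)) * e1
  rw [key]
  refine dvd_add (dvd_add ?_ ?_) ?_
  · rw [hx, hy]; exact ⟨-(x ^ 2 - y ^ 2) * (a.f + N), by ring⟩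
  · rw [hx]; exact ⟨2 * x ^ 2 * (a.f - b.f), by ring⟩
  · rw [hz, ← hN, hx]; exact ⟨z * (a.n * x - z) * (a.f + a.n * (G * x)), by ring⟩

theorem Valid.sq_dvd_of_dvd_add (ha : a.Valid N) (hb : b.Valid N) {G : ℤ} (h1 : G ∣ a.F)
    (h2 : G ∣ b.F) (h : G ∣ a.f + b.f) : G ^ 2 ∣ 2 * (N + a.f + b.f) := by
  obtain ⟨x, hx⟩ := h1
  obtain ⟨y, hy⟩ := h2
  obtain ⟨z, hz⟩ := h
  have hN := ha.mul_eq
  have e1 := ha.sq_eq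
  have e2 := hb.sq_eq
  have e3 : (a.f - b.f) * (a.f + b.f + N) = a.F ^ 2 - b.F ^ 2 := by linear_combination e2 - e1
  have key : 2 * (N + a.f + b.f) = - (a.F ^ 2 - b.F ^ 2) * (a.f + N) +
      2 * a.F ^ 2 * (N + a.f + b.f) + (N + (a.f + b.f)) * (-(a.f + b.f)) * (a.f + N) := by
    rw [← e3]; linear_combination (-2 * (N + a.f + b.f)) * e1
  rw [key]
  refine dvd_add (dvd_add ?_ ?_) ?_
  · rw [hx, hy]; exact ⟨-(x ^ 2 - y ^ 2) * (a.f + N), by ring⟩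
  · rw [hx]; exact ⟨2 * x ^ 2 * (N + a.f + b.f), by ring⟩
  · rw [hz, ← hN, hx]; exact ⟨(a.n * x + z) * (-z) * (a.f + a.n * (G * x)), by ring⟩

/-- If b.n < a.n, then a.F divides b.n G, while G² ≤ 2 b.f. Together with b.n b.f ≤ b.F this gives
a.F ≤ 2 a.n, against a.F ≥ a.n² + 1. -/
theorem Valid.n_eq_of_dvd_sub (ha : a.Valid N) (hb : b.Valid N) (ha1 : a.F ≠ 1)
    (h : (Int.gcd a.F b.F : ℤ) ∣ a.f - b.f) : a.n ≤ b.n := by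
  by_contra! hlt
  have h1 := ha.sq_dvd_of_dvd_sub hb (Int.gcd_dvd_left _ _) (Int.gcd_dvd_right _ _) h
  have h2 := ha.f_lt hb hlt
  have h3 := ha.F_dvd_mul_gcd hb
  set G : ℤ := (Int.gcd a.F b.F : ℤ)
  have hF := ha.F_pos
  have hbp := hb.pos
  have hG : 0 < G := by
    have : 0 < Int.gcd a.F b.F := Int.gcd_pos_of_ne_zero_left _ hF.ne'
    exact Int.natCast_pos.2 this
  have h4 := Int.le_of_dvd (by positivity) h3
  have h5 : G ^ 2 ≤ 2 * (b.f - a.f) := Int.le_of_dvd (by linarith) (by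
    have := dvd_neg.2 h1
    rwa [← mul_neg, neg_sub] at this)
  have h6 := hb.le
  have h7 := ha.nonneg
  have h8 : a.F ^ 2 ≤ b.n ^ 2 * G ^ 2 := by rw [← mul_pow]; exact pow_le_pow_left₀ hF.le h4 2
  have h9 : b.n ^ 2 * G ^ 2 ≤ b.n ^ 2 * (2 * b.f) := by gcongr; linarith
  have h10 : b.n ^ 2 * (2 * b.f) ≤ 2 * (b.n * b.F) := by nlinarith
  rw [hb.mul_eq, ← ha.mul_eq] at h10
  have h11 : a.F ≤ 2 * a.n := by
    by_contra! hc
    nlinarith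
  have := ha.sq_add_one_le ha1
  nlinarith

/-- Here G² ≤ 2 (N + a.f + b.f) only gives a cubic bound for a.F in terms of a.n. It rules out
indices at least five, where a.F has degree at least four, but not index three. -/
theorem Valid.shape_of_dvd_add (ha : a.Valid N) (hb : b.Valid N) (ha1 : a.F ≠ 1)
    (h : (Int.gcd a.F b.F : ℤ) ∣ a.f + b.f) (hlt : b.n < a.n) :
    a.F = a.n ^ 2 + 1 ∧ a.f = a.n := by
  have h1 := ha.sq_dvd_of_dvd_add hb (Int.gcd_dvd_left _ _) (Int.gcd_dvd_right _ _) h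
  have h3 := ha.F_dvd_mul_gcd hb
  set G : ℤ := (Int.gcd a.F b.F : ℤ)
  have hF := ha.F_pos
  have hbp := hb.pos
  have hG : 0 < G := by
    have : 0 < Int.gcd a.F b.F := Int.gcd_pos_of_ne_zero_left _ hF.ne'
    exact Int.natCast_pos.2 this
  have h4 := Int.le_of_dvd (by positivity) h3
  have hN : 0 < N := by rw [← ha.mul_eq]; exact mul_pos ha.pos hF
  have := ha.nonneg
  have := hb.nonneg
  have h5 : G ^ 2 ≤ 2 * (N + a.f + b.f) := Int.le_of_dvd (by linarith) h1
  have h6 := hb.le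
  have h8 : a.F ^ 2 ≤ b.n ^ 2 * G ^ 2 := by rw [← mul_pow]; exact pow_le_pow_left₀ hF.le h4 2
  have h9 : b.n ^ 2 * G ^ 2 ≤ b.n ^ 2 * (2 * (N + a.f + b.f)) := by gcongr
  have h10 : b.n ^ 2 * b.f ≤ N := by rw [← hb.mul_eq]; nlinarith
  have h11 : b.n ^ 2 * a.f ≤ N := by
    have e1 : b.n ^ 2 ≤ a.n ^ 2 := by gcongr
    have e2 : a.n ^ 2 * a.f ≤ N := by rw [← ha.mul_eq]; nlinarith [ha.le, ha.pos]
    nlinarith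
  have h12 : a.F ^ 2 ≤ 2 * N * (b.n ^ 2 + 2) := by nlinarith
  rw [← ha.mul_eq] at h12
  have h13 : a.F ≤ 2 * a.n * (b.n ^ 2 + 2) := by
    by_contra! hc
    nlinarith
  have h14 : b.n ^ 2 ≤ (a.n - 1) ^ 2 := by
    have : b.n ≤ a.n - 1 := by omega
    gcongr
  have h15 : 2 * a.n * (b.n ^ 2 + 2) ≤ 2 * a.n * ((a.n - 1) ^ 2 + 2) := by
    have := ha.pos
    gcongr
  rcases ha.shape with h | h | h
  · exact absurd h.1 ha1
  · exact h
  · nlinarith [sq_nonneg (a.n * (a.n - 1)), ha.pos]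

/-- The case where n² + 1 divides F. A quartic is bounded by twice the cubic N plus small terms, so
n is small. For k = 1 only n = 2, 3 remain, and `hsq` traps f between consecutive integers; for k ≥
2 one has n ≥ 4 and f ≤ N / 4, which is too small. -/
theorem not_sq_le_of_dvd {n k y f N F : ℤ} (hk : 0 < k) (hkn : k < n) (hky : k * y = n)
    (hN : N = n * (n ^ 2 + 1)) (hf : 0 ≤ f) (hkf : k ^ 2 * f ≤ N)
    (h : (n ^ 2 + 1) ^ 2 ≤ 2 * (N + n + f)) (hF : F = (n ^ 2 + 1) * y)
    (hsq : F ^ 2 = f ^ 2 + N * f + 1) : False := by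
  have hN0 : 0 ≤ N := by rw [hN]; nlinarith
  have key : ∀ c, c ≤ n → c * N + n ^ 2 + 1 ≤ (n ^ 2 + 1) ^ 2 ∧ c * n ≤ n ^ 2 := by
    intro c hc
    have e1 : c * n ≤ n ^ 2 := by nlinarith
    refine ⟨?_, e1⟩
    rw [hN]
    nlinarith [mul_le_mul_of_nonneg_right e1 (show 0 ≤ n ^ 2 + 1 by positivity)]
  by_cases hk1 : k = 1
  · rw [hk1, one_mul] at hky
    rw [hk1, one_pow, one_mul] at hkf
    have hn : n ≤ 3 := by
      by_contra! hc
      obtain ⟨e1, e2⟩ := key 4 (by omega)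
      linarith
    have hFN : F = N := by rw [hF, hN, hky]; ring
    rw [hFN, hN] at hsq
    have : n = 2 ∨ n = 3 := by omega
    rcases this with rfl | rfl <;> norm_num at hsq
    · have : f < 7 := by nlinarith
      have : 6 < f := by nlinarith
      omega
    · have : f < 19 := by nlinarith
      have : 18 < f := by nlinarith
      omega
  · have h2 : 2 ≤ k := by omega
    have hy2 : 2 ≤ y := by
      by_contra! hc
      have : y ≤ 1 := by omega
      nlinarith
    have hn : 4 ≤ n := by nlinarith
    obtain ⟨e1, e2⟩ := key 4 (by omega)
    have h4 : 4 ≤ k ^ 2 := by nlinarith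
    have := mul_le_mul_of_nonneg_right h4 hf
    linarith

/-- The case where the gcd is half of n² + 1, so that n is odd and the other argument is 2 c with c
dividing n. For c = 1 the values n = 3, 5, 7, 9 again trap f between consecutive integers; otherwise
c ≥ 3 and n ≥ 9. -/
theorem not_sq_le_of_two_dvd {n c y f N F : ℤ} (hc : 0 < c) (hcn : 2 * c < n) (hcy : c * y = n)
    (hodd : n % 2 = 1)
    (hN : N = n * (n ^ 2 + 1)) (hf : 0 ≤ f) (hcf : (2 * c) ^ 2 * f ≤ N)
    (h : (n ^ 2 + 1) ^ 2 ≤ 8 * (N + n + f)) (hF : 2 * c * F = N)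
    (hsq : F ^ 2 = f ^ 2 + N * f + 1) : False := by
  have hN0 : 0 ≤ N := by rw [hN]; nlinarith
  have key : ∀ c, c ≤ n → c * N + n ^ 2 + 1 ≤ (n ^ 2 + 1) ^ 2 ∧ c * n ≤ n ^ 2 := by
    intro c hc
    have e1 : c * n ≤ n ^ 2 := by nlinarith
    refine ⟨?_, e1⟩
    rw [hN]
    nlinarith [mul_le_mul_of_nonneg_right e1 (show 0 ≤ n ^ 2 + 1 by positivity)]
  by_cases hc1 : c = 1
  · rw [hc1] at hcf hF
    have hn : n ≤ 10 := by
      by_contra! hc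
      obtain ⟨e1, e2⟩ := key 11 (by omega)
      linarith
    have hFb : (2 * F) ^ 2 = N ^ 2 := by rw [← hF]; ring
    have hsq' : N ^ 2 = 4 * (f ^ 2 + N * f + 1) := by rw [← hFb, ← hsq]; ring
    rw [hN] at hsq'
    have : n = 3 ∨ n = 5 ∨ n = 7 ∨ n = 9 := by omega
    rcases this with rfl | rfl | rfl | rfl <;> norm_num at hsq'
    · have : f < 7 := by nlinarith
      have : 6 < f := by nlinarith
      omega
    · have : f < 27 := by nlinarith
      have : 26 < f := by nlinarith
      omega
    · have : f < 73 := by nlinarith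
      have : 72 < f := by nlinarith
      omega
    · have : f < 153 := by nlinarith
      have : 152 < f := by nlinarith
      omega
  · have hc3 : c ≠ 2 := by
      rintro rfl
      omega
    have hc3 : 3 ≤ c := by omega
    have hy3 : 3 ≤ y := by
      by_contra! hcc
      have : y ≤ 2 := by omega
      nlinarith
    have : 9 ≤ n := by nlinarith
    obtain ⟨e1, e2⟩ := key 9 this
    have h4 : 16 ≤ (2 * c) ^ 2 := by nlinarith
    have := mul_le_mul_of_nonneg_right h4 hf
    linarith

/-- Two steps of the same sign, the first of index three. -/
theorem Valid.not_dvd_two_mul (ha : a.Valid N) (hb : b.Valid N) (hlt : b.n < a.n)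
    (h : (Int.gcd a.F b.F : ℤ) ∣ a.f + b.f) (hs : a.F = a.n ^ 2 + 1 ∧ a.f = a.n) :
    ¬ a.F ∣ 2 * b.F := by
  intro hd
  have h1 := ha.sq_dvd_of_dvd_add hb (Int.gcd_dvd_left _ _) (Int.gcd_dvd_right _ _) h
  have hF := ha.F_pos
  have hap := ha.pos
  have hbp := hb.pos
  have hN : 0 < N := by rw [← ha.mul_eq]; exact mul_pos ha.pos hF
  have hN1 : N = a.n * (a.n ^ 2 + 1) := by rw [← ha.mul_eq, hs.1]
  have hN2 := hb.mul_eq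
  have hbf := hb.nonneg
  have hle := hb.le
  have h10 : b.n ^ 2 * b.f ≤ N := by rw [← hN2]; nlinarith
  have hd2 : a.F ∣ 2 * (Int.gcd a.F b.F : ℤ) := by
    rw [Int.gcd_eq_gcd_ab, mul_add, ← mul_assoc, ← mul_assoc]
    exact dvd_add (dvd_mul_of_dvd_left (dvd_mul_left _ _) _) (dvd_mul_of_dvd_left hd _)
  obtain ⟨x, hx⟩ := Int.gcd_dvd_left a.F b.F
  obtain ⟨y, hy⟩ := Int.gcd_dvd_right a.F b.F
  have hmax : ∀ z : ℤ, z ∣ a.F → z ∣ b.F → z ∣ (Int.gcd a.F b.F : ℤ) := fun z h1 h2 =>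
    Int.dvd_coe_gcd h1 h2
  set G : ℤ := (Int.gcd a.F b.F : ℤ)
  have hG : 0 < G := by
    have : 0 < Int.gcd a.F b.F := Int.gcd_pos_of_ne_zero_left _ hF.ne'
    exact Int.natCast_pos.2 this
  -- The cofactor of the gcd in a.F is 1 or 2, which separates the two numerical lemmas.
  have hx2 : x ∣ 2 := by
    obtain ⟨z, hz⟩ := hd2
    refine ⟨z, ?_⟩
    nth_rewrite 1 [hx] at hz
    rw [mul_comm, mul_assoc] at hz
    exact mul_left_cancel₀ hG.ne' hz
  have hxpos : 0 < x := by
    by_contra! hc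
    nlinarith
  have hx3 : x ≤ 2 := Int.le_of_dvd (by norm_num) hx2
  have h5 : G ^ 2 ≤ 2 * (N + a.f + b.f) :=
    Int.le_of_dvd (by rw [hs.2]; linarith) h1
  rw [hs.2] at h5
  have hbn : b.n * y = a.n * x := by
    have : G * (b.n * y) = G * (a.n * x) := by
      rw [mul_left_comm, ← hy, hN2, ← ha.mul_eq, hx]; ring
    exact mul_left_cancel₀ hG.ne' this
  have cases12 : x = 1 ∨ x = 2 := by omega
  rcases cases12 with rfl | rfl
  · rw [mul_one] at hx hbn
    rw [hs.1] at hx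
    rw [← hx] at h5 hy
    exact not_sq_le_of_dvd hbp hlt hbn hN1 hbf h10 h5 hy hb.sq_eq
  · have hb2 : 2 ∣ b.n := by
      -- An even y would make 2 G a common divisor.
      have hodd : ¬ 2 ∣ y := by
        rintro ⟨z, rfl⟩
        have : 2 * G ∣ G := hmax _ ⟨1, by rw [hx]; ring⟩ ⟨z, by rw [hy]; ring⟩
        have := Int.le_of_dvd hG this
        linarith
      have : (2 : ℤ) ∣ b.n * y := by rw [hbn]; exact dvd_mul_left _ _
      exact (Int.prime_two.dvd_or_dvd this).resolve_right hodd
    obtain ⟨c, hc⟩ := hb2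
    have hcy : c * y = a.n := by
      rw [hc] at hbn; linarith
    rw [hs.1] at hx
    have hnodd : a.n % 2 = 1 := by
      rcases Int.emod_two_eq_zero_or_one a.n with h | h
      · obtain ⟨w, hw⟩ := Int.dvd_of_emod_eq_zero h
        rw [hw] at hx
        have : (2 * w) ^ 2 = 2 * (2 * w ^ 2) := by ring
        omega
      · exact h
    rw [hc] at hlt h10 hN2
    exact not_sq_le_of_two_dvd (by omega) hlt hcy hnodd hN1 hbf h10
      (by rw [hx]; linarith [mul_pow G 2 2]) hN2 hb.sq_eq

end LatticeStep

/-! ### Walks, and walks in one direction -/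

section

variable {P : Type*} [AddCommGroup P]

/-- Primitive vectors that are not eigenvectors. -/
structure IsLatticeNode (J : P ≃ₗ[ℤ] P) (p : P) : Prop where
  primitive : ∀ (a G : ℤ) (z : P), a • p = G • z → G ∣ a
  indep : ∀ a b : ℤ, a • p + b • J p = 0 → b = 0

namespace LatticeStep

variable (J : P ≃ₗ[ℤ] P)

/-- The step `a` leads from `p` to `p'`. -/
def Rel (a : LatticeStep) (p p' : P) : Prop :=
  if a.fwd then a.F • p' = J p + a.f • p else a.F • p = J p' + a.f • p'

/-- The steps in the list lead from `p` to `p'`. -/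
def Walk (p : P) : List LatticeStep → P → Prop
  | [], p' => p = p'
  | a :: L, p' => ∃ r, IsLatticeNode J r ∧ Rel J a p r ∧ Walk r L p'

/-- There is a walk with the given steps that leads from some `p` to `± J ^ k p`. -/
def Closed (k : ℤ) (L : List LatticeStep) : Prop :=
  ∃ p, IsLatticeNode J p ∧ ∃ σ : P ≃ₗ[ℤ] P,
    ((∀ x, σ x = (J ^ k) x) ∨ ∀ x, σ x = -(J ^ k) x) ∧ Walk J p L (σ p)

variable {J}

theorem zpow_comm_apply (k : ℤ) (x : P) : (J ^ k) (J x) = J ((J ^ k) x) := by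
  have h : J ^ k * J = J * J ^ k := by rw [← zpow_add_one, ← zpow_one_add, add_comm]
  exact congrArg (fun f : P ≃ₗ[ℤ] P => f x) h

theorem comm_of_shift {k : ℤ} {σ : P ≃ₗ[ℤ] P}
    (hσ : (∀ x, σ x = (J ^ k) x) ∨ ∀ x, σ x = -(J ^ k) x) (x : P) : σ (J x) = J (σ x) := by
  rcases hσ with h | h
  · rw [h, h, zpow_comm_apply]
  · rw [h, h, zpow_comm_apply, map_neg]

variable {σ : P ≃ₗ[ℤ] P} (hσ : ∀ x, σ (J x) = J (σ x))

include hσ in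
theorem isLatticeNode_map {p : P} (hp : IsLatticeNode J p) : IsLatticeNode J (σ p) := by
  refine ⟨fun a G z h => hp.primitive a G (σ.symm z) ?_, fun a b h => hp.indep a b ?_⟩
  · apply σ.injective
    rw [map_zsmul, map_zsmul, h, LinearEquiv.apply_symm_apply]
  · apply σ.injective
    rw [map_add, map_zsmul, map_zsmul, hσ, h, map_zero]

include hσ in
theorem Rel.map {a : LatticeStep} {p p' : P} (h : Rel J a p p') : Rel J a (σ p) (σ p') := by
  unfold Rel at h ⊢
  split_ifs at h ⊢
  · rw [← map_zsmul, h, map_add, hσ, map_zsmul]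
  · rw [← map_zsmul, h, map_add, hσ, map_zsmul]

include hσ in
theorem Walk.map {L : List LatticeStep} {p p' : P} (h : Walk J p L p') :
    Walk J (σ p) L (σ p') := by
  induction L generalizing p with
  | nil => exact congrArg σ h
  | cons a L ih =>
    obtain ⟨r, hr, h1, h2⟩ := h
    exact ⟨σ r, isLatticeNode_map hσ hr, h1.map hσ, ih h2⟩

theorem Walk.append {L L' : List LatticeStep} {p r p' : P} (h : Walk J p L r)
    (h' : Walk J r L' p') : Walk J p (L ++ L') p' := by
  induction L generalizing p with
  | nil => rw [show p = r from h]; exact h'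
  | cons a L ih =>
    obtain ⟨s, hs, h1, h2⟩ := h
    exact ⟨s, hs, h1, ih h2⟩

theorem Closed.rotate {k : ℤ} {a : LatticeStep} {L : List LatticeStep}
    (h : Closed J k (a :: L)) : Closed J k (L ++ [a]) := by
  obtain ⟨p, -, σ, hσ, r, hr, h1, h2⟩ := h
  have hc := comm_of_shift hσ
  exact ⟨r, hr, σ, hσ, h2.append ⟨_, isLatticeNode_map hc hr, h1.map hc, rfl⟩⟩

theorem Closed.double {k : ℤ} {L : List LatticeStep} (h : Closed J k L) :
    Closed J (k + k) (L ++ L) := by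
  obtain ⟨p, hp, σ, hσ, h1⟩ := h
  refine ⟨p, hp, σ * σ, Or.inl fun x => ?_, h1.append (h1.map (comm_of_shift hσ))⟩
  rw [zpow_add]
  change σ (σ x) = (J ^ k) ((J ^ k) x)
  rcases hσ with h | h
  · rw [h, h]
  · rw [h, h, map_neg, neg_neg]

/-- A unit step is J or its inverse, so it can be moved into the closing power of J. -/
theorem Closed.of_unit {k : ℤ} {a : LatticeStep} {L : List LatticeStep}
    (h : Closed J k (a :: L)) (hF : a.F = 1) (hf : a.f = 0) : Closed J (k - a.sign) L := by
  obtain ⟨p, -, σ, hσ, r, hr, h1, h2⟩ := h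
  unfold Rel at h1
  unfold sign
  split_ifs at h1 ⊢ with hs
  · rw [hF, hf, one_smul, zero_smul, add_zero] at h1
    refine ⟨r, hr, σ * J⁻¹, ?_, ?_⟩
    · rw [zpow_sub_one]
      exact hσ.imp (fun h x => h (J⁻¹ x)) (fun h x => h (J⁻¹ x))
    · have : (σ * J⁻¹) r = σ p := by
        rw [h1]
        exact congrArg σ (J.symm_apply_apply p)
      rwa [this]
  · rw [hF, hf, one_smul, zero_smul, add_zero] at h1
    refine ⟨r, hr, σ * J, ?_, ?_⟩
    · rw [sub_neg_eq_add, zpow_add_one]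
      exact hσ.imp (fun h x => h (J x)) (fun h x => h (J x))
    · have : (σ * J) r = σ p := by rw [h1]; rfl
      rwa [this]

variable {N : ℤ} (hJ : ∀ p, J (J p) = N • J p - p)

section cone

include hJ

/-- The cone b ≥ 0, a + b > 0 is preserved by prepending a step: the new sum of coefficients is (a +
b)(1 + f) + b (N - 2). After one step the coefficient of J p is strictly positive. -/
theorem Walk.exists_of_fwd (hN : 2 ≤ N) {L : List LatticeStep} (hL : ∀ a ∈ L, a.Valid N)
    (hf : ∀ a ∈ L, a.fwd = true) {p p' : P} (h : Walk J p L p') : ∃ D a b : ℤ, D ≠ 0 ∧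
      D • p' = a • p + b • J p ∧ 0 ≤ b ∧ 0 < a + b ∧ (L ≠ [] → 0 < b) := by
  induction L generalizing p with
  | nil =>
    rw [show p = p' from h]
    exact ⟨1, 1, 0, one_ne_zero, by simp, le_rfl, one_pos, fun h => absurd rfl h⟩
  | cons c L ih =>
    obtain ⟨r, -, h1, h2⟩ := h
    obtain ⟨D, a, b, hD, h3, hb, hab, -⟩ := ih (fun a ha => hL a (List.mem_cons_of_mem _ ha))
      (fun a ha => hf a (List.mem_cons_of_mem _ ha)) h2
    have hc := hL c List.mem_cons_self
    have hcf := hc.nonneg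
    rw [Rel, if_pos (hf c List.mem_cons_self)] at h1
    have h4 : 0 < a + b * N + b * c.f := by nlinarith
    refine ⟨c.F * D, a * c.f - b, a + b * N + b * c.f, mul_ne_zero hc.F_pos.ne' hD, ?_, h4.le,
      by nlinarith, fun _ => h4⟩
    rw [mul_smul, h3, smul_add, smul_comm c.F, smul_comm c.F, ← map_zsmul J, h1, map_add,
      map_zsmul, hJ]
    module

theorem Walk.exists_of_not_fwd (hN : 2 ≤ N) {L : List LatticeStep} (hL : ∀ a ∈ L, a.Valid N)
    (hf : ∀ a ∈ L, a.fwd = false) {p p' : P} (h : Walk J p L p') : ∃ D a b : ℤ, D ≠ 0 ∧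
      D • p = a • p' + b • J p' ∧ 0 ≤ b ∧ 0 < a + b ∧ (L ≠ [] → 0 < b) := by
  induction L generalizing p with
  | nil =>
    rw [show p = p' from h]
    exact ⟨1, 1, 0, one_ne_zero, by simp, le_rfl, one_pos, fun h => absurd rfl h⟩
  | cons c L ih =>
    obtain ⟨r, -, h1, h2⟩ := h
    obtain ⟨D, a, b, hD, h3, hb, hab, -⟩ := ih (fun a ha => hL a (List.mem_cons_of_mem _ ha))
      (fun a ha => hf a (List.mem_cons_of_mem _ ha)) h2
    have hc := hL c List.mem_cons_self
    have hcf := hc.nonneg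
    rw [Rel, if_neg (by rw [hf c List.mem_cons_self]; simp)] at h1
    have h4 : 0 < a + b * N + b * c.f := by nlinarith
    refine ⟨D * c.F, a * c.f - b, a + b * N + b * c.f, mul_ne_zero hD hc.F_pos.ne', ?_, h4.le,
      by nlinarith, fun _ => h4⟩
    rw [mul_smul, h1, smul_add, ← map_zsmul J, smul_comm D, h3, map_add, map_zsmul, map_zsmul, hJ]
    module

/-- Steps of the same sign never lead back. -/
theorem not_closed_zero_of_fwd_eq (hN : 2 ≤ N) {L : List LatticeStep} (hL : ∀ a ∈ L, a.Valid N)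
    (h0 : L ≠ []) (s : Bool) (hf : ∀ a ∈ L, a.fwd = s) : ¬ Closed J 0 L := by
  rintro ⟨p, hp, σ, hσ, h⟩
  have hσ' : ∃ ε : ℤ, ε ≠ 0 ∧ ∀ x, σ x = ε • x := by
    rcases hσ with h | h
    · exact ⟨1, one_ne_zero, fun x => by rw [h, zpow_zero, one_smul]; rfl⟩
    · exact ⟨-1, by norm_num, fun x => by rw [h, zpow_zero, neg_smul, one_smul]; rfl⟩
  obtain ⟨ε, hε, hσ'⟩ := hσ'
  rw [hσ'] at h
  cases s with
  | true =>
    obtain ⟨D, a, b, -, h1, -, -, h2⟩ := h.exists_of_fwd hJ hN hL hf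
    have := hp.indep (a - D * ε) b (by
      rw [sub_smul, mul_smul, h1]; abel)
    exact (h2 h0).ne' this
  | false =>
    obtain ⟨D, a, b, -, h1, -, -, h2⟩ := h.exists_of_not_fwd hJ hN hL hf
    have := hp.indep (a * ε - D) (b * ε) (by
      rw [sub_smul, mul_smul, mul_smul, ← map_zsmul, h1]; abel)
    exact mul_ne_zero (h2 h0).ne' hε this

/-- A positive power of J is a walk of forward unit steps, which cannot end at ± its start. -/
theorem eq_zero_of_closed_nil (hN : 2 ≤ N) {k : ℤ} (h : Closed J k []) : k = 0 := by
  have key : ∀ n : ℕ, n ≠ 0 → ∀ p, IsLatticeNode J p → ¬ ((J ^ n) p = p ∨ (J ^ n) p = -p) := by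
    intro n hn p hp hpn
    set u : LatticeStep := ⟨true, N, 1, 0⟩
    have hu : u.Valid N := ⟨by simp [u]; omega, le_rfl, by simp [u], by simp [u], by simp [u],
      Or.inl ⟨rfl, rfl⟩⟩
    have hw : ∀ (n : ℕ) (p : P), IsLatticeNode J p → Walk J p (List.replicate n u) ((J ^ n) p) := by
      intro n
      induction n with
      | zero => intro p _; rfl
      | succ n ih =>
        intro p hp
        have hp' := isLatticeNode_map (σ := J) (fun x => rfl) hp
        exact ⟨J p, hp', by simp [Rel, u], by rw [pow_succ]; exact ih _ hp'⟩
    refine not_closed_zero_of_fwd_eq hJ hN (L := List.replicate n u)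
      (fun a ha => (List.eq_of_mem_replicate ha) ▸ hu) (by simp [hn]) true
      (fun a ha => by rw [List.eq_of_mem_replicate ha]) ⟨p, hp, ?_⟩
    rcases hpn with h | h
    · exact ⟨1, Or.inl fun x => rfl, by have := hw n p hp; rwa [h] at this⟩
    · exact ⟨LinearEquiv.neg ℤ, Or.inr fun x => rfl, by have := hw n p hp; rwa [h] at this⟩
  obtain ⟨p, hp, σ, hσ, h⟩ := h
  have h : p = σ p := h
  have h1 : (J ^ k) p = p ∨ (J ^ k) p = -p := by
    rcases hσ with h' | h'
    · rw [h'] at h; exact Or.inl h.symm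
    · rw [h'] at h; right; nth_rewrite 2 [h]; rw [neg_neg]
  by_contra hk
  obtain ⟨n, rfl | rfl⟩ := k.eq_nat_or_neg
  · exact key n (by rintro rfl; exact hk rfl) p hp (by simpa using h1)
  · refine key n (by rintro rfl; exact hk rfl) p hp ?_
    have hc : ∀ x, (J ^ n) ((J ^ (-(n : ℤ))) x) = x := by
      intro x
      rw [zpow_neg, zpow_natCast]
      exact (J ^ n).apply_symm_apply x
    rcases h1 with h1 | h1
    · left; nth_rewrite 1 [← h1]; exact hc p
    · right
      have := hc p
      rw [h1, map_neg] at this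
      rw [← this, neg_neg, this]

end cone

end LatticeStep

end

/-! ### Consecutive steps and parity of closed walks -/

section

variable {P : Type*} [AddCommGroup P] [Module.IsTorsionFree ℤ P]

namespace LatticeStep

variable {J : P ≃ₗ[ℤ] P} {N : ℤ} (hJ : ∀ p, J (J p) = N • J p - p) {a b c : LatticeStep} {p r : P}

include hJ in
-- The identity (J - f)(J + f) = N (J + f) - F² applied to p. It gives a step the same form at both
-- ends, up to the sign of f.
theorem Rel.exists_smul_of_fwd (ha : a.Valid N) (h : a.F • r = J p + a.f • p) :
    J r - a.f • r = a.F • (a.n • r - p) := by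
  have hF := ha.F_pos.ne'
  apply smul_right_injective P hF
  simp only [smul_sub, ← map_zsmul J]
  rw [smul_comm a.F a.f, smul_comm a.F a.n, h, map_add, map_zsmul, hJ, ← ha.mul_eq]
  have e : a.F • a.F • p = (a.f ^ 2 + a.n * a.F * a.f + 1) • p := by
    rw [smul_smul, ← sq, ha.sq_eq, ha.mul_eq]
  rw [e]
  module

include hJ in
theorem Rel.source (ha : a.Valid N) (h : Rel J a p r) :
    ∃ z, J p + (a.sign * a.f) • p = a.F • z := by
  unfold Rel at h
  unfold sign
  split_ifs at h ⊢
  · exact ⟨r, by rw [h, one_mul]⟩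
  · exact ⟨_, by rw [← Rel.exists_smul_of_fwd hJ ha h, neg_one_mul, neg_smul, sub_eq_add_neg]⟩

include hJ in
theorem Rel.target (ha : a.Valid N) (h : Rel J a p r) :
    ∃ z, J r - (a.sign * a.f) • r = a.F • z := by
  unfold Rel at h
  unfold sign
  split_ifs at h ⊢
  · exact ⟨_, by rw [← Rel.exists_smul_of_fwd hJ ha h, one_mul]⟩
  · exact ⟨p, by rw [h, neg_one_mul, neg_smul, sub_neg_eq_add]⟩

-- Modulo the gcd, arriving by a makes J r a multiple of r, and leaving by b makes it another one.
-- As r is primitive, the factors agree.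
include hJ in
theorem gcd_dvd_of_rel {p' : P} (ha : a.Valid N) (hb : b.Valid N) (hr : IsLatticeNode J r)
    (h1 : Rel J a p r) (h2 : Rel J b r p') :
    (Int.gcd a.F b.F : ℤ) ∣ a.sign * a.f + b.sign * b.f := by
  obtain ⟨z, hz⟩ := h1.target hJ ha
  obtain ⟨w, hw⟩ := h2.source hJ hb
  obtain ⟨x, hx⟩ := Int.gcd_dvd_left a.F b.F
  obtain ⟨y, hy⟩ := Int.gcd_dvd_right a.F b.F
  refine hr.primitive _ _ (y • w - x • z) ?_
  rw [smul_sub, smul_smul, smul_smul, ← hx, ← hy, ← hz, ← hw]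
  module

include hJ in
/-- Two consecutive steps of a walk. -/
theorem pair_of_rel {p' : P} (hN : 3 ≤ N) (ha : a.Valid N) (hb : b.Valid N)
    (hr : IsLatticeNode J r) (h1 : Rel J a p r) (h2 : Rel J b r p') (ha1 : a.F ≠ 1)
    (hb1 : b.F ≠ 1) : (a.n = b.n ∧ a.fwd ≠ b.fwd) ∨ (a.fwd = b.fwd ∧
      (Int.gcd a.F b.F : ℤ) ∣ a.f + b.f ∧
      (b.n < a.n ∧ (a.F = a.n ^ 2 + 1 ∧ a.f = a.n) ∨
        a.n < b.n ∧ (b.F = b.n ^ 2 + 1 ∧ b.f = b.n))) := by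
  have hd := gcd_dvd_of_rel hJ ha hb hr h1 h2
  by_cases hs : a.fwd = b.fwd
  · right
    have hd' : (Int.gcd a.F b.F : ℤ) ∣ a.f + b.f := by
      unfold sign at hd
      rw [hs] at hd
      split_ifs at hd
      · simpa using hd
      · obtain ⟨z, hz⟩ := hd; exact ⟨-z, by linear_combination -hz⟩
    refine ⟨hs, hd', ?_⟩
    rcases lt_trichotomy b.n a.n with h | h | h
    · exact Or.inl ⟨h, ha.shape_of_dvd_add hb ha1 hd' h⟩
    · exfalso
      have hF := ha.F_eq hb h.symm
      have hf := ha.f_eq hb h.symm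
      rw [← hF, ← hf, Int.gcd_self] at hd'
      have hd2 : a.F ∣ 2 * a.f := by
        rw [two_mul]; exact (Int.natAbs_dvd.1 hd')
      -- From F ∣ 2 f and F² = f (f + N) + 1 one gets F ∣ 2, so n = 1 and N ≤ 2. This is where N ≥ 3
      -- is needed.
      have h2 : a.F ∣ 2 := by
        have e : (2 : ℤ) = a.F * (2 * a.F) - (2 * a.f) * (a.f + N) := by
          linear_combination (-2) * ha.sq_eq
        rw [e]
        exact dvd_sub (dvd_mul_right _ _) (dvd_mul_of_dvd_left hd2 _)
      have h3 := Int.le_of_dvd two_pos h2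
      have h4 := ha.sq_add_one_le ha1
      have h5 := ha.mul_eq
      have h6 := ha.pos
      have : a.n = 1 := by nlinarith
      rw [this] at h5
      omega
    · exact Or.inr ⟨h, hb.shape_of_dvd_add ha hb1 (by rwa [Int.gcd_comm, add_comm]) h⟩
  · left
    refine ⟨?_, hs⟩
    have hd' : (Int.gcd a.F b.F : ℤ) ∣ a.f - b.f := by
      unfold sign at hd
      cases h : a.fwd <;> cases h' : b.fwd <;> simp [h, h'] at hd hs
      · obtain ⟨z, hz⟩ := hd; exact ⟨-z, by linear_combination -hz⟩
      · simpa [sub_eq_add_neg] using hd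
    refine le_antisymm (ha.n_eq_of_dvd_sub hb ha1 hd') (hb.n_eq_of_dvd_sub ha hb1 ?_)
    rw [Int.gcd_comm, ← dvd_neg, neg_sub]
    exact hd'

include hJ in
omit [Module.IsTorsionFree ℤ P] in
theorem dvd_two_mul_of_rel (hs : a.F = a.n ^ 2 + 1 ∧ a.f = a.n)
    (hp : IsLatticeNode J r) {x y : P} {F' f' : ℤ} (h : F' • r = J p + f' • p)
    (hx : J p - a.f • p = a.F • x) (hy : J r + a.f • r = a.F • y) : a.F ∣ 2 * F' := by
  -- Modulo a.F one has J p ≡ f p and J r ≡ -f r. Expanding F' (J r + f r) by F' r = (J + f') p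
  -- gives 2 f F' r ≡ 0. Afterwards f = n is removed, being prime to F = n² + 1.
  have h1 : a.F ∣ 2 * a.f * F' := by
    refine hp.primitive _ _ (F' • y - (f' • x + J x)) ?_
    have e1 : J (a.F • x) = N • J p - p - a.f • J p := by
      rw [← hx, map_sub, hJ, map_zsmul]
    have e2 : F' • J r = N • J p - p + f' • J p := by
      rw [← map_zsmul, h, map_add, hJ, map_zsmul]
    rw [smul_sub, smul_add, smul_comm a.F F' y, smul_comm a.F f' x, ← hx, ← hy, ← map_zsmul J, e1,
      smul_add, e2]
    have e3 : (2 * a.f * F') • r = a.f • F' • r + F' • a.f • r := by module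
    rw [e3, h]
    module
  rw [hs.2] at h1
  have e : 2 * F' = a.F * (2 * F') - a.n * (2 * a.n * F') := by rw [hs.1]; ring
  rw [e]
  exact dvd_sub (dvd_mul_right _ _) (dvd_mul_of_dvd_right h1 _)

-- Steps of index three on both sides of a step with smaller parameter would force a.F ∣ 2 b.F,
-- which `Valid.not_dvd_two_mul` forbids.
include hJ in
theorem not_rel_of_rel {p₀ p₁ p₂ p₃ : P} (ha : a.Valid N) (hb : b.Valid N) (hc : c.Valid N)
    (h₁ : IsLatticeNode J p₁) (h₂ : IsLatticeNode J p₂) (hab : a.fwd = b.fwd) (hbc : b.fwd = c.fwd)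
    (hac : a.n = c.n) (hlt : b.n < a.n) (hs : a.F = a.n ^ 2 + 1 ∧ a.f = a.n)
    (hd : (Int.gcd a.F b.F : ℤ) ∣ a.f + b.f)
    (r₁ : Rel J a p₀ p₁) (r₂ : Rel J b p₁ p₂) : ¬ Rel J c p₂ p₃ := by
  intro r₃
  refine ha.not_dvd_two_mul hb hlt hd hs ?_
  obtain ⟨x, hx⟩ := r₁.target hJ ha
  obtain ⟨y, hy⟩ := r₃.source hJ hc
  rw [← ha.F_eq hc hac, ← ha.f_eq hc hac] at hy
  unfold sign at hx hy
  unfold Rel at r₂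
  rw [hab] at hx
  rw [← hbc] at hy
  split_ifs at hx hy r₂
  · rw [one_mul] at hx hy
    exact dvd_two_mul_of_rel hJ hs h₂ r₂ hx hy
  · rw [neg_one_mul, neg_smul] at hx hy
    rw [sub_neg_eq_add] at hx
    rw [← sub_eq_add_neg] at hy
    exact dvd_two_mul_of_rel hJ hs h₁ r₂ hy hx

include hJ in
theorem eq_of_backtrack {p' : P} (ha : a.Valid N) (hb : b.Valid N) (hn : a.n = b.n)
    (hs : a.fwd ≠ b.fwd) (h1 : Rel J a p r) (h2 : Rel J b r p') : p = p' := by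
  have hF := ha.F_eq hb hn
  have hf := ha.f_eq hb hn
  unfold Rel at h1 h2
  rw [← hF, ← hf] at h2
  cases ha' : a.fwd <;> cases hb' : b.fwd <;> simp [ha', hb'] at h1 h2 hs
  · exact smul_right_injective P ha.F_pos.ne' (h1.trans h2.symm)
  · have h3 := Rel.exists_smul_of_fwd hJ ha h1
    have h4 := Rel.exists_smul_of_fwd hJ ha (h2.symm.trans h1 ▸ h2 : a.F • r = J p' + a.f • p')
    have h5 := smul_right_injective P ha.F_pos.ne' (h3.symm.trans h4)
    exact sub_right_injective h5

theorem Closed.of_backtrack (hJ : ∀ p, J (J p) = N • J p - p) {k : ℤ} {L : List LatticeStep}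
    (ha : a.Valid N) (hb : b.Valid N) (hn : a.n = b.n)
    (hs : a.fwd ≠ b.fwd) (h : Closed J k (a :: b :: L)) : Closed J k L := by
  obtain ⟨p, hp, σ, hσ, r, hr, h1, r', hr', h2, h3⟩ := h
  rw [← eq_of_backtrack hJ ha hb hn hs h1 h2] at h3
  exact ⟨p, hp, σ, hσ, h3⟩

theorem Closed.pair (hJ : ∀ p, J (J p) = N • J p - p) {k : ℤ} {L : List LatticeStep} (hN : 3 ≤ N)
    (ha : a.Valid N) (hb : b.Valid N) (ha1 : a.F ≠ 1)
    (hb1 : b.F ≠ 1) (h : Closed J k (a :: b :: L)) :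
    (a.n = b.n ∧ a.fwd ≠ b.fwd) ∨ (a.fwd = b.fwd ∧
      (Int.gcd a.F b.F : ℤ) ∣ a.f + b.f ∧
      (b.n < a.n ∧ (a.F = a.n ^ 2 + 1 ∧ a.f = a.n) ∨
        a.n < b.n ∧ (b.F = b.n ^ 2 + 1 ∧ b.f = b.n))) := by
  obtain ⟨p, hp, σ, hσ, r, hr, h1, r', hr', h2, h3⟩ := h
  exact pair_of_rel hJ hN ha hb hr h1 h2 ha1 hb1

theorem Closed.not_triple (hJ : ∀ p, J (J p) = N • J p - p) {k : ℤ} {L : List LatticeStep}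
    (ha : a.Valid N) (hb : b.Valid N) (hc : c.Valid N) (hab : a.fwd = b.fwd) (hbc : b.fwd = c.fwd)
    (hac : a.n = c.n) (hlt : b.n < a.n) (hs : a.F = a.n ^ 2 + 1 ∧ a.f = a.n)
    (hd : (Int.gcd a.F b.F : ℤ) ∣ a.f + b.f) : ¬ Closed J k (a :: b :: c :: L) := by
  rintro ⟨p, hp, σ, hσ, r, hr, h1, r', hr', h2, r'', hr'', h3, -⟩
  exact not_rel_of_rel hJ ha hb hc hr hr' hab hbc hac hlt hs hd h1 h2 h3

theorem Valid.n_eq_of_shape (ha : a.Valid N) (hb : b.Valid N)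
    (hsa : a.F = a.n ^ 2 + 1 ∧ a.f = a.n) (hsb : b.F = b.n ^ 2 + 1 ∧ b.f = b.n) : a.n = b.n := by
  have h1 := ha.mul_eq
  rw [← hb.mul_eq, hsa.1, hsb.1] at h1
  have := ha.pos
  have := hb.pos
  have h2 : (a.n - b.n) * (a.n ^ 2 + a.n * b.n + b.n ^ 2 + 1) = 0 := by linear_combination h1
  rcases mul_eq_zero.1 h2 with h | h
  · linarith
  · nlinarith

/-- The parity of the number of steps of a closed walk. -/
theorem even_length_add (hJ : ∀ p, J (J p) = N • J p - p) (hN : 3 ≤ N) (m : ℕ) :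
    ∀ (L : List LatticeStep) (k : ℤ), L.length = m → (∀ a ∈ L, a.Valid N) → Closed J k L →
      Even ((m : ℤ) + k) := by
  induction m using Nat.strong_induction_on with
  | _ m IH =>
  intro L k hm hL hC
  by_contra hodd
  -- In a minimal counterexample no step is a unit: removing it changes both length and k by one.
  have unit : ∀ a L, (a :: L).length = m → (∀ c ∈ a :: L, c.Valid N) → Closed J k (a :: L) →
      a.F ≠ 1 := by
    intro a L hl hv hC h1
    have ha := hv a List.mem_cons_self
    have h2 := hC.of_unit h1 (ha.f_eq_zero h1)
    rw [List.length_cons] at hl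
    have h3 := IH L.length (by omega) L _ rfl (fun c hc => hv c (List.mem_cons_of_mem _ hc)) h2
    apply hodd
    unfold sign at h3
    rw [Int.even_iff] at h3 ⊢
    split_ifs at h3 <;> omega
  -- Backtracking would shorten the walk by two. So neighbors have the same direction, and the one
  -- with the larger n has index three; call it large.
  have key : ∀ a b L, (a :: b :: L).length = m → (∀ c ∈ a :: b :: L, c.Valid N) →
      Closed J k (a :: b :: L) → (a.fwd = b.fwd ∧ (Int.gcd a.F b.F : ℤ) ∣ a.f + b.f ∧
      (b.n < a.n ∧ (a.F = a.n ^ 2 + 1 ∧ a.f = a.n) ∨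
        a.n < b.n ∧ (b.F = b.n ^ 2 + 1 ∧ b.f = b.n))) := by
    intro a b L hl hv hC
    have hva := hv a (by simp)
    have hvb := hv b (by simp)
    have ha := unit _ _ hl hv hC
    have hb := unit b (L ++ [a]) (by simpa using hl) (fun c hc => hv c (by
      simp at hc ⊢; tauto)) hC.rotate
    refine (hC.pair hJ hN hva hvb ha hb).resolve_left fun ⟨h1, h2⟩ => ?_
    have h3 := hC.of_backtrack hJ hva hvb h1 h2
    simp only [List.length_cons] at hl
    have h4 := IH L.length (by omega) L _ rfl (fun c hc => hv c (by simp [hc])) h3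
    apply hodd
    rw [Int.even_iff] at h4 ⊢
    omega
  -- All large steps have the same n, because n (n² + 1) = N. So large and small steps alternate
  -- cyclically, and large, small, large is impossible. Lengths one and two are treated by going
  -- around twice.
  match L, hm, hL, hC with
  | [], hm, hL, hC =>
    have := eq_zero_of_closed_nil hJ (by omega) hC
    rw [← hm, this] at hodd
    exact hodd (by simp)
  | [a], hm, hL, hC =>
    have ha := hL a (by simp)
    have h1 := unit _ _ hm hL hC
    rcases hC.double.pair hJ hN ha ha h1 h1 with h | ⟨-, -, h | h⟩
    · exact h.2 rfl
    · exact lt_irrefl _ h.1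
    · exact lt_irrefl _ h.1
  | [a, b], hm, hL, hC =>
    have ha := hL a (by simp)
    have hb := hL b (by simp)
    obtain ⟨h1, h2, ⟨h3, h4⟩ | ⟨h3, h4⟩⟩ := key _ _ _ hm hL hC
    · exact Closed.not_triple hJ ha hb ha h1 h1.symm rfl h3 h4 h2 hC.double
    · exact Closed.not_triple hJ hb ha hb h1.symm h1 rfl h3 h4
        (by rwa [Int.gcd_comm, add_comm]) hC.rotate.double
  | a :: b :: c :: L, hm, hL, hC =>
    have ha := hL a (by simp)
    have hb := hL b (by simp)
    have hc := hL c (by simp)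
    obtain ⟨h1, h2, h3⟩ := key _ _ _ hm hL hC
    obtain ⟨h1', h2', h3'⟩ := key b c (L ++ [a]) (by simpa using hm)
      (fun d hd => hL d (by simp at hd ⊢; tauto)) hC.rotate
    rcases h3 with ⟨h3, h4⟩ | ⟨h3, h4⟩
    · rcases h3' with ⟨h3', h4'⟩ | ⟨h3', h4'⟩
      · exact h3.ne (hb.n_eq_of_shape ha h4' h4)
      · exact Closed.not_triple hJ ha hb hc h1 h1' (ha.n_eq_of_shape hc h4 h4') h3 h4 h2 hC
    · rcases h3' with ⟨h3', h4'⟩ | ⟨h3', h4'⟩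
      · match L, hm, hL, hC with
        | [], hm, hL, hC =>
          obtain ⟨-, -, ⟨h5, h6⟩ | ⟨h5, h6⟩⟩ := key c a [b] (by simpa using hm)
            (fun d hd => hL d (by simp at hd ⊢; tauto)) hC.rotate.rotate
          · exact h3'.ne (hc.n_eq_of_shape hb h6 h4)
          · exact h3.ne (ha.n_eq_of_shape hb h6 h4)
        | d :: L, hm, hL, hC =>
          have hd := hL d (by simp)
          obtain ⟨h1'', -, ⟨h5, h6⟩ | ⟨h5, h6⟩⟩ := key c d (L ++ [a] ++ [b]) (by simpa using hm)
            (fun d hd => hL d (by simp at hd ⊢; tauto)) hC.rotate.rotate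
          · exact h3'.ne (hc.n_eq_of_shape hb h6 h4)
          · exact Closed.not_triple hJ hb hc hd h1' h1'' (hb.n_eq_of_shape hd h4 h6) h3' h4 h2'
              hC.rotate
      · exact h3'.ne (hb.n_eq_of_shape hc h4 h4')

end LatticeStep

end

/-! ### Fibonacci polynomials at positive integers -/

theorem fibPoly_add_two (n : ℤ) (k : ℕ) :
    fibPoly n (k + 2) = n * fibPoly n (k + 1) + fibPoly n k := rfl

theorem fibPoly_neg (n : ℤ) (k : ℕ) : fibPoly (-n) k = (-1) ^ (k + 1) * fibPoly n k := by
  induction k using Nat.twoStepInduction with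
  | zero => simp [fibPoly]
  | one => simp [fibPoly]
  | more k h1 h2 => rw [fibPoly_add_two, fibPoly_add_two, h1, h2]; ring

theorem fibPoly_nonneg {n : ℤ} (hn : 0 < n) (k : ℕ) : 0 ≤ fibPoly n k := by
  induction k using Nat.twoStepInduction with
  | zero => simp [fibPoly]
  | one => simp [fibPoly]
  | more k h1 h2 => rw [fibPoly_add_two]; positivity

theorem fibPoly_pos {n : ℤ} (hn : 0 < n) (k : ℕ) : 0 < fibPoly n (k + 1) := by
  induction k with
  | zero => simp [fibPoly]
  | succ k h =>
    rw [fibPoly_add_two]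
    have := fibPoly_nonneg hn k
    positivity

theorem fibPoly_ne_zero {n : ℤ} (hn : n ≠ 0) {k : ℕ} (hk : k ≠ 0) : fibPoly n k ≠ 0 := by
  obtain ⟨k, rfl⟩ := Nat.exists_eq_succ_of_ne_zero hk
  rcases hn.lt_or_gt with h | h
  · have h1 := (fibPoly_pos (neg_pos.2 h) k).ne'
    rw [fibPoly_neg] at h1
    exact right_ne_zero_of_mul h1
  · exact (fibPoly_pos h k).ne'

theorem fibPolyZ_ne_zero {n k : ℤ} (hn : n ≠ 0) (hk : k ≠ 0) : fibPolyZ n k ≠ 0 := by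
  obtain ⟨j, rfl | rfl⟩ := k.eq_nat_or_neg
  · exact fibPoly_ne_zero hn (by rintro rfl; exact hk rfl)
  · rw [fibPolyZ_neg_natCast]
    exact mul_ne_zero (by simp) (fibPoly_ne_zero hn (by rintro rfl; exact hk rfl))

theorem fibPoly_sq (n : ℤ) (j : ℕ) : fibPoly n (2 * j + 1) ^ 2 =
    fibPoly n (2 * j) ^ 2 + n * fibPoly n (2 * j + 1) * fibPoly n (2 * j) + 1 := by
  induction j with
  | zero => simp [fibPoly]
  | succ j ih =>
    have h1 : fibPoly n (2 * (j + 1)) = n * fibPoly n (2 * j + 1) + fibPoly n (2 * j) := rfl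
    have h2 : fibPoly n (2 * (j + 1) + 1) =
      n * fibPoly n (2 * (j + 1)) + fibPoly n (2 * j + 1) := rfl
    rw [h2, h1]
    linear_combination ih

theorem fibPoly_shape {n : ℤ} (hn : 0 < n) (j : ℕ) :
    n ^ 4 + 3 * n ^ 2 + 1 ≤ fibPoly n (2 * (j + 2) + 1) := by
  induction j with
  | zero => simp only [fibPoly]; linarith [show n * (n * (n * (n * 1 + 0) + 1) + (n * 1 + 0)) + (n * (n * 1 + 0) + 1) = n ^ 4 + 3 * n ^ 2 + 1 by ring]
  | succ j ih =>
    have h : fibPoly n (2 * (j + 1 + 2) + 1) =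
      n * fibPoly n (2 * (j + 2) + 2) + fibPoly n (2 * (j + 2) + 1) := rfl
    have := fibPoly_nonneg hn (2 * (j + 2) + 2)
    rw [h]
    nlinarith

theorem latticeStep_valid {n N : ℤ} (hn : 0 < n) (s : Bool) (j : ℕ)
    (hN : n * fibPoly n (2 * j + 1) = N) :
    LatticeStep.Valid N ⟨s, n, fibPoly n (2 * j + 1), fibPoly n (2 * j)⟩ where
  pos := hn
  nonneg := fibPoly_nonneg hn _
  mul_eq := hN
  sq_eq := by rw [← hN]; exact fibPoly_sq n j
  le := by
    match j with
    | 0 => simp [fibPoly]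
    | j + 1 =>
      have h : fibPoly n (2 * (j + 1) + 1) =
        n * fibPoly n (2 * (j + 1)) + fibPoly n (2 * j + 1) := rfl
      have := fibPoly_nonneg hn (2 * j + 1)
      simp only [h]
      linarith
  shape := by
    match j with
    | 0 => exact Or.inl ⟨by simp [fibPoly], by simp [fibPoly]⟩
    | 1 => exact Or.inr (Or.inl ⟨by simp [fibPoly]; ring, by simp [fibPoly]⟩)
    | j + 2 => exact Or.inr (Or.inr (fibPoly_shape hn j))

/-! ### Twist regions as steps of a walk -/

section

/-- The map `(x, y) ↦ (y, N y - x)` on pairs of vectors of the plane. -/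
def latticeShift (N : ℤ) : ((Fin 2 → ℤ) × (Fin 2 → ℤ)) ≃ₗ[ℤ] ((Fin 2 → ℤ) × (Fin 2 → ℤ)) where
  toFun p := (p.2, N • p.2 - p.1)
  invFun p := (N • p.1 - p.2, p.1)
  left_inv p := by simp
  right_inv p := by simp
  map_add' p p' := by ext <;> simp; ring
  map_smul' c p := by ext <;> simp; ring

theorem latticeShift_apply (N : ℤ) (x y : Fin 2 → ℤ) :
    latticeShift N (x, y) = (y, N • y - x) := rfl

theorem latticeShift_latticeShift (N : ℤ) (p : (Fin 2 → ℤ) × (Fin 2 → ℤ)) :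
    latticeShift N (latticeShift N p) = N • latticeShift N p - p := by
  obtain ⟨x, y⟩ := p
  simp [latticeShift_apply]

theorem isLatticeNode_of_isCoprime {N : ℤ} {x y : Fin 2 → ℤ} (hx : IsCoprime (x 0) (x 1))
    (hxy : areaForm y x ≠ 0) : IsLatticeNode (latticeShift N) (x, y) := by
  refine ⟨fun a G z h => ?_, fun a b h => ?_⟩
  · obtain ⟨s, t, hst⟩ := hx
    have h0 := congrFun (congrArg Prod.fst h) 0
    have h1 := congrFun (congrArg Prod.fst h) 1
    simp at h0 h1
    refine ⟨s * z.1 0 + t * z.1 1, ?_⟩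
    linear_combination (-a) * hst + s * h0 + t * h1
  · rw [latticeShift_apply] at h
    have h0 := congrFun (congrArg Prod.fst h) 0
    have h1 := congrFun (congrArg Prod.fst h) 1
    simp at h0 h1
    have : b * areaForm y x = 0 := by
      simp only [areaForm]
      linear_combination x 1 * h0 - x 0 * h1
    exact (mul_eq_zero.1 this).resolve_right hxy

theorem areaForm_regionVec_sub_one (n : ℤ) (u w : Fin 2 → ℤ) (k : ℤ) :
    areaForm (regionVec n u w (k - 1)) w = fibPolyZ n k * areaForm u w := by
  simp only [areaForm, regionVec, Pi.add_apply, Pi.smul_apply, smul_eq_mul, sub_add_cancel]; ring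

/-- The step of a walk that belongs to a twist region with `q` crossings. -/
def regionStep (n q : ℤ) : LatticeStep :=
  ⟨decide (q < 0), |n|, fibPoly |n| q.natAbs, fibPoly |n| (q.natAbs - 1)⟩

theorem regionStep_valid {n q N : ℤ} (hn : n ≠ 0) (hq : Odd q)
    (hN : |n| * fibPoly |n| q.natAbs = N) : (regionStep n q).Valid N := by
  obtain ⟨j, hj⟩ := Int.natAbs_odd.2 hq
  unfold regionStep
  rw [hj] at hN ⊢
  exact latticeStep_valid (abs_pos.2 hn) _ j hN

/-- The normalized areas of y and y' fix the signs in `hy` and `hy'`, since Fibonacci values at n >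
0 with odd index are positive. Then the coordinates are Fibonacci combinations of u and w, and
`fibPoly_sq` gives the step relation. -/
theorem rel_of_regionVec_of_pos {u w y y' : Fin 2 → ℤ} {e n N q : ℤ} (he : e = 1 ∨ e = -1)
    (hq : Odd q) (hn : n = e * areaForm u w) (hn0 : 0 < n) (hN : 0 < N)
    (hy : y = regionVec n u w q ∨ y = -regionVec n u w q)
    (hy' : y' = regionVec n u w (q - 1) ∨ y' = -regionVec n u w (q - 1))
    (ay : areaForm y u = -(e * N)) (ay' : areaForm y' w = -(e * N)) :
    |n| * fibPoly |n| q.natAbs = N ∧ ((regionStep n q).Rel (latticeShift N) (u, y) (w, y') ∨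
      (regionStep n q).Rel (latticeShift N) (u, y) (-(w, y'))) := by
  obtain ⟨j, hj⟩ := Int.natAbs_odd.2 hq
  have hF0 : 0 < fibPoly n (2 * j + 1) := fibPoly_pos hn0 _
  have hsq := fibPoly_sq n j
  have hArea : areaForm u w = e * n := by
    rw [hn, ← mul_assoc]; rcases he with rfl | rfl <;> ring
  have hArea' : areaForm w u = -(e * n) := by rw [← hArea]; simp only [areaForm]; ring
  have hneg : ∀ v x : Fin 2 → ℤ, areaForm (-v) x = - areaForm v x := by
    intro v x; simp only [areaForm, Pi.neg_apply]; ring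
  have ee : e * e = 1 := by rcases he with rfl | rfl <;> rfl
  have hFZ : fibPolyZ n q = fibPoly n (2 * j + 1) := by
    obtain ⟨k, hk | hk⟩ := q.eq_nat_or_neg
    · rw [hk, Int.natAbs_natCast] at hj
      rw [hk, hj, fibPolyZ_natCast]
    · rw [hk, Int.natAbs_neg, Int.natAbs_natCast] at hj
      rw [hk, hj, fibPolyZ_neg_natCast, show 2 * j + 1 + 1 = 2 * (j + 1) by ring, pow_mul]
      simp
  have hnF : n * fibPoly n (2 * j + 1) = N ∧ y = regionVec n u w q := by
    rcases hy with h | h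
    · rw [h, areaForm_regionVec, hFZ, hArea'] at ay
      exact ⟨by linear_combination (-e) * ay + (N - n * fibPoly n (2 * j + 1)) * ee, h⟩
    · rw [h, hneg, areaForm_regionVec, hFZ, hArea'] at ay
      have : n * fibPoly n (2 * j + 1) = -N := by
        linear_combination e * ay + (-N - n * fibPoly n (2 * j + 1)) * ee
      nlinarith
  have hy2 : y' = -regionVec n u w (q - 1) := by
    rcases hy' with h | h
    · rw [h, areaForm_regionVec_sub_one, hFZ, hArea] at ay'
      have : n * fibPoly n (2 * j + 1) = -N := by
        linear_combination e * ay' + (-N - n * fibPoly n (2 * j + 1)) * ee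
      nlinarith
    · exact h
  obtain ⟨hnF, hy1⟩ := hnF
  rw [abs_of_pos hn0, hj]
  refine ⟨hnF, ?_⟩
  rw [regionVec, hFZ] at hy1
  rw [regionVec, sub_add_cancel, hFZ] at hy2
  rw [regionStep, abs_of_pos hn0, hj, Nat.add_sub_cancel]
  simp only [LatticeStep.Rel, decide_eq_true_eq]
  obtain ⟨k, hk | hk⟩ := q.eq_nat_or_neg
  · right
    rw [hk, Int.natAbs_natCast] at hj
    have h1 : fibPolyZ n (q + 1) = n * fibPoly n (2 * j + 1) + fibPoly n (2 * j) := by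
      rw [hk, hj]; rfl
    have h2 : fibPolyZ n (q - 1) = fibPoly n (2 * j) := by
      rw [hk, hj]
      push_cast
      rw [add_sub_cancel_right]; exact fibPolyZ_natCast n (2 * j)
    rw [if_neg (by omega), hy1, hy2, h1, h2, ← hnF]
    ext i
    · simp [latticeShift]
    · simp [latticeShift]
      linear_combination w i * hsq
  · left
    rw [hk, Int.natAbs_neg, Int.natAbs_natCast] at hj
    have h1 : fibPolyZ n (q + 1) = -fibPoly n (2 * j) := by
      rw [hk, hj]
      push_cast
      rw [show (-(2 * (j : ℤ) + 1) + 1) = -((2 * j : ℕ) : ℤ) by push_cast; ring,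
        fibPolyZ_neg_natCast, pow_succ, pow_mul]
      simp
    have h2 : fibPolyZ n (q - 1) = -(n * fibPoly n (2 * j + 1) + fibPoly n (2 * j)) := by
      rw [hk, hj]
      push_cast
      rw [show (-(2 * (j : ℤ) + 1) - 1) = -((2 * j + 2 : ℕ) : ℤ) by push_cast; ring,
        fibPolyZ_neg_natCast, fibPoly_add_two, pow_succ, show 2 * j + 2 = 2 * (j + 1) by ring,
        pow_mul]
      simp
    rw [if_pos (by omega), hy1, hy2, h1, h2, ← hnF]
    ext i
    · simp [latticeShift]
    · simp [latticeShift]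
      linear_combination (-u i) * hsq

theorem rel_of_regionVec {u w y y' : Fin 2 → ℤ} {e n N q : ℤ} (he : e = 1 ∨ e = -1)
    (hq : Odd q) (hn : n = e * areaForm u w) (hn0 : n ≠ 0) (hN : 0 < N)
    (hy : y = regionVec n u w q ∨ y = -regionVec n u w q)
    (hy' : y' = regionVec n u w (q - 1) ∨ y' = -regionVec n u w (q - 1))
    (ay : areaForm y u = -(e * N)) (ay' : areaForm y' w = -(e * N)) :
    |n| * fibPoly |n| q.natAbs = N ∧ ((regionStep n q).Rel (latticeShift N) (u, y) (w, y') ∨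
      (regionStep n q).Rel (latticeShift N) (u, y) (-(w, y'))) := by
  rcases hn0.lt_or_gt with h | h
  -- Replacing w and y' by their negatives changes the sign of n, and so reduces to n > 0.
  · have hF : ∀ k : ℤ, Odd k → fibPolyZ (-n) k = fibPolyZ n k := by
      intro k hk
      obtain ⟨j, rfl | rfl⟩ := k.eq_nat_or_neg
      · rw [fibPolyZ_natCast, fibPolyZ_natCast, fibPoly_neg, (by exact_mod_cast hk.add_one :
          Even (j + 1)).neg_one_pow, one_mul]
      · rw [fibPolyZ_neg_natCast, fibPolyZ_neg_natCast, fibPoly_neg, (by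
          rw [odd_neg] at hk; exact_mod_cast hk.add_one : Even (j + 1)).neg_one_pow, one_mul]
    have hF' : ∀ k : ℤ, Even k → fibPolyZ (-n) k = -fibPolyZ n k := by
      intro k hk
      obtain ⟨j, rfl | rfl⟩ := k.eq_nat_or_neg
      · rw [fibPolyZ_natCast, fibPolyZ_natCast, fibPoly_neg, (by exact_mod_cast hk.add_one :
          Odd (j + 1)).neg_one_pow, neg_one_mul]
      · rw [fibPolyZ_neg_natCast, fibPolyZ_neg_natCast, fibPoly_neg, (by
          rw [even_neg] at hk; exact_mod_cast hk.add_one : Odd (j + 1)).neg_one_pow]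
        ring
    have e1 : regionVec (-n) u (-w) q = -regionVec n u w q := by
      rw [regionVec, regionVec, hF q hq, hF' _ hq.add_one]; module
    have e2 : regionVec (-n) u (-w) (q - 1) = regionVec n u w (q - 1) := by
      rw [regionVec, regionVec, sub_add_cancel, hF q hq, hF' _ (hq.sub_odd odd_one)]; module
    have := rel_of_regionVec_of_pos (u := u) (w := -w) (y := y) (y' := -y') he hq
      (n := -n) (by rw [hn]; simp only [areaForm, Pi.neg_apply]; ring) (neg_pos.2 h) hN
      (by rw [e1, neg_neg]; exact hy.symm)
      (by rw [e2]; exact hy'.symm.imp (fun h => by rw [h, neg_neg]) (fun h => by rw [h])) ay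
      (by rw [← ay']; simp only [areaForm, Pi.neg_apply]; ring)
    have e3 : regionStep (-n) q = regionStep n q := by rw [regionStep, regionStep, abs_neg]
    rw [abs_neg, e3] at this
    refine ⟨this.1, this.2.symm.imp (fun h => ?_) (fun h => ?_)⟩
    · simpa using h
    · exact h
  · exact rel_of_regionVec_of_pos he hq hn h hN hy hy' ay ay'

open Matrix in
theorem eq_or_eq_neg_of_transvec_eq {v z : Fin 2 → ℤ} {d e : ℤ} (hd : d = 1 ∨ d = -1)
    (he : e = 1 ∨ e = -1) (hv : v ≠ 0) (h : transvec v d = transvec z e) : v = z ∨ v = -z := by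
  have h' := congrArg (fun g : SpecialLinearGroup (Fin 2) ℤ => g.1) h
  have h00 := congrFun (congrFun h' 0) 0
  have h01 := congrFun (congrFun h' 0) 1
  have h10 := congrFun (congrFun h' 1) 0
  simp [transvec] at h00 h01 h10
  have key : v 0 ^ 2 = z 0 ^ 2 ∧ v 1 ^ 2 = z 1 ^ 2 ∧ v 0 * v 1 = z 0 * z 1 := by
    rcases hd with rfl | rfl <;> rcases he with rfl | rfl
    · exact ⟨by linarith, by linarith, by linarith⟩
    · exfalso; apply hv; ext i
      fin_cases i <;> simp <;> nlinarith [sq_nonneg (z 0), sq_nonneg (z 1)]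
    · exfalso; apply hv; ext i
      fin_cases i <;> simp <;> nlinarith [sq_nonneg (z 0), sq_nonneg (z 1)]
    · exact ⟨by linarith, by linarith, by linarith⟩
  obtain ⟨k0, k1, k2⟩ := key
  rcases sq_eq_sq_iff_eq_or_eq_neg.1 k0 with a | a <;>
    rcases sq_eq_sq_iff_eq_or_eq_neg.1 k1 with b | b
  · left; ext i; fin_cases i; exacts [a, b]
  · rw [a, b] at k2
    have : z 0 * z 1 = 0 := by linarith
    rcases mul_eq_zero.1 this with c | c
    · right; ext i; fin_cases i
      · simp [a, c]
      · exact b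
    · left; ext i; fin_cases i
      · exact a
      · simp [b, c]
  · rw [a, b] at k2
    have : z 0 * z 1 = 0 := by linarith
    rcases mul_eq_zero.1 this with c | c
    · left; ext i; fin_cases i
      · simp [a, c]
      · exact b
    · right; ext i; fin_cases i
      · exact a
      · simp [b, c]
  · right; ext i; fin_cases i; exacts [a, b]

end

/-! ### Lifted colorings in the plane -/

section

open BraidGroup

variable {m : ℕ} [NeZero m] {q : Fin m → ℤ}

/-- For m = 2 k + 1, adding two k + 1 times is adding one modulo m. -/
theorem Fin.eq_of_forall_add_two (hm : Odd m) {α : Type*} (f : Fin m → α)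
    (h : ∀ i, f (i + 1 + 1) = f i) (i j : Fin m) : f i = f j := by
  refine Fin.eq_of_forall_add_one f (fun i => ?_) i j
  obtain ⟨k, hk⟩ := hm
  have key : ∀ n : ℕ, ∀ i, f (i + Fin.ofNat m (2 * n)) = f i := by
    intro n
    induction n with
    | zero => intro i; congr 1; simp
    | succ n ih =>
      intro i
      rw [← ih i, ← h (i + Fin.ofNat m (2 * n))]
      congr 1
      ext
      simp only [Fin.val_add, Fin.val_ofNat, Fin.val_one', Nat.add_mod_mod, Nat.mod_add_mod]
      congr 1
  rw [← key (k + 1) i]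
  congr 1
  ext
  simp only [Fin.val_add, Fin.val_ofNat, Fin.val_one', Nat.add_mod_mod]
  rw [show i.val + 2 * (k + 1) = i.val + 1 + m by omega, Nat.add_mod_right]

variable {ψ : PretzelGroup q →* BraidGroup 4} {g h : Fin m → BraidGroup 4} {e d : Fin m → ℤ}

/-- In the abelianization a crossing only exchanges the two colors. -/
theorem exponent_region (hb : ∀ i, bottomColor ψ i = g i * sigma (n := 4) 0 ^ e i * (g i)⁻¹)
    (ht : ∀ i, topColor ψ i = h i * sigma (n := 4) 0 ^ d i * (h i)⁻¹) (i : Fin m) :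
    (Even (q i) → d i = e i) ∧ (Odd (q i) → d i = -e (i + 1) ∧ d (i + 1) = -e i) := by
  have h1 := crossing_zpow_map exponent (q i) (bottomColor ψ i, (bottomColor ψ (i + 1))⁻¹)
  rw [crossing_zpow_bottomColor] at h1
  simp only [Prod.map, map_inv, hb, ht, exponent_halfTwist] at h1
  refine ⟨fun hq => ?_, fun hq => ?_⟩
  · rw [crossing_zpow_of_commute_even (mul_comm _ _) hq, Prod.mk.injEq] at h1
    exact Multiplicative.ofAdd.injective h1.1
  · rw [crossing_zpow_of_commute_odd (mul_comm _ _) hq, Prod.mk.injEq, ← ofAdd_neg,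
      ← ofAdd_neg] at h1
    refine ⟨Multiplicative.ofAdd.injective h1.1, ?_⟩
    have := Multiplicative.ofAdd.injective h1.2
    linarith

theorem planeVec_ne_zero (g : BraidGroup 4) : planeVec g ≠ 0 := by
  intro h
  have := isCoprime_planeVec g
  rw [h] at this
  exact not_isCoprime_zero_zero this

theorem planeVec_region (he : ∀ i, e i = 1 ∨ e i = -1) (hd : ∀ i, d i = 1 ∨ d i = -1)
    (hb : ∀ i, bottomColor ψ i = g i * sigma (n := 4) 0 ^ e i * (g i)⁻¹)
    (ht : ∀ i, topColor ψ i = h i * sigma (n := 4) 0 ^ d i * (h i)⁻¹) {i : Fin m}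
    (hi : e (i + 1) = e i) {n : ℤ}
    (hn : n = e i * areaForm (planeVec (g i)) (planeVec (g (i + 1)))) :
    (planeVec (h i) = regionVec n (planeVec (g i)) (planeVec (g (i + 1))) (q i) ∨
      planeVec (h i) = -regionVec n (planeVec (g i)) (planeVec (g (i + 1))) (q i)) ∧
    (planeVec (h (i + 1)) = regionVec n (planeVec (g i)) (planeVec (g (i + 1))) (q i - 1) ∨
      planeVec (h (i + 1)) = -regionVec n (planeVec (g i)) (planeVec (g (i + 1))) (q i - 1)) := by
  have h1 := crossing_zpow_map planeRep (q i) (bottomColor ψ i, (bottomColor ψ (i + 1))⁻¹)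
  rw [crossing_zpow_bottomColor] at h1
  simp only [Prod.map, map_inv planeRep (_), hb, ht, planeRep_halfTwist _ (he _),
    planeRep_halfTwist _ (hd _), transvec_inv] at h1
  rw [hi, crossing_zpow_transvec, ← hn, Prod.mk.injEq] at h1
  have hs : ((q i).negOnePow : ℤ) * e i = 1 ∨ ((q i).negOnePow : ℤ) * e i = -1 := by
    rcases Int.units_eq_one_or (q i).negOnePow with h | h <;> rw [h] <;>
      rcases he i with h' | h' <;> rw [h'] <;> simp
  refine ⟨eq_or_eq_neg_of_transvec_eq (hd i) hs (planeVec_ne_zero _) h1.1,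
    eq_or_eq_neg_of_transvec_eq ?_ ?_ (planeVec_ne_zero _) h1.2⟩
  · rcases hd (i + 1) with h | h <;> simp [h]
  · rcases hs with h | h <;> simp [h]

/-- The area of bottom and top is, up to sign, the area of the two bottom vectors times a Fibonacci
value that is nonzero if the bottom area is. -/
theorem commute_of_areaForm_eq_zero (he : ∀ i, e i = 1 ∨ e i = -1)
    (hd : ∀ i, d i = 1 ∨ d i = -1)
    (hb : ∀ i, bottomColor ψ i = g i * sigma (n := 4) 0 ^ e i * (g i)⁻¹)
    (ht : ∀ i, topColor ψ i = h i * sigma (n := 4) 0 ^ d i * (h i)⁻¹) {i : Fin m}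
    (hi : e (i + 1) = e i) (hq : q i ≠ 0)
    (h0 : areaForm (planeVec (g i)) (planeVec (h i)) = 0) :
    Commute (bottomColor ((toPerm 4).comp ψ) i) (bottomColor ((toPerm 4).comp ψ) (i + 1)) := by
  have h1 : areaForm (planeVec (g i)) (planeVec (g (i + 1))) = 0 := by
    by_contra hne
    have hr := (planeVec_region he hd hb ht hi rfl).1
    set n := e i * areaForm (planeVec (g i)) (planeVec (g (i + 1))) with hn
    have hn0 : n ≠ 0 := mul_ne_zero (by rcases he i with h | h <;> simp [h]) hne
    have h2 := areaForm_regionVec n (planeVec (g i)) (planeVec (g (i + 1))) (q i)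
    have h3 : areaForm (regionVec n (planeVec (g i)) (planeVec (g (i + 1))) (q i))
        (planeVec (g i)) = 0 := by
      simp only [areaForm] at h0 ⊢
      rcases hr with hr | hr <;> rw [hr] at h0
      · linarith
      · simp only [Pi.neg_apply] at h0; linarith
    rw [h3] at h2
    refine mul_ne_zero (fibPolyZ_ne_zero hn0 hq) ?_ h2.symm
    intro h4
    apply hne
    simp only [areaForm] at h4 ⊢
    linarith
  have h2 := commute_toPerm_of_areaForm_eq_zero h1 (he i) (he (i + 1))
  rwa [← hb, ← hb] at h2

/-- All twist regions are odd, so all exponents agree. -/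
theorem exponent_eq_of_odd (hm : Odd m) (hq : ∀ i, Odd (q i))
    (hb : ∀ i, bottomColor ψ i = g i * sigma (n := 4) 0 ^ e i * (g i)⁻¹)
    (ht : ∀ i, topColor ψ i = h i * sigma (n := 4) 0 ^ d i * (h i)⁻¹) (i j : Fin m) :
    e i = e j := by
  refine Fin.eq_of_forall_add_two hm e (fun i => ?_) i j
  have h1 := ((exponent_region hb ht i).2 (hq i)).2
  have h2 := ((exponent_region hb ht (i + 1)).2 (hq _)).1
  linarith

/-- All twist regions but one are odd. -/
theorem exponent_eq_of_even (hm : Odd m) {i₀ : Fin m} (h₀ : Even (q i₀))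
    (hq : ∀ i, i ≠ i₀ → Odd (q i)) (he : ∀ i, e i = 1 ∨ e i = -1)
    (hb : ∀ i, bottomColor ψ i = g i * sigma (n := 4) 0 ^ e i * (g i)⁻¹)
    (ht : ∀ i, topColor ψ i = h i * sigma (n := 4) 0 ^ d i * (h i)⁻¹) :
    e (i₀ + 1) = e i₀ := by
  have hde : ∀ i, d i = e i := by
    intro i
    have h1 := exponent_sub_eq hb ht i i₀
    have h2 := (exponent_region hb ht i₀).1 h₀
    linarith
  have hstep : ∀ i, i ≠ i₀ → e i * e (i + 1) = -1 := by
    intro i hi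
    have h1 := ((exponent_region hb ht i).2 (hq i hi)).1
    rw [hde] at h1
    rw [h1]
    rcases he (i + 1) with h | h <;> rw [h] <;> norm_num
  -- Each exponent occurs twice in the cyclic product, so the even number m - 1 of sign changes
  -- leaves none at `i₀`.
  have hprod : ∏ i, (e i * e (i + 1)) = 1 := by
    have hshift : ∏ i, e (i + 1) = ∏ i, e i := Equiv.prod_comp (Equiv.addRight (1 : Fin m)) e
    rw [Finset.prod_mul_distrib, hshift, ← Finset.prod_mul_distrib]
    refine Finset.prod_eq_one fun i _ => ?_
    rcases he i with h | h <;> rw [h] <;> norm_num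
  rw [← Finset.mul_prod_erase _ _ (Finset.mem_univ i₀), Finset.prod_congr rfl (g := fun _ => -1)
    (fun i hi => hstep i (Finset.ne_of_mem_erase hi)), Finset.prod_const,
    Finset.card_erase_of_mem (Finset.mem_univ _), Finset.card_univ, Fintype.card_fin,
    (Nat.Odd.sub_odd hm odd_one).neg_one_pow, mul_one] at hprod
  rcases he i₀ with h | h <;> rw [h] at hprod ⊢ <;> linarith

/-- A lifted coloring gives a closed walk. -/
theorem exists_closed (hm : Odd m) (hq : ∀ i, Odd (q i))
    (he : ∀ i, e i = 1 ∨ e i = -1) (hd : ∀ i, d i = 1 ∨ d i = -1)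
    (hb : ∀ i, bottomColor ψ i = g i * sigma (n := 4) 0 ^ e i * (g i)⁻¹)
    (ht : ∀ i, topColor ψ i = h i * sigma (n := 4) 0 ^ d i * (h i)⁻¹)
    (hne : ∀ i, areaForm (planeVec (g i)) (planeVec (h i)) ≠ 0) :
    ∃ (N : ℤ) (n : Fin m → ℤ), (∀ i, n i ≠ 0) ∧
      (∀ i, |n i| * fibPoly |n i| (q i).natAbs = N) ∧
      LatticeStep.Closed (latticeShift N) 0
        ((List.range m).map fun j => regionStep (n (Fin.ofNat m j)) (q (Fin.ofNat m j))) := by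
  have hee : ∀ i, e (i + 1) = e i := fun i => exponent_eq_of_odd hm hq hb ht _ _
  set u : Fin m → Fin 2 → ℤ := fun i => planeVec (g i) with hu
  set v : Fin m → Fin 2 → ℤ := fun i => planeVec (h i) with hv
  set N : ℤ := |areaForm (u 0) (v 0)| with hN
  have hswap : ∀ x y : Fin 2 → ℤ, areaForm x y = -areaForm y x := by
    intro x y; simp only [areaForm]; ring
  have hNi : ∀ i, areaForm (v i) (u i) = N ∨ areaForm (v i) (u i) = -N := by
    intro i
    have h1 := areaForm_sq_eq he hd hb ht i 0
    have h2 := abs_eq_abs.2 (sq_eq_sq_iff_eq_or_eq_neg.1 h1)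
    rw [hswap]
    have h3 : |areaForm (u i) (v i)| = N := h2
    rcases abs_choice (areaForm (u i) (v i)) with h | h <;> rw [h] at h3
    · right; rw [h3]
    · left; exact h3
  have hN0 : 0 < N := abs_pos.2 (hne 0)
  set n : Fin m → ℤ := fun i => e i * areaForm (u i) (u (i + 1)) with hn
  have hreg := fun i => planeVec_region he hd hb ht (hee i) (n := n i) rfl
  have hn0 : ∀ i, n i ≠ 0 := by
    intro i h0
    have h1 : areaForm (u i) (u (i + 1)) = 0 := by
      rcases mul_eq_zero.1 h0 with h | h
      · rcases he i with h' | h' <;> omega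
      · exact h
    have h2 := areaForm_regionVec (n i) (u i) (u (i + 1)) (q i)
    rw [hswap (u (i + 1)), h1, neg_zero, mul_zero] at h2
    apply hne i
    simp only [areaForm] at h2 ⊢
    rcases (hreg i).1 with h | h <;> rw [h]
    · linarith
    · simp only [Pi.neg_apply]; linarith
  -- Vectors of transvections are defined up to sign; the sign is chosen to make the area -eᵢ N.
  have hy : ∀ i, ∃ y : Fin 2 → ℤ, areaForm y (u i) = -(e i * N) ∧ (y = v i ∨ y = -v i) := by
    intro i
    have hneg : areaForm (-v i) (u i) = -areaForm (v i) (u i) := by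
      simp only [areaForm, Pi.neg_apply]; ring
    rcases he i with h | h <;> rcases hNi i with h' | h' <;> rw [h]
    · exact ⟨_, by rw [hneg, h', one_mul], Or.inr rfl⟩
    · exact ⟨_, by rw [h', one_mul], Or.inl rfl⟩
    · exact ⟨_, by rw [h', neg_one_mul, neg_neg], Or.inl rfl⟩
    · exact ⟨_, by rw [hneg, h', neg_one_mul], Or.inr rfl⟩
  choose y hy hyv using hy
  have hpm : ∀ {a b c : Fin 2 → ℤ}, (a = b ∨ a = -b) → (b = c ∨ b = -c) → (a = c ∨ a = -c) := by
    rintro a b c (rfl | rfl) (rfl | rfl)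
    · exact Or.inl rfl
    · exact Or.inr rfl
    · exact Or.inr rfl
    · left; exact neg_neg c
  have hrel := fun i => rel_of_regionVec (he i) (hq i) (n := n i) rfl (hn0 i) hN0
    (hpm (hyv i) (hreg i).1) (hpm (hyv (i + 1)) (hreg i).2) (hy i) (by rw [← hee i]; exact hy (i + 1))
  have hnode : ∀ i, IsLatticeNode (latticeShift N) (u i, y i) := by
    intro i
    refine isLatticeNode_of_isCoprime (isCoprime_planeVec _) ?_
    rw [hy]
    rcases he i with h | h <;> rw [h] <;> omega
  have hcast : ∀ k : ℕ, Fin.ofNat m (k + 1) = Fin.ofNat m k + 1 := by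
    intro k; ext; simp [Fin.val_add]
  set p : Fin m → (Fin 2 → ℤ) × (Fin 2 → ℤ) := fun i => (u i, y i)
  have hneg : ∀ x, LinearEquiv.neg ℤ (latticeShift N x) = latticeShift N (LinearEquiv.neg ℤ x) := by
    intro x; exact (map_neg _ x).symm
  -- Each relation determines the next node up to sign. Negation commutes with J, so the sign can be
  -- carried to the end, where `Closed` allows it.
  have hwalk : ∀ k : ℕ, ∃ r, (r = p (Fin.ofNat m k) ∨ r = -p (Fin.ofNat m k)) ∧
      LatticeStep.Walk (latticeShift N) (p 0)
        ((List.range k).map fun j => regionStep (n (Fin.ofNat m j)) (q (Fin.ofNat m j))) r := by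
    intro k
    induction k with
    | zero => exact ⟨p 0, Or.inl rfl, rfl⟩
    | succ k ih =>
      obtain ⟨r, hr, hw⟩ := ih
      have hnext : ∃ r', (r' = p (Fin.ofNat m (k + 1)) ∨ r' = -p (Fin.ofNat m (k + 1))) ∧
          (regionStep (n (Fin.ofNat m k)) (q (Fin.ofNat m k))).Rel (latticeShift N) r r' := by
        rw [hcast]
        rcases hr with rfl | rfl
        · rcases (hrel (Fin.ofNat m k)).2 with h | h
          · exact ⟨_, Or.inl rfl, h⟩
          · exact ⟨_, Or.inr rfl, h⟩
        · rcases (hrel (Fin.ofNat m k)).2 with h | h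
          · exact ⟨_, Or.inr rfl, h.map (σ := LinearEquiv.neg ℤ) hneg⟩
          · refine ⟨_, Or.inl rfl, ?_⟩
            have := h.map (σ := LinearEquiv.neg ℤ) hneg
            rwa [LinearEquiv.neg_apply, LinearEquiv.neg_apply, neg_neg] at this
      obtain ⟨r', hr', hrr'⟩ := hnext
      refine ⟨r', hr', ?_⟩
      rw [List.range_succ, List.map_append]
      refine hw.append ⟨r', ?_, hrr', rfl⟩
      rcases hr' with rfl | rfl
      · exact hnode _
      · exact LatticeStep.isLatticeNode_map (σ := LinearEquiv.neg ℤ) hneg (hnode _)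
  refine ⟨N, n, hn0, fun i => (hrel i).1, p 0, hnode 0, ?_⟩
  obtain ⟨r, hr, hw⟩ := hwalk m
  have h0 : Fin.ofNat m m = 0 := by ext; simp
  rw [h0] at hr
  rcases hr with rfl | rfl
  · exact ⟨1, Or.inl fun x => rfl, hw⟩
  · exact ⟨LinearEquiv.neg ℤ, Or.inr fun x => rfl, hw⟩

end

/-! ### Pretzel knots -/

section

variable {m : ℕ} [NeZero m] {q : Fin m → ℤ}

/-- Two adjacent twist regions of a pretzel knot are not both even. -/
theorem IsPretzelKnot.not_even_even (hk : IsPretzelKnot q) {i : Fin m} (hi : i + 1 ≠ i)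
    (h1 : Even (q i)) : ¬ Even (q (i + 1)) := by
  intro h2
  -- The right strand of region i and the left strand of region i + 1 return to the same side after
  -- an even number of crossings, so they close up to a component of their own.
  let χ : PretzelStrand q → Prop := fun s =>
    (s.region = i ∧ (s.side = true ↔ Even s.level.val)) ∨
      (s.region = i + 1 ∧ (s.side = true ↔ ¬ Even s.level.val))
  have hJ : ∀ s t, PretzelStrand.Joined q s t → (χ s ↔ χ t) := by
    intro s t h
    cases h with
    | crossing_left j l => simp [χ, Nat.even_add_one, Nat.odd_add_one]
    | crossing_right j l => simp [χ, Nat.even_add_one]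
    | bottom j => simp [χ]
    | top j =>
      simp only [χ, Fin.val_last, true_iff, Bool.false_eq_true, false_iff, not_not,
        Int.natAbs_even, add_left_inj]
      constructor
      · rintro (⟨rfl, -⟩ | ⟨rfl, h⟩)
        · exact Or.inr ⟨rfl, h2⟩
        · exact absurd h2 h
      · rintro (⟨rfl, h⟩ | ⟨rfl, -⟩)
        · exact absurd h1 h
        · exact Or.inl ⟨rfl, h1⟩
  have key : ∀ s t, Relation.EqvGen (PretzelStrand.Joined q) s t → (χ s ↔ χ t) := by
    intro s t h
    induction h with
    | rel s t h => exact hJ s t h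
    | refl s => exact Iff.rfl
    | symm s t _ ih => exact ih.symm
    | trans s t r _ _ ih1 ih2 => exact ih1.trans ih2
  have h3 := key _ _ (hk (.right q i 0) (.left q i 0))
  have h4 : χ (.right q i 0) := Or.inl ⟨rfl, by simp⟩
  rcases h3.1 h4 with h | h
  · simpa using h.2
  · exact hi h.1.symm

end

/-! ### Colorings that do not lift -/

section

open BraidGroup Equiv

variable {m : ℕ} [NeZero m] {q : Fin m → ℤ} {φ : PretzelGroup q →* Perm (Fin 4)}

/-- Commuting colors are exchanged by an odd region, so bottom colors two regions apart agree, and m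
is odd. -/
theorem isConstantColoring_of_commute (hm : Odd m) (hq : ∀ i, Odd (q i))
    (hφ : IsSimplePermColoring φ)
    (h : ∀ i, Commute (bottomColor φ i) (bottomColor φ (i + 1))) : IsConstantColoring φ := by
  have h1 : ∀ i, topColor φ i = bottomColor φ (i + 1) ∧ topColor φ (i + 1) = bottomColor φ i := by
    intro i
    have := hφ.crossing_zpow i
    rw [crossing_zpow_of_commute_odd (h i).eq (hq i), Prod.mk.injEq] at this
    exact ⟨this.1.symm, this.2.symm⟩
  have h2 : ∀ i, bottomColor φ i = bottomColor φ 0 := fun i =>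
    Fin.eq_of_forall_add_two hm (bottomColor φ)
      (fun i => (h1 (i + 1)).1.symm.trans (h1 i).2) i 0
  have h3 : ∀ s, φ (PretzelGroup.meridian s) = bottomColor φ 0 := by
    rintro ⟨i, l, s⟩
    have := map_level φ i l
    rw [(hφ.bottomColor (i + 1)).inv_eq, h2, h2 (i + 1), crossing_zpow_self,
      Prod.mk.injEq] at this
    cases s
    · exact this.1
    · exact this.2
  intro s t
  rw [h3, h3]

theorem not_surjective_of_isConstantColoring (h : IsConstantColoring φ) :
    ¬ Function.Surjective φ := by
  intro hs
  have hcomm : ∀ x, bottomColor φ 0 * x = x * bottomColor φ 0 := by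
    have h1 : ∀ i, bottomColor φ i = bottomColor φ 0 := fun i => h _ _
    intro x
    obtain ⟨y, rfl⟩ := hs x
    exact (Subgroup.mem_centralizer_singleton_iff.1 (map_mem_of_bottomColor_mem φ
      (Subgroup.centralizer {bottomColor φ 0}) (fun i => by
        rw [Subgroup.mem_centralizer_singleton_iff, h1]) y)).symm
  have h1 : bottomColor φ 0 = 1 := by
    revert hcomm
    generalize bottomColor φ 0 = x
    revert x; decide
  have h2 : ∀ y, φ y = 1 := fun y => by
    have := map_mem_of_bottomColor_mem φ ⊥ (fun i => by
      rw [Subgroup.mem_bot, ← h1]; exact h _ _) y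
    rwa [Subgroup.mem_bot] at this
  obtain ⟨y, hy⟩ := hs (swap 0 1)
  rw [h2] at hy
  exact absurd hy (by decide)

/-- Two transpositions do not generate the symmetric group. -/
theorem not_surjective_of_two_colors {x y : Perm (Fin 4)} (hx : x.IsSwap) (hy : y.IsSwap)
    (h : ∀ i, bottomColor φ i = x ∨ bottomColor φ i = y) : ¬ Function.Surjective φ := by
  intro hs
  obtain ⟨a, b, -, rfl⟩ := hx
  obtain ⟨c, d, -, rfl⟩ := hy
  -- Two edges cannot connect four points, so some two-valued function is constant on both.
  have key : ∀ a b c d : Fin 4, ∃ H : Fin 4 → Fin 2, H a = H b ∧ H c = H d ∧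
      ∃ i j, H i ≠ H j := by decide
  obtain ⟨H, h1, h2, i, j, hij⟩ := key a b c d
  have hinv := map_invariant_of_bottomColor φ (fun x => (H x : ℤ)) (fun i x => by
    rcases h i with h | h <;> rw [h, swap_apply_def] <;> split_ifs with e1 e2 <;>
      simp [*])
  obtain ⟨z, hz⟩ := hs (swap i j)
  have := hinv z i
  rw [hz, swap_apply_left] at this
  exact hij (Fin.ext (by exact_mod_cast this.symm))

/-- All twist regions but one are odd. -/
theorem commute_of_lifts (hm : Odd m) {i₀ : Fin m} (h₀ : Even (q i₀))
    (hq : ∀ i, i ≠ i₀ → Odd (q i)) (hs : Function.Surjective φ)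
    (hl : LiftsToSimpleBraidColoring φ) (hne : q i₀ ≠ 0) :
    Commute (bottomColor φ i₀) (bottomColor φ (i₀ + 1)) := by
  obtain ⟨ψ, hψ, rfl⟩ := hl
  obtain ⟨g, h, e, d, he, hd, hb, ht⟩ := hψ.exists_conj
  exact commute_of_areaForm_eq_zero he hd hb ht (exponent_eq_of_even hm h₀ hq he hb ht) hne
    (areaForm_eq_zero_of_surjective he hd hb ht hs i₀)

theorem not_surjective_of_lifts (hm : Odd m) (hq : ∀ i, Odd (q i))
    (hφ : IsSimplePermColoring φ) (hl : LiftsToSimpleBraidColoring φ) :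
    ¬ Function.Surjective φ := by
  intro hs
  refine not_surjective_of_isConstantColoring ?_ hs
  obtain ⟨ψ, hψ, rfl⟩ := hl
  obtain ⟨g, h, e, d, he, hd, hb, ht⟩ := hψ.exists_conj
  refine isConstantColoring_of_commute hm hq hφ fun i => ?_
  exact commute_of_areaForm_eq_zero he hd hb ht (exponent_eq_of_odd hm hq hb ht _ _)
    (fun h0 => by have := hq i; rw [h0] at this; simp at this)
    (areaForm_eq_zero_of_surjective he hd hb ht hs i)

theorem one_lt_fibPoly {n : ℤ} (hn : n ≠ 0) {q : ℤ} (hq : Odd q) (h1 : |q| ≠ 1) :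
    2 ≤ |n| * fibPoly |n| q.natAbs := by
  have hv := regionStep_valid hn hq rfl
  have hn' : 0 < |n| := abs_pos.2 hn
  have hF : fibPoly |n| q.natAbs ≠ 1 := by
    obtain ⟨j, hj⟩ := Int.natAbs_odd.2 hq
    rw [hj]
    match j with
    | 0 => exact absurd (by rw [Int.abs_eq_natAbs, hj]; rfl) h1
    | 1 => simp only [fibPoly]; nlinarith
    | j + 2 => have := fibPoly_shape hn' j; nlinarith [sq_nonneg (|n|), sq_nonneg (|n| ^ 2)]
  have := hv.sq_add_one_le hF
  change |n| ^ 2 + 1 ≤ fibPoly |n| q.natAbs at this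
  nlinarith

theorem two_lt_fibPoly {n : ℤ} (hn : n ≠ 0) {q : ℤ} (hq : Odd q) (h1 : 3 < |q|) :
    3 ≤ |n| * fibPoly |n| q.natAbs := by
  have hn' : 0 < |n| := abs_pos.2 hn
  rw [Int.abs_eq_natAbs] at h1
  obtain ⟨j, hj⟩ := Int.natAbs_odd.2 hq
  obtain ⟨i, rfl⟩ : ∃ i, j = i + 2 := ⟨j - 2, by omega⟩
  have := fibPoly_shape hn' i
  rw [hj]
  nlinarith [sq_nonneg (|n|), sq_nonneg (|n| ^ 2)]

/-- All twist regions are odd. -/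
theorem not_lifts_of_odd (hm : Odd m) (hq : ∀ i, Odd (q i))
    (hcase : (∃ p, 3 < |q p|) ∨ ((∀ j, 0 < q j) ∨ ∀ j, q j < 0))
    (hφ : IsSimplePermColoring φ) (hc : ¬ IsConstantColoring φ)
    (h' : Function.Surjective φ ∨ ∃ i, |q i| ≠ 1) : ¬ LiftsToSimpleBraidColoring φ := by
  intro hl
  -- Surjective colorings are excluded already; what remains is a region with at least three
  -- crossings, which makes N ≥ 2.
  obtain ⟨p, hp⟩ := h'.resolve_left (not_surjective_of_lifts hm hq hφ hl)
  obtain ⟨ψ, hψ, rfl⟩ := hl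
  obtain ⟨g, h, e, d, he, hd, hb, ht⟩ := hψ.exists_conj
  have hne : ∀ i, areaForm (planeVec (g i)) (planeVec (h i)) ≠ 0 := by
    intro i h0
    refine hc (isConstantColoring_of_commute hm hq hφ fun j => ?_)
    refine commute_of_areaForm_eq_zero he hd hb ht (exponent_eq_of_odd hm hq hb ht _ _)
      (fun h0 => by have := hq j; rw [h0] at this; simp at this) ?_
    have := areaForm_sq_eq he hd hb ht j i
    rw [h0] at this
    exact pow_eq_zero_iff two_ne_zero |>.1 (this.trans (by norm_num))
  obtain ⟨N, n, hn, hN, hC⟩ := exists_closed hm hq he hd hb ht hne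
  have hvalid : ∀ a ∈ (List.range m).map fun j =>
      regionStep (n (Fin.ofNat m j)) (q (Fin.ofNat m j)), a.Valid N := by
    intro a ha
    obtain ⟨j, -, rfl⟩ := List.mem_map.1 ha
    exact regionStep_valid (hn _) (hq _) (hN _)
  have hsame : ∀ s : Bool, (∀ j, decide (q j < 0) = s) → False := by
    intro s hs
    refine LatticeStep.not_closed_zero_of_fwd_eq (latticeShift_latticeShift N) ?_ hvalid ?_ s ?_ hC
    · rw [← hN p]; exact one_lt_fibPoly (hn p) (hq p) hp
    · simp [NeZero.ne m]
    · intro a ha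
      obtain ⟨j, -, rfl⟩ := List.mem_map.1 ha
      exact hs _
  rcases hcase with ⟨i, hi⟩ | h | h
  · have := LatticeStep.even_length_add (latticeShift_latticeShift N)
      (by rw [← hN i]; exact two_lt_fibPoly (hn i) (hq i) hi) m _ 0 (by simp) hvalid hC
    rw [add_zero, Int.even_coe_nat] at this
    exact Nat.not_even_iff_odd.2 hm this
  · exact hsame false fun j => by simpa using (h j).le
  · exact hsame true fun j => by simpa using h j

end

/-! ### The four statements together -/

theorem Fin.three_adjacent : ∀ i j : Fin 3, j = i ∨ j = i + 1 ∨ i = j + 1 := by decide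

theorem Fin.three_cases : ∀ i j : Fin 3, j = i ∨ j = i + 1 ∨ j = i + 1 + 1 := by decide

theorem Fin.three_succ_ne : ∀ i : Fin 3, i + 1 ≠ i := by decide

theorem mainTheorem9 {m : ℕ} [NeZero m] (q : Fin m → ℤ) (hknot : IsPretzelKnot q) :
    -- three twist regions
    (m = 3 → ∀ φ : PretzelGroup q →* Equiv.Perm (Fin 4), IsSimplePermColoring φ →
      ((∃ i, Even (q i) ∧ (q i ≠ 0 → DisjointInRegion φ i)) → LiftsToSimpleBraidColoring φ) ∧
      (Function.Surjective φ → LiftsToSimpleBraidColoring φ →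
        ∃ i, Even (q i) ∧ (q i ≠ 0 → DisjointInRegion φ i))) ∧
    -- everything odd
    (Odd m → (∀ i, Odd (q i)) →
      ((∃ j, (q j = q (j + 1) ∨ q j = -q (j + 1)) ∧ 3 ≤ |q j|) ∧ (∃ p, 3 < |q p|) ∨
        ((∀ j, 0 < q j) ∨ (∀ j, q j < 0))) →
      ∀ φ : PretzelGroup q →* Equiv.Perm (Fin 4), IsSimplePermColoring φ →
        ¬ IsConstantColoring φ → (Function.Surjective φ ∨ ∃ i, |q i| ≠ 1) →
        ¬ LiftsToSimpleBraidColoring φ) ∧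
    -- the number of regions and the first entry even
    (Even m → Even (q 0) → (∀ j, j ≠ 0 → Odd (q j)) →
      ∀ φ : PretzelGroup q →* Equiv.Perm (Fin 4), IsSimplePermColoring φ →
        (Function.Surjective φ ∨ ∃ i, 3 ∣ q i) → LiftsToSimpleBraidColoring φ) ∧
    -- the number of regions odd and the first entry even
    (Odd m → Even (q 0) → (∀ j, j ≠ 0 → Odd (q j)) →
      ∀ φ : PretzelGroup q →* Equiv.Perm (Fin 4), IsSimplePermColoring φ →
        (q 0 = 0 ∨ DisjointInRegion φ 0 ∨ IdenticalInRegion φ 0 →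
          LiftsToSimpleBraidColoring φ) ∧
        (Function.Surjective φ → LiftsToSimpleBraidColoring φ →
          q 0 = 0 ∨ DisjointInRegion φ 0 ∨ IdenticalInRegion φ 0)) := by
  refine ⟨?_, ?_, ?_, ?_⟩
  · intro hm φ hφ
    have hodd : Odd m := hm ▸ by decide
    refine ⟨?_, fun hs hl => ?_⟩
    · rintro ⟨i, hi, h⟩
      refine lifts_of_commute hi hφ ?_
      by_cases h0 : q i = 0
      · exact Or.inl h0
      · exact Or.inr (commute_of_disjointInRegion (h h0))
    · have hex : ∃ i, Even (q i) := by
        by_contra! hc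
        exact not_surjective_of_lifts hodd (fun i => Int.not_even_iff_odd.1 (hc i)) hφ hl hs
      obtain ⟨i, hi⟩ := hex
      have hadj : ∀ j, j = i ∨ j = i + 1 ∨ i = j + 1 := by
        subst hm
        exact Fin.three_adjacent i
      have hne : ∀ j : Fin m, j + 1 ≠ j := by
        subst hm
        exact Fin.three_succ_ne
      -- Any two of three regions are adjacent, and adjacent even regions would split off a
      -- component.
      have hothers : ∀ j, j ≠ i → Odd (q j) := by
        intro j hj
        rw [← Int.not_even_iff_odd]
        intro hje
        rcases hadj j with rfl | rfl | rfl
        · exact hj rfl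
        · exact hknot.not_even_even (hne i) hi hje
        · exact hknot.not_even_even (hne j) hje hi
      refine ⟨i, hi, fun h0 => ?_⟩
      refine (disjoint_or_identical_of_commute hφ
        (commute_of_lifts hodd hi hothers hs hl h0)).resolve_right fun hid => ?_
      -- Identical colors in region i leave only two different bottom colors among the three.
      refine not_surjective_of_two_colors (hφ.bottomColor i) (hφ.bottomColor (i + 1 + 1))
        (fun j => ?_) hs
      have hcov : j = i ∨ j = i + 1 ∨ j = i + 1 + 1 := by
        subst hm
        exact Fin.three_cases i j
      rcases hcov with rfl | rfl | rfl
      · exact Or.inl rfl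
      · exact Or.inl (bottomColor_eq_of_identicalInRegion hφ hid).symm
      · exact Or.inr rfl
  · intro hm hq h φ hφ hc h'
    exact not_lifts_of_odd hm hq (h.imp (fun h => h.2) id) hφ hc h'
  · intro hm h0 _ φ hφ h
    exact lifts_of_even_length hm h0 hφ h
  · intro hm h0 hq φ hφ
    refine ⟨fun h => lifts_of_commute h0 hφ (h.imp id fun h => ?_), fun hs hl => ?_⟩
    · rcases h with h | h
      · exact commute_of_disjointInRegion h
      · exact bottomColor_eq_of_identicalInRegion hφ h ▸ Commute.refl _
    · by_cases hne : q 0 = 0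
      · exact Or.inl hne
      · exact Or.inr (disjoint_or_identical_of_commute hφ (commute_of_lifts hm h0 hq hs hl hne))
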